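/- Let $k$ be a field of characteristic $0$ and let $\mathcal R$ be the ring of formal power series in $\epsilon$ whose coefficients are polynomials over $k$ in $e^{\pm u}$ and the jet variables $v^{(m)}=\partial_x^m v$, $u^{(m)}=\partial_x^m u$ ($m\ge 0$), where $w^1=v$, $w^2=u$. Let $\Lambda=e^{\epsilon\partial_x}$ and $$L=\Lambda+v+e^{u}\Lambda^{-1}.$$ Let $P=\sum_{j\ge 0}p_j\Lambda^{-j}$ with $p_0=1$, and $Q=\sum_{j\ge 0}q_j\Lambda^{j}$ invertible, be dressing operators, $L=P\Lambda P^{-1}=Q\Lambda^{-1}Q^{-1}$, with coefficients in the extension of $\mathcal R$ obtained by adjoining formal power series in $x$ and $\epsilon^{-1}$ (that is, Laurent series in $\epsilon$ over power series in $x$ over the differential polynomials) and then an invertible symbol $\theta=\exp\big((1-\Lambda^{-1})^{-1}u\big)$, with $\Lambda^{-1}\theta=e^{-u}\theta$. Put $$\log L=\tfrac12\big(P\,\epsilon\partial_x P^{-1}-Q\,\epsilon\partial_x Q^{-1}\big)=\tfrac12\big(\epsilon Q_xQ^{-1}-\epsilon P_xP^{-1}\big).$$ For $\sum_j B_j\Lambda^j$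 write $B_+=\sum_{j\ge0}B_j\Lambda^j$ and $\operatorname{res}B=B_0$; let $c_0=0$, $c_p=1+\frac12+\dots+\frac1p$. The extended Toda hierarchy is the family of evolutionary flows $\partial w^\alpha/\partial t^{\beta,q}\in\mathcal R$ ($\alpha,\beta\in\{1,2\}$, $q\ge0$) given by $$\epsilon\frac{\partial L}{\partial t^{\beta,q}}=[A_{\beta,q},L],\qquad A_{1,q}=\frac{2}{q!}\big[L^q(\log L-c_q)\big]_+,\qquad A_{2,q}=\frac1{(q+1)!}\big[L^{q+1}\big]_+,$$ where each $\partial/\partial t^{\beta,q}$ acts on $\mathcal R$ as the $\epsilon$-linear derivation commuting with $\partial_x$ that it determines; its Hamiltonian densities are, for $p\ge0$, $$h_{1,p-1}=\frac{2}{p!}\operatorname{res}\big[L^{p}(\log L-c_{p})\big],\qquad h_{2,p-1}=\frac{1}{(p+1)!}\operatorname{res}L^{p+1}.$$ Theorem 4.2 (tau-symmetry). These objects exist: there are dressing operators for which $\log L$ has coefficients in $\mathcal R$, and for every $\log L$ with coefficients in $\mathcal R$ obtained from dressing operators there are flows with components in $\mathcal R$ satisfying the equations above. For every such $\log L$ and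 every such family of flows, $$\frac{\partial h_{\alpha,p-1}}{\partial t^{\beta,q}}=\frac{\partial h_{\beta,q-1}}{\partial t^{\alpha,p}}\qquad\text{in }\mathcal R,\qquad \alpha,\beta\in\{1,2\},\ p,q\ge 0.$$ -/

import Mathlib

noncomputable section

namespace ExtendedToda

/-- The label set `{1, 2}` of the dependent variables `w¹ = v`, `w² = u` and of the two families
of times. -/
inductive Label : Type
  | one
  | two
  deriving DecidableEq

/-! ### The ring of differential polynomials and its completion in `ε` -/

/-- Differential polynomials: polynomials over `k` in the jet variables `w^{α,m} = ∂ₓᵐ w^α`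
and in `e^u`, `e^{-u}`. The Laurent variable `T` is `e^u`. -/
abbrev Jet (k : Type*) [Field k] : Type _ := LaurentPolynomial (MvPolynomial (Label × ℕ) k)

/-- The ring `𝓡` of formal power series in `ε` with differential polynomials as coefficients. -/
abbrev DiffRing (k : Type*) [Field k] : Type _ := PowerSeries (Jet k)

variable {k : Type*} [Field k]

/-- The jet variable `w^{α,m}`: `v^{(m)}` for `α = 1` and `u^{(m)}` for `α = 2`. -/
def jetVar (α : Label) (m : ℕ) : Jet k := LaurentPolynomial.C (MvPolynomial.X (α, m))

/-- The element `e^{n u}`. -/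
def expU (n : ℤ) : Jet k := LaurentPolynomial.T n

/-- The partial derivative with respect to the jet variable `w^{α,m}`, `a = (α, m)`,
in which `∂ e^{n u} / ∂u = n e^{n u}`. -/
def partialD (a : Label × ℕ) (f : Jet k) : Jet k :=
  f.coeff.sum fun n c =>
    LaurentPolynomial.C (MvPolynomial.pderiv a c) * expU n +
      if a = (Label.two, 0) then n • (LaurentPolynomial.C c * expU n) else 0

/-- `∑_{α,m} (∂f/∂w^{α,m}) Y^{α,m}` (a finite sum, since `f` involves finitely many variables). -/
def derivAlong {M : Type*} [AddCommGroup M] [Module (Jet k) M] (Y : Label × ℕ → M) (f : Jet k) :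
    M :=
  ∑ᶠ a : Label × ℕ, partialD a f • Y a

/-- The total `x`-derivative `∂ₓ = ∑ w^{α,m+1} ∂/∂w^{α,m}` on differential polynomials. -/
def dx (f : Jet k) : Jet k := derivAlong (fun a => jetVar a.1 (a.2 + 1)) f

/-- The total `x`-derivative on `𝓡`. -/
def dxR (f : DiffRing k) : DiffRing k := PowerSeries.mk fun n => dx (PowerSeries.coeff n f)

/-- The formal parameter `ε` as an element of `𝓡`. -/
def eps : DiffRing k := PowerSeries.X

/-- The shift `Λʲ = e^{jε∂ₓ} = ∑ (jε)ᵐ ∂ₓᵐ / m!` on `𝓡`, i.e. `f(x) ↦ f(x + jε)`. -/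
def shift (j : ℤ) (f : DiffRing k) : DiffRing k :=
  PowerSeries.mk fun n => ∑ p ∈ Finset.HasAntidiagonal.antidiagonal n,
    ((j : k) ^ p.1 / (p.1.factorial : k)) • dx^[p.1] (PowerSeries.coeff p.2 f)

/-- The derivative `∂f/∂t` along the evolutionary flow `∂w^α/∂t = X^α`, `X^α ∈ 𝓡`:
it is `ε`-linear and `∂w^{α,m}/∂t = ∂ₓᵐ X^α`. -/
def evolve (X : Label → DiffRing k) (f : DiffRing k) : DiffRing k :=
  PowerSeries.mk fun n => ∑ p ∈ Finset.HasAntidiagonal.antidiagonal n,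
    PowerSeries.coeff p.1
      (derivAlong (fun a : Label × ℕ => dxR^[a.2] (X a.1)) (PowerSeries.coeff p.2 f))

/-! ### Difference operators -/

/-- The product of the difference operators `∑ Aᵢ Λⁱ` and `∑ Bⱼ Λʲ`, given by their coefficients,
with respect to a shift action `f ↦ Λʲ f`. It is used only where every coefficient of the product
is a finite sum. -/
def opMul {R : Type*} [CommRing R] (sh : ℤ → R → R) (A B : ℤ → R) : ℤ → R :=
  fun n => ∑ᶠ i : ℤ, A i * sh i (B (n - i))

/-- The operator `Λʲ`. -/
def opShift {R : Type*} [CommRing R] (j : ℤ) : ℤ → R := fun n => if n = j then 1 else 0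

/-- Powers of a difference operator. -/
def opPow {R : Type*} [CommRing R] (sh : ℤ → R → R) (A : ℤ → R) : ℕ → ℤ → R
  | 0 => opShift 0
  | p + 1 => opMul sh (opPow sh A p) A

/-- The commutator `[A, B] = A B - B A`. -/
def opComm {R : Type*} [CommRing R] (sh : ℤ → R → R) (A B : ℤ → R) : ℤ → R :=
  opMul sh A B - opMul sh B A

/-- The part `B₊ = ∑_{j ≥ 0} Bⱼ Λʲ`. -/
def opPlus {R : Type*} [CommRing R] (B : ℤ → R) : ℤ → R := fun n => if 0 ≤ n then B n else 0

/-- The residue `res B = B₀`. -/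
def opRes {R : Type*} (B : ℤ → R) : R := B 0

/-- The Lax operator `L = Λ + v + e^u Λ⁻¹`. -/
def lax (k : Type*) [Field k] : ℤ → DiffRing k := fun n =>
  if n = 1 then 1
  else if n = 0 then PowerSeries.C (jetVar Label.one 0)
  else if n = -1 then PowerSeries.C (expU 1)
  else 0

/-! ### The extension of `𝓡` that contains the coefficients of the dressing operators

First adjoin to the differential polynomials formal power series in `x` itself and invert `ε`
(so that `∂ₓ` and `Λ - 1` become onto); then adjoin an invertible symbol
`q = exp ((1 - Λ⁻¹)⁻¹ u)`. -/

/-- Formal power series in `x` whose coefficients are differential polynomials. -/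
abbrev JetX (k : Type*) [Field k] : Type _ := PowerSeries (Jet k)

lemma dx_zero : dx (0 : Jet k) = 0 := by
  simp [dx, derivAlong, partialD]

/-- The total `x`-derivative on `JetX k`; in addition to its action on jets, `∂ₓ x = 1`. -/
def dxX (F : JetX k) : JetX k := PowerSeries.mk fun n =>
  dx (PowerSeries.coeff n F) + ((n + 1 : ℕ) : Jet k) * PowerSeries.coeff (n + 1) F

lemma dxX_zero : dxX (0 : JetX k) = 0 := by
  ext n : 1
  simp [dxX, dx_zero]

lemma dxX_iterate_zero (m : ℕ) : dxX^[m] (0 : JetX k) = 0 :=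
  Function.iterate_fixed dxX_zero m

/-- Formal Laurent series in `ε` with coefficients in `JetX k`. -/
abbrev LaurentJetX (k : Type*) [Field k] : Type _ := LaurentSeries (JetX k)

instance instCommRingLaurentJetX : CommRing (LaurentJetX k) := HahnSeries.instCommRing

/-- The operator `ε∂ₓ` on `LaurentJetX k`. -/
def epsDxL (F : LaurentJetX k) : LaurentJetX k :=
  HahnSeries.ofSuppBddBelow (fun n => dxX (F.coeff (n - 1))) <| by
    refine ⟨F.order, fun n hn => ?_⟩
    by_contra hlt
    exact hn (by
      show dxX (F.coeff (n - 1)) = 0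
      rw [HahnSeries.coeff_eq_zero_of_lt_order (by omega), dxX_zero])

/-- The shift `Λʲ = e^{jε∂ₓ}` on `LaurentJetX k` (every coefficient is a finite sum). -/
def shiftL (j : ℤ) (F : LaurentJetX k) : LaurentJetX k :=
  HahnSeries.ofSuppBddBelow
    (fun n => ∑ᶠ m : ℕ, ((j : k) ^ m / (m.factorial : k)) • dxX^[m] (F.coeff (n - m))) <| by
    refine ⟨F.order, fun n hn => ?_⟩
    by_contra hlt
    refine hn (finsum_eq_zero_of_forall_eq_zero fun m => ?_)
    rw [HahnSeries.coeff_eq_zero_of_lt_order (by omega), dxX_iterate_zero, smul_zero]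

/-- The inclusion of `𝓡` into `LaurentJetX k`. -/
def inclL : DiffRing k →+* LaurentJetX k :=
  (HahnSeries.ofPowerSeries ℤ (JetX k)).comp (PowerSeries.map PowerSeries.C)

/-- `𝓑₋ u = (1 - Λ⁻¹)⁻¹ ε∂ₓ u = ∑ (B_m / m!) (-ε∂ₓ)ᵐ u`, with the Bernoulli numbers
`B_m` (`B₁ = -1/2`). -/
def bMinusU (k : Type*) [Field k] : DiffRing k := PowerSeries.mk fun m =>
  (((bernoulli m : ℚ) : k) / (m.factorial : k) * (-1) ^ m) • dx^[m] (jetVar Label.two 0)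

/-- The ring of Laurent polynomials over `LaurentJetX k` in the symbol
`q = exp ((1 - Λ⁻¹)⁻¹ u)`, the Laurent variable. -/
abbrev DressingRing (k : Type*) [Field k] : Type _ := LaurentPolynomial (LaurentJetX k)

/-- The inclusion of `𝓡` into the dressing ring. -/
def incl : DiffRing k →+* DressingRing k := LaurentPolynomial.C.comp inclL

/-- The operator `ε∂ₓ` on the dressing ring, where `ε∂ₓ q = (𝓑₋ u) q`. -/
def epsDx (F : DressingRing k) : DressingRing k :=
  F.coeff.sum fun n c =>
    LaurentPolynomial.C (epsDxL c + n • (inclL (bMinusU k) * c)) * LaurentPolynomial.T n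

/-- The factor `(Λʲ q / q)ⁿ`, determined by `Λ⁻¹ q = e^{-u} q`. -/
def qShiftFactor (j n : ℤ) : DiffRing k :=
  (∏ i ∈ Finset.range j.toNat, shift ((i : ℤ) + 1) (PowerSeries.C (expU n))) *
    ∏ i ∈ Finset.range (-j).toNat, shift (-(i : ℤ)) (PowerSeries.C (expU (-n)))

/-- The shift `Λʲ` on the dressing ring. -/
def shiftD (j : ℤ) (F : DressingRing k) : DressingRing k :=
  F.coeff.sum fun n c =>
    LaurentPolynomial.C (shiftL j c * inclL (qShiftFactor j n)) * LaurentPolynomial.T n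

/-! ### Dressing operators and the logarithm of `L` -/

/-- The Lax operator over the dressing ring. -/
def laxD (k : Type*) [Field k] : ℤ → DressingRing k := fun n => incl (lax k n)

/-- `P = ∑_{j ≥ 0} p_j Λ^{-j}`, `p₀ = 1`, with inverse `P' = P⁻¹` of the same shape, satisfies
`L = P Λ P⁻¹`. -/
structure IsDressingP (P P' : ℤ → DressingRing k) : Prop where
  supp : ∀ n, 0 < n → P n = 0
  supp_inv : ∀ n, 0 < n → P' n = 0
  lead : P 0 = 1
  mul_inv : opMul shiftD P P' = opShift 0
  inv_mul : opMul shiftD P' P = opShift 0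
  dress : opMul shiftD (opMul shiftD P (opShift 1)) P' = laxD k

/-- `Q = ∑_{j ≥ 0} q_j Λ^j`, with inverse `Q' = Q⁻¹` of the same shape, satisfies
`L = Q Λ⁻¹ Q⁻¹`. -/
structure IsDressingQ (Q Q' : ℤ → DressingRing k) : Prop where
  supp : ∀ n, n < 0 → Q n = 0
  supp_inv : ∀ n, n < 0 → Q' n = 0
  mul_inv : opMul shiftD Q Q' = opShift 0
  inv_mul : opMul shiftD Q' Q = opShift 0
  dress : opMul shiftD (opMul shiftD Q (opShift (-1))) Q' = laxD k

/-- The operator `∑ gⱼ Λʲ` with coefficients in `𝓡` is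
`log L = (P ε∂ₓ P⁻¹ - Q ε∂ₓ Q⁻¹) / 2` for some choice of the dressing operators. Since
`P ε∂ₓ P⁻¹ = ε∂ₓ - ε Pₓ P⁻¹` and `Q ε∂ₓ Q⁻¹ = ε∂ₓ - ε Qₓ Q⁻¹`, this says
`2 log L = ε Qₓ Q⁻¹ - ε Pₓ P⁻¹`. -/
def IsLogLax (g : ℤ → DiffRing k) : Prop :=
  ∃ P P' Q Q' : ℤ → DressingRing k, IsDressingP P P' ∧ IsDressingQ Q Q' ∧
    ∀ n, 2 * incl (g n) =
      opMul shiftD (fun i => epsDx (Q i)) Q' n - opMul shiftD (fun i => epsDx (P i)) P' n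

/-! ### The extended Toda hierarchy -/

/-- `L^p (log L - c_p)`, where `g` is the sequence of coefficients of `log L` and
`c_p = 1 + 1/2 + ⋯ + 1/p`. -/
def laxPowLog (g : ℤ → DiffRing k) (p : ℕ) : ℤ → DiffRing k :=
  opMul shift (opPow shift (lax k) p)
    (g - ((harmonic p : ℚ) : k) • (opShift 0 : ℤ → DiffRing k))

/-- The operators `A_{1,q} = (2 / q!) [L^q (log L - c_q)]₊` and
`A_{2,q} = (1 / (q+1)!) [L^{q+1}]₊`. -/
def laxA (g : ℤ → DiffRing k) : Label → ℕ → ℤ → DiffRing k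
  | Label.one, q => (2 / (q.factorial : k)) • opPlus (laxPowLog g q)
  | Label.two, q => (1 / ((q + 1).factorial : k)) • opPlus (opPow shift (lax k) (q + 1))

/-- The family of vector fields `∂w^α/∂t^{β,q} = X β q α` is the extended Toda hierarchy:
`ε ∂L/∂t^{β,q} = [A_{β,q}, L]` for all `β` and `q`. -/
def IsExtendedToda (g : ℤ → DiffRing k) (X : Label → ℕ → Label → DiffRing k) : Prop :=
  ∀ (β : Label) (q : ℕ) (n : ℤ),
    eps * evolve (X β q) (lax k n) = opComm shift (laxA g β q) (lax k) n

/-- The Hamiltonian density `h_{α,p-1}`, `p ≥ 0`: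
`h_{1,p-1} = (2 / p!) res [L^p (log L - c_p)]` and `h_{2,p-1} = (1 / (p+1)!) res L^{p+1}`. -/
def hamDensityPred (g : ℤ → DiffRing k) : Label → ℕ → DiffRing k
  | Label.one, p => (2 / (p.factorial : k)) • opRes (laxPowLog g p)
  | Label.two, p => (1 / ((p + 1).factorial : k)) • opRes (opPow shift (lax k) (p + 1))

end ExtendedToda

end

/-!
Two-sided difference operators cannot be multiplied, so the argument takes place in two rings of
one-sided operators (`LowerOp`): operators bounded below, and operators bounded above. The latter
are operators bounded below for the opposite action `Λ ↦ Λ⁻¹` (`ShiftAction.rev`), so that almost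
every statement is proved once, for an arbitrary action.

*Existence of the logarithm.* An operator `L = a Λ⁻¹ + v + b Λ` is conjugate to `Λ⁻¹`
(`exists_intertwiner`); the coefficients of the dressing operator are found by inverting `Λ - 1`,
which is onto on Laurent series in `ε` over power series in `x`. The operator `W = ε Qₓ Q⁻¹` has
coefficients in `𝓡` for a reason of symmetry. A derivation `δ` of the dressing ring that commutes
with `Λ` and `ε∂ₓ` and kills the coefficients of `L` satisfies `Q⁻¹ δQ Λ⁻¹ = Λ⁻¹ Q⁻¹ δQ`, hence
`ε∂ₓ (Q⁻¹ δQ) = 0`, and this gives `δW = 0` (`mapAdd_logDeriv_eq_zero`). The derivation with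
respect to the symbol, the one with respect to the explicit `x`, and the Euler derivation of the
grading in which `ε` has weight `1`, `x` has weight `1` and `∂ₓᵐ w` has weight `-m` are of this
kind, and an element that is killed by all three belongs to `𝓡` (`exists_incl_eq`); the last point
uses that the differential degree is nonnegative.

*Tau-symmetry.* Of the logarithm the proof uses only that its halves `y₊ = (2 log L)_{≥ 0}` and
`y₋ = -(2 log L)_{< 0}` satisfy `[y, L] = ε Lₓ`. It follows that `B = f y₊ + h - f y₋`, with `f`
and `h` polynomials in `L`, commutes with `L`, which gives the flow `ε ∂L/∂t = [B₊, L]`. Put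
`M₊ = B₊` and `M₋ = -B₋`, so that `ε ∂L/∂t = [M, L]` in both rings. Then
`ε ∂y/∂t = [M, y] + ε Mₓ` (`epsEvolve_log`): the difference of the two sides commutes with `L` and
vanishes when `v` and `u` are constant, and such an operator is zero, because the lowest term of its
leading coefficient is a constant times a power of `e^u` (`eq_zero_of_comm_lax`).

For two flows, with data `f, h, M` and `f', h', M'`, set `U = f y + h` and `K = M - U`. A
computation in an arbitrary ring (`cross_derivative_eq`) gives
`ε ∂U'/∂t - ε ∂U/∂t' = [M, M'] - E`, where `E` depends only on `f`, `f'`, `K`, `K'` and is given by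
the same expression in both rings. Here `K₊ = B₊ - f y₊ - h` and `K₋ = -B₋ - f y₋` are the same
finite operator (`matches_plusOp_sub`). As `B = U₊ - U₋`, the residue of
`ε ∂B'/∂t - ε ∂B/∂t'` is `res [B₊, B'₊] - res [B₋, B'₋] - res E + res E`, and both commutators have
residue zero (`evolve_fullOp_comm`). The Hamiltonian densities are the residues of the operators
`B`.
-/

noncomputable section

namespace ExtendedToda

section

variable {k : Type*} [Field k]
/-! ### Differential polynomials -/

open LaurentPolynomial in
/-- The additive map `∑ cₙ Tⁿ ↦ ∑ gₙ(cₙ) Tⁿ` on Laurent polynomials. -/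
def mapT {A : Type*} [CommRing A] (g : ℤ → A →+ A) : A[T;T⁻¹] →+ A[T;T⁻¹] where
  toFun F := F.coeff.sum fun n c => C (g n c) * T n
  map_zero' := by simp
  map_add' F G := by
    rw [AddMonoidAlgebra.coeff_add, Finsupp.sum_add_index']
    · simp
    · intro n a b; simp [add_mul]

section mapT

open LaurentPolynomial

variable {A : Type*} [CommRing A] (g g₁ g₂ : ℤ → A →+ A)

lemma mapT_apply (F : A[T;T⁻¹]) : mapT g F = F.coeff.sum fun n c => C (g n c) * T n := rfl

lemma mapT_C_mul_T (a : A) (n : ℤ) : mapT g (C a * T n) = C (g n a) * T n := by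
  change Finsupp.sum (C a * T n : A[T;T⁻¹]).coeff (fun n c => C (g n c) * T n) = _
  rw [← single_eq_C_mul_T, AddMonoidAlgebra.coeff_single, Finsupp.sum_single_index]
  simp

lemma mapT_C (a : A) : mapT g (C a) = C (g 0 a) := by
  simpa using mapT_C_mul_T g a 0

lemma coeff_mapT (F : A[T;T⁻¹]) (n : ℤ) : (mapT g F).coeff n = g n (F.coeff n) := by
  induction F using LaurentPolynomial.induction_on' with
  | add p q hp hq => rw [map_add, AddMonoidAlgebra.coeff_add, AddMonoidAlgebra.coeff_add,
      Finsupp.add_apply, Finsupp.add_apply, hp, hq, map_add]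
  | C_mul_T m a =>
    rw [mapT_C_mul_T, ← single_eq_C_mul_T, ← single_eq_C_mul_T, AddMonoidAlgebra.coeff_single,
      AddMonoidAlgebra.coeff_single, Finsupp.single_apply, Finsupp.single_apply]
    split_ifs with h
    · rw [h]
    · simp

lemma C_mul_T_mul_C_mul_T (a b : A) (m n : ℤ) :
    (C a * T m : A[T;T⁻¹]) * (C b * T n) = C (a * b) * T (m + n) := by
  rw [map_mul, T_add]; ring

lemma mapT_mul (h : ∀ m n a b, g (m + n) (a * b) = g₁ m a * g₂ n b) (F G : A[T;T⁻¹]) :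
    mapT g (F * G) = mapT g₁ F * mapT g₂ G := by
  induction F using LaurentPolynomial.induction_on' with
  | add p q hp hq => simp only [add_mul, map_add, hp, hq]
  | C_mul_T m a =>
    induction G using LaurentPolynomial.induction_on' with
    | add p q hp hq => simp only [mul_add, map_add, hp, hq]
    | C_mul_T n b => simp only [C_mul_T_mul_C_mul_T, mapT_C_mul_T, h]

lemma mapT_leibniz (h : ∀ m n a b, g (m + n) (a * b) = g m a * b + a * g n b) (F G : A[T;T⁻¹]) :
    mapT g (F * G) = mapT g F * G + F * mapT g G := by
  induction F using LaurentPolynomial.induction_on' with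
  | add p q hp hq => simp only [add_mul, map_add, hp, hq]; ring
  | C_mul_T m a =>
    induction G using LaurentPolynomial.induction_on' with
    | add p q hp hq => simp only [mul_add, map_add, hp, hq]; ring
    | C_mul_T n b =>
      rw [C_mul_T_mul_C_mul_T, mapT_C_mul_T, h, mapT_C_mul_T, mapT_C_mul_T, C_mul_T_mul_C_mul_T,
        C_mul_T_mul_C_mul_T, map_add, add_mul]

end mapT

lemma expU_zero : (expU 0 : Jet k) = 1 := LaurentPolynomial.T_zero

lemma expU_add (m n : ℤ) : (expU (m + n) : Jet k) = expU m * expU n := LaurentPolynomial.T_add m n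

/-- The differential polynomials are generated as a `k`-algebra by the jet variables and the
powers of `e^u`. -/
lemma jet_induction {p : Jet k → Prop} (f : Jet k) (scalar : ∀ c : k, p (algebraMap k (Jet k) c))
    (var : ∀ α m, p (jetVar α m)) (exp : ∀ n, p (expU n))
    (add : ∀ f g, p f → p g → p (f + g)) (mul : ∀ f g, p f → p g → p (f * g)) : p f := by
  induction f using LaurentPolynomial.induction_on' with
  | add f g hf hg => exact add f g hf hg
  | C_mul_T n a =>
    refine mul _ _ ?_ (exp n)
    induction a using MvPolynomial.induction_on with
    | C a => exact scalar a
    | add a b ha hb => rw [map_add]; exact add _ _ ha hb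
    | mul_X a i ha => rw [map_mul]; exact mul _ _ ha (var i.1 i.2)

lemma partialD_eq_mapT (a : Label × ℕ) (f : Jet k) : partialD a f =
    mapT (fun n => ((MvPolynomial.pderiv a : Derivation k _ _) : _ →ₗ[k] _).toAddMonoidHom +
      if a = (Label.two, 0) then n • AddMonoidHom.id _ else 0) f := by
  rw [partialD, mapT_apply]
  refine Finsupp.sum_congr fun n _ => ?_
  split_ifs
  · simp [add_mul, expU, mul_assoc]
  · simp [expU]

/-- `∂/∂w^{α,m}` as a derivation. -/
def partialDer (a : Label × ℕ) : Derivation k (Jet k) (Jet k) :=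
  Derivation.mk' (M := Jet k)
    { toFun := partialD a
      map_add' := fun f g => by simp only [partialD_eq_mapT, map_add]
      map_smul' := fun c f => by
        simp only [partialD_eq_mapT, RingHom.id_apply]
        ext n : 2
        simp only [coeff_mapT, AddMonoidAlgebra.coeff_smul, Finsupp.smul_apply]
        split_ifs <;> simp }
    (fun f g => by
      simp only [LinearMap.coe_mk, AddHom.coe_mk, partialD_eq_mapT, smul_eq_mul]
      rw [mapT_leibniz]
      · ring
      · intro m n a b
        split_ifs
        · simp [Derivation.leibniz]; ring
        · simp [Derivation.leibniz]; ring)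

lemma partialDer_apply (a : Label × ℕ) (f : Jet k) : partialDer a f = partialD a f := rfl

lemma partialD_jetVar (a : Label × ℕ) (α : Label) (m : ℕ) :
    partialD a (jetVar α m : Jet k) = if a = (α, m) then 1 else 0 := by
  rw [partialD_eq_mapT, jetVar, mapT_C]
  by_cases h : a = (α, m)
  · subst h; simp
  · have : (α, m) ≠ a := fun e => h e.symm
    rw [if_neg h]
    split_ifs <;> simp [MvPolynomial.pderiv_X_of_ne this]

lemma partialD_expU (a : Label × ℕ) (n : ℤ) :
    partialD a (expU n : Jet k) = if a = (Label.two, 0) then n • expU n else 0 := by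
  have : (expU n : Jet k) = LaurentPolynomial.C 1 * LaurentPolynomial.T n := by simp [expU]
  rw [partialD_eq_mapT, this, mapT_C_mul_T]
  split_ifs
  · simp
  · simp

lemma finite_support_partialD (f : Jet k) : {a | partialD a f ≠ 0}.Finite := by
  induction f using jet_induction with
  | scalar c => simp only [← partialDer_apply, Derivation.map_algebraMap]; simp
  | var α m =>
    refine (Set.finite_singleton (α, m)).subset fun a ha => ?_
    by_contra h
    exact ha (by rw [partialD_jetVar, if_neg (by simpa using h)])
  | exp n =>
    refine (Set.finite_singleton (Label.two, 0)).subset fun a ha => ?_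
    by_contra h
    exact ha (by rw [partialD_expU, if_neg (by simpa using h)])
  | add f g hf hg =>
    refine (hf.union hg).subset fun a ha => ?_
    by_contra h
    simp only [Set.mem_union, Set.mem_ofPred_eq, not_or, not_not] at h
    apply ha
    rw [← partialDer_apply, map_add, partialDer_apply, partialDer_apply, h.1, h.2, add_zero]
  | mul f g hf hg =>
    refine (hf.union hg).subset fun a ha => ?_
    by_contra h
    simp only [Set.mem_union, Set.mem_ofPred_eq, not_or, not_not] at h
    apply ha
    rw [← partialDer_apply, Derivation.leibniz, partialDer_apply, partialDer_apply, h.1, h.2]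
    simp

section derivAlong

variable {M : Type*} [AddCommGroup M] [Module (Jet k) M] (Y : Label × ℕ → M)

lemma finite_support_partialD_smul (f : Jet k) :
    (Function.support fun a => partialD a f • Y a).Finite :=
  (finite_support_partialD f).subset fun a ha h => ha (by simp [h])

/-- The derivation of the differential polynomials with `w^{α,m} ↦ Y^{α,m}`. -/
def derivAlongDer [Module k M] [IsScalarTower k (Jet k) M] : Derivation k (Jet k) M :=
  Derivation.mk'
    { toFun := derivAlong Y
      map_add' := fun f g => by
        rw [derivAlong, derivAlong, derivAlong, ← finsum_add_distrib
          (finite_support_partialD_smul Y f) (finite_support_partialD_smul Y g)]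
        simp only [← partialDer_apply, map_add, add_smul]
      map_smul' := fun c f => by
        rw [derivAlong, derivAlong, RingHom.id_apply,
          smul_finsum' c (finite_support_partialD_smul Y f)]
        simp only [← partialDer_apply, Derivation.map_smul, smul_assoc] }
    (fun f g => by
      change derivAlong Y _ = f • derivAlong Y g + g • derivAlong Y f
      rw [derivAlong, derivAlong, derivAlong, smul_finsum' f (finite_support_partialD_smul Y g),
        smul_finsum' g (finite_support_partialD_smul Y f), ← finsum_add_distrib
          ((finite_support_partialD_smul Y g).subset fun a ha h => ha (by simp_all))
          ((finite_support_partialD_smul Y f).subset fun a ha h => ha (by simp_all))]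
      simp only [← partialDer_apply, Derivation.leibniz, add_smul, smul_assoc])

lemma derivAlong_jetVar (α : Label) (m : ℕ) :
    derivAlong Y (jetVar α m : Jet k) = Y (α, m) := by
  rw [derivAlong, finsum_eq_single _ (α, m)]
  · simp [partialD_jetVar]
  · intro a ha; simp [partialD_jetVar, ha]

lemma derivAlong_expU (n : ℤ) :
    derivAlong Y (expU n : Jet k) = n • (expU n : Jet k) • Y (Label.two, 0) := by
  rw [derivAlong, finsum_eq_single _ (Label.two, 0)]
  · rw [partialD_expU, if_pos rfl, smul_assoc]
  · intro a ha; simp [partialD_expU, ha]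

end derivAlong

/-- `∂ₓ` as a derivation. -/
def dxDer : Derivation k (Jet k) (Jet k) := derivAlongDer fun a => jetVar a.1 (a.2 + 1)

lemma dxDer_apply (f : Jet k) : dxDer f = dx f := rfl

lemma dx_jetVar (α : Label) (m : ℕ) : dx (jetVar α m : Jet k) = jetVar α (m + 1) :=
  derivAlong_jetVar _ α m

lemma dx_expU (n : ℤ) : dx (expU n : Jet k) = n • (expU n * jetVar Label.two 1) :=
  derivAlong_expU _ n

lemma dx_add (f g : Jet k) : dx (f + g) = dx f + dx g := dxDer.map_add f g

lemma dx_mul (f g : Jet k) : dx (f * g) = dx f * g + f * dx g := by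
  rw [← dxDer_apply, Derivation.leibniz]; simp only [smul_eq_mul, dxDer_apply]; ring

lemma dx_algebraMap (c : k) : dx (algebraMap k (Jet k) c) = 0 := dxDer.map_algebraMap c

/-! ### The kernel of `∂ₓ` -/

lemma partialD_succ_dx (α : Label) (m : ℕ) (f : Jet k) :
    partialD (α, m + 1) (dx f) = partialD (α, m) f + dx (partialD (α, m + 1) f) := by
  simp only [← partialDer_apply, ← dxDer_apply]
  induction f using jet_induction with
  | scalar c => simp only [Derivation.map_algebraMap, map_zero, add_zero]
  | var β l =>
    simp only [partialDer_apply, dxDer_apply, dx_jetVar, partialD_jetVar]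
    have : ((α, m + 1) = (β, l + 1)) ↔ ((α, m) = (β, l)) := by simp
    simp only [this]
    split_ifs <;> simp [← dxDer_apply]
  | exp n =>
    simp only [dxDer_apply, dx_expU]
    simp only [map_zsmul, Derivation.leibniz, partialDer_apply, partialD_jetVar, partialD_expU,
      ← dxDer_apply]
    have : ((α, m + 1) = (Label.two, 1)) ↔ ((α, m) = (Label.two, 0)) := by simp
    simp [this]
  | add f g hf hg => simp only [map_add, hf, hg]; ring
  | mul f g hf hg =>
    simp only [Derivation.leibniz, map_add, hf, hg, smul_eq_mul]; ring

lemma partialD_eq_zero_of_dx_eq_zero {f : Jet k} (hf : dx f = 0) (a : Label × ℕ) :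
    partialD a f = 0 := by
  obtain ⟨α, m⟩ := a
  obtain ⟨N, hN⟩ : ∃ N, ∀ l ≥ N, partialD (α, l) f = 0 := by
    obtain ⟨N, hN⟩ := ((finite_support_partialD f).image Prod.snd).bddAbove
    refine ⟨N + 1, fun l hl => ?_⟩
    by_contra h
    have := hN ⟨(α, l), h, rfl⟩
    simp only at this
    omega
  have step : ∀ j, partialD (α, N - j) f = 0 := by
    intro j
    induction j with
    | zero => exact hN _ (by simp)
    | succ j ih =>
      by_cases h : N ≤ j
      · rwa [show N - (j + 1) = N - j by omega]
      · have := partialD_succ_dx α (N - (j + 1)) f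
        rw [show N - (j + 1) + 1 = N - j by omega, ih, hf, dx_zero, add_zero,
          ← partialDer_apply, map_zero] at this
        exact this.symm
  by_cases h : N ≤ m
  · exact hN m h
  · simpa [show N - (N - m) = m by omega] using step (N - m)

/-- The evaluation of the differential polynomials at constant `v`, `u`: all jet variables
`w^{α,m}` with `m ≥ 1` are sent to `0`. -/
def evalConst : Jet k →+* Jet k :=
  AddMonoidAlgebra.mapRingHom ℤ
    (MvPolynomial.aeval fun a : Label × ℕ =>
      if a.2 = 0 then (MvPolynomial.X a : MvPolynomial (Label × ℕ) k) else 0).toRingHom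

lemma coeff_evalConst (f : Jet k) (n : ℤ) : (evalConst f).coeff n =
    MvPolynomial.aeval (fun a : Label × ℕ =>
      if a.2 = 0 then (MvPolynomial.X a : MvPolynomial (Label × ℕ) k) else 0) (f.coeff n) := by
  simp [evalConst]

lemma evalConst_jetVar_succ (α : Label) (m : ℕ) : evalConst (jetVar α (m + 1) : Jet k) = 0 := by
  ext n : 2
  rw [coeff_evalConst, jetVar, LaurentPolynomial.C_apply]
  split_ifs <;> simp

lemma evalConst_expU (n : ℤ) : evalConst (expU n : Jet k) = expU n := by
  ext m : 2
  rw [coeff_evalConst, expU, LaurentPolynomial.T_apply]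
  split_ifs <;> simp

lemma evalConst_dx (f : Jet k) : evalConst (dx f) = 0 := by
  induction f using jet_induction with
  | scalar c => rw [dx_algebraMap, map_zero]
  | var β l => rw [dx_jetVar, evalConst_jetVar_succ]
  | exp n => rw [dx_expU, map_zsmul, map_mul, evalConst_jetVar_succ]; simp
  | add f g hf hg => rw [dx_add, map_add, hf, hg, add_zero]
  | mul f g hf hg => rw [dx_mul, map_add, map_mul, map_mul, hf, hg]; simp

lemma aeval_eq_self_of_pderiv_eq_zero [CharZero k] (c : MvPolynomial (Label × ℕ) k)
    (h : ∀ a : Label × ℕ, a.2 ≠ 0 → MvPolynomial.pderiv a c = 0) :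
    MvPolynomial.aeval (fun a : Label × ℕ =>
      if a.2 = 0 then (MvPolynomial.X a : MvPolynomial (Label × ℕ) k) else 0) c = c := by
  have hv : ∀ a ∈ c.vars, a.2 = 0 := by
    intro a ha
    by_contra h0
    obtain ⟨d, hd, had⟩ := (MvPolynomial.mem_vars_iff_mem_support a).1 ha
    have := MvPolynomial.coeff_pderiv (i := a) c (d - Finsupp.single a 1)
    have hle : Finsupp.single a 1 ≤ d := by
      rw [Finsupp.single_le_iff]
      exact Nat.one_le_iff_ne_zero.2 (Finsupp.mem_support_iff.1 had)
    rw [h a h0, tsub_add_cancel_of_le hle, MvPolynomial.coeff_zero] at this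
    have hc := MvPolynomial.mem_support_iff.1 hd
    have h2 := (mul_eq_zero.1 this.symm).resolve_left hc
    norm_cast at h2
  conv_rhs => rw [← MvPolynomial.aeval_X_left_apply c]
  exact MvPolynomial.eval₂Hom_congr' rfl (fun a ha _ => by simp [hv a ha]) rfl

/-- A differential polynomial that is killed by `∂ₓ` is a constant, so it vanishes if its value
at constant `v`, `u` does. -/
lemma eq_zero_of_dx_eq_zero [CharZero k] {f : Jet k} (hf : dx f = 0) (h0 : evalConst f = 0) :
    f = 0 := by
  rw [← h0]
  ext n : 2
  rw [coeff_evalConst, aeval_eq_self_of_pderiv_eq_zero]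
  intro a ha
  have := congrArg (fun F : Jet k => F.coeff n) (partialD_eq_zero_of_dx_eq_zero hf a)
  have h2 : a ≠ (Label.two, 0) := fun h => ha (by rw [h])
  simpa [partialD_eq_mapT, coeff_mapT, h2] using this

/-! ### The differential degree -/

/-- The derivation that multiplies a differential monomial by its differential degree, in which
`w^{α,m}` has degree `m` and `e^u` has degree `0`. -/
def wtDer : Derivation k (Jet k) (Jet k) := derivAlongDer fun a => a.2 • jetVar a.1 a.2

lemma wtDer_jetVar (α : Label) (m : ℕ) : wtDer (jetVar α m : Jet k) = m • jetVar α m :=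
  derivAlong_jetVar _ α m

lemma wtDer_expU (n : ℤ) : wtDer (expU n : Jet k) = 0 := by
  refine (derivAlong_expU _ n).trans ?_
  change n • expU n • (0 • jetVar Label.two 0 : Jet k) = 0
  rw [zero_smul, smul_zero, smul_zero]

lemma wtDer_dx (f : Jet k) : wtDer (dx f) = dx (wtDer f) + dx f := by
  simp only [← dxDer_apply]
  induction f using jet_induction with
  | scalar c => simp only [Derivation.map_algebraMap, map_zero, add_zero]
  | var β l =>
    simp only [wtDer_jetVar, dxDer_apply, dx_jetVar]
    rw [← dxDer_apply, map_nsmul, dxDer_apply, dx_jetVar, succ_nsmul]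
  | exp n =>
    simp only [dxDer_apply, dx_expU, wtDer_expU, dx_zero]
    rw [map_zsmul, Derivation.leibniz, wtDer_expU, wtDer_jetVar]
    simp
  | add f g hf hg => simp only [map_add, hf, hg]; ring
  | mul f g hf hg =>
    simp only [Derivation.leibniz, map_add, hf, hg, smul_eq_mul]; ring

/-- `e^u` as a unit of the polynomial ring over the differential polynomials. -/
def expUnit : (Polynomial (Jet k))ˣ where
  val := Polynomial.C (expU 1)
  inv := Polynomial.C (expU (-1))
  val_inv := by rw [← map_mul, ← expU_add, add_neg_cancel, expU_zero, map_one]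
  inv_val := by rw [← map_mul, ← expU_add, neg_add_cancel, expU_zero, map_one]

lemma expUnit_zpow (n : ℤ) : ((expUnit ^ n : (Polynomial (Jet k))ˣ) : Polynomial (Jet k)) =
    Polynomial.C (expU n) := by
  induction n with
  | zero => rw [zpow_zero, expU_zero, map_one, Units.val_one]
  | succ n ih =>
    rw [zpow_add_one, Units.val_mul, ih, expU_add, map_mul]
    rfl
  | pred n ih =>
    rw [zpow_sub_one, Units.val_mul, ih, sub_eq_add_neg, expU_add, map_mul]
    rfl

/-- The grading of the differential polynomials by the differential degree, as the homomorphism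
`w^{α,m} ↦ s^m w^{α,m}`, `e^u ↦ e^u`. -/
def gradingHom : Jet k →+* Polynomial (Jet k) :=
  LaurentPolynomial.eval₂
    (MvPolynomial.eval₂Hom (algebraMap k (Polynomial (Jet k))) fun a : Label × ℕ =>
      Polynomial.C (jetVar a.1 a.2) * Polynomial.X ^ a.2)
    expUnit

lemma gradingHom_jetVar (α : Label) (m : ℕ) :
    gradingHom (jetVar α m : Jet k) = Polynomial.C (jetVar α m) * Polynomial.X ^ m := by
  simp [gradingHom, jetVar]

lemma gradingHom_algebraMap (c : k) :
    gradingHom (algebraMap k (Jet k) c) = Polynomial.C (algebraMap k (Jet k) c) := by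
  have : algebraMap k (Jet k) c = LaurentPolynomial.C (MvPolynomial.C c) := rfl
  rw [gradingHom, this, LaurentPolynomial.eval₂_C]
  rw [MvPolynomial.coe_eval₂Hom, MvPolynomial.eval₂_C, ← this]
  rfl

lemma gradingHom_expU (n : ℤ) : gradingHom (expU n : Jet k) = Polynomial.C (expU n) := by
  rw [gradingHom, expU, LaurentPolynomial.eval₂_T, expUnit_zpow]; rfl

lemma eval_gradingHom (f : Jet k) : (gradingHom f).eval 1 = f := by
  induction f using jet_induction with
  | scalar c => rw [gradingHom_algebraMap, Polynomial.eval_C]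
  | var β l => simp [gradingHom_jetVar]
  | exp n => simp [gradingHom_expU]
  | add f g hf hg => simp [hf, hg]
  | mul f g hf hg => simp [hf, hg]

lemma gradingHom_wtDer (f : Jet k) :
    gradingHom (wtDer f) = Polynomial.X * Polynomial.derivative (gradingHom f) := by
  induction f using jet_induction with
  | scalar c =>
    rw [Derivation.map_algebraMap, gradingHom_algebraMap]
    simp only [Polynomial.derivative_C, mul_zero, map_zero]
  | var β l =>
    rw [wtDer_jetVar, map_nsmul, gradingHom_jetVar]
    cases l with
    | zero => simp
    | succ l =>
      rw [Polynomial.derivative_mul, Polynomial.derivative_C, Polynomial.derivative_X_pow,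
        Nat.add_sub_cancel, nsmul_eq_mul, map_natCast, pow_succ]
      ring
  | exp n => simp [gradingHom_expU, wtDer_expU]
  | add f g hf hg => simp [hf, hg, mul_add]
  | mul f g hf hg => simp [hf, hg]; ring

/-- The differential degree takes no negative values. -/
lemma eq_zero_of_wtDer_eq_neg [CharZero k] {f : Jet k} {n : ℤ} (hn : n < 0)
    (hf : wtDer f = n • f) : f = 0 := by
  have h := gradingHom_wtDer f
  rw [hf, map_zsmul] at h
  rw [← eval_gradingHom f]
  suffices gradingHom f = 0 by simp [this]
  ext i : 1
  have hi := congrArg (fun p => Polynomial.coeff p i) h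
  have : (n - i) • (gradingHom f).coeff i = 0 := by
    rw [sub_smul, sub_eq_zero]
    cases i with
    | zero => simpa using hi
    | succ i =>
      simp only [Polynomial.coeff_smul, Polynomial.coeff_X_mul, Polynomial.coeff_derivative] at hi
      rw [hi]; simp [mul_comm]
  have hne : (((n - i : ℤ) : k)) ≠ 0 := by
    rw [Int.cast_ne_zero]; omega
  rw [← Int.cast_smul_eq_zsmul k] at this
  exact (smul_eq_zero.1 this).resolve_left hne

end

section

variable {k : Type*} [Field k]

/-! ### Laurent series in `ε` over a differential ring -/

section Laurent

variable {A : Type*} [CommRing A] [Algebra k A]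

/-- The Laurent series `F` is divisible by `ε^a`. -/
def Vanish (a : ℤ) (F : LaurentSeries A) : Prop := ∀ i < a, F.coeff i = 0

lemma Vanish.mono {a b : ℤ} {F : LaurentSeries A} (h : Vanish b F) (hab : a ≤ b) : Vanish a F :=
  fun i hi => h i (hi.trans_le hab)

lemma Vanish.add {a : ℤ} {F G : LaurentSeries A} (hF : Vanish a F) (hG : Vanish a G) :
    Vanish a (F + G) := fun i hi => by simp [hF i hi, hG i hi]

lemma Vanish.sub {a : ℤ} {F G : LaurentSeries A} (hF : Vanish a F) (hG : Vanish a G) :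
    Vanish a (F - G) := fun i hi => by simp [hF i hi, hG i hi]

lemma Vanish.smul {a : ℤ} {F : LaurentSeries A} (hF : Vanish a F) (c : k) :
    Vanish a (c • F) := fun i hi => by simp [hF i hi]

lemma Vanish.zero (a : ℤ) : Vanish a (0 : LaurentSeries A) := fun i _ => by simp

lemma Vanish.sum {ι : Type*} {s : Finset ι} {a : ℤ} {F : ι → LaurentSeries A}
    (h : ∀ i ∈ s, Vanish a (F i)) : Vanish a (∑ i ∈ s, F i) :=
  Finset.sum_induction F (Vanish a) (fun _ _ => Vanish.add) (Vanish.zero a) h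

lemma Vanish.mul {a b : ℤ} {F G : LaurentSeries A} (hF : Vanish a F) (hG : Vanish b G) :
    Vanish (a + b) (F * G) := fun i hi => by
  rw [HahnSeries.coeff_mul]
  refine Finset.sum_eq_zero fun p hp => ?_
  have hp' := (Finset.mem_antidiagonal.1 hp).2.2
  by_cases h : p.1 < a
  · rw [hF _ h, zero_mul]
  · rw [hG _ (by omega), mul_zero]

lemma exists_vanish (F : LaurentSeries A) : ∃ a, Vanish a F :=
  ⟨F.order, fun _ hi => HahnSeries.coeff_eq_zero_of_lt_order hi⟩

lemma eq_of_forall_vanish {F G : LaurentSeries A} {a : ℤ} (h : ∀ M : ℕ, Vanish (a + M) (F - G)) :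
    F = G := by
  ext i
  have := h (i + 1 - a).toNat i (by omega)
  rwa [HahnSeries.coeff_sub, sub_eq_zero] at this

/-- The map `∑ fₙ εⁿ ↦ ∑ eₙ(fₙ) εⁿ` on Laurent series. -/
def coeffMap (e : ℤ → A →ₗ[k] A) : LaurentSeries A →ₗ[k] LaurentSeries A where
  toFun F := HahnSeries.ofSuppBddBelow (fun n => e n (F.coeff n)) <| by
    refine ⟨F.order, fun n hn => ?_⟩
    by_contra hlt
    exact hn (by simp [HahnSeries.coeff_eq_zero_of_lt_order (not_le.1 hlt)])
  map_add' F G := by ext n; exact map_add (e n) _ _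
  map_smul' c F := by ext n; exact map_smul (e n) c _

lemma coeff_coeffMap (e : ℤ → A →ₗ[k] A) (F : LaurentSeries A) (n : ℤ) :
    (coeffMap e F).coeff n = e n (F.coeff n) := rfl

lemma Vanish.coeffMap {e : ℤ → A →ₗ[k] A} {a : ℤ} {F : LaurentSeries A} (h : Vanish a F) :
    Vanish a (coeffMap e F) := fun i hi => by rw [coeff_coeffMap, h i hi, map_zero]

lemma coeffMap_mul {e : ℤ → A →ₗ[k] A}
    (he : ∀ m n a b, e (m + n) (a * b) = e m a * b + a * e n b) (F G : LaurentSeries A) :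
    coeffMap e (F * G) = coeffMap e F * G + F * coeffMap e G := by
  have hs (H : LaurentSeries A) : (coeffMap e H).support ⊆ H.support := by
    intro n hn h
    exact hn (by rw [coeff_coeffMap, h, map_zero])
  ext n
  rw [HahnSeries.coeff_add, coeff_coeffMap, HahnSeries.coeff_mul,
    HahnSeries.coeff_mul_left' F.isPWO_support (hs F),
    HahnSeries.coeff_mul_right' G.isPWO_support (hs G), ← Finset.sum_add_distrib, map_sum]
  refine Finset.sum_congr rfl fun p hp => ?_
  rw [coeff_coeffMap, coeff_coeffMap, ← he, (Finset.mem_antidiagonal.1 hp).2.2]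

variable (D : Derivation k A A)

/-- The operator `ε D` on Laurent series. -/
def epsD : LaurentSeries A →ₗ[k] LaurentSeries A where
  toFun F := HahnSeries.single 1 1 * coeffMap (fun _ => (D : A →ₗ[k] A)) F
  map_add' F G := by rw [map_add, mul_add]
  map_smul' c F := by
    ext n
    rw [map_smul, RingHom.id_apply, HahnSeries.coeff_smul, HahnSeries.coeff_single_mul,
      HahnSeries.coeff_single_mul, HahnSeries.coeff_smul, one_mul, one_mul]

lemma coeff_epsD (F : LaurentSeries A) (n : ℤ) : (epsD D F).coeff n = D (F.coeff (n - 1)) := by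
  change (HahnSeries.single 1 1 * coeffMap (fun _ => (D : A →ₗ[k] A)) F).coeff n = _
  rw [HahnSeries.coeff_single_mul, coeff_coeffMap, one_mul]; rfl

lemma epsD_mul (F G : LaurentSeries A) : epsD D (F * G) = epsD D F * G + F * epsD D G := by
  change HahnSeries.single 1 1 * coeffMap (fun _ => (D : A →ₗ[k] A)) (F * G) =
    HahnSeries.single 1 1 * coeffMap (fun _ => (D : A →ₗ[k] A)) F * G +
      F * (HahnSeries.single 1 1 * coeffMap (fun _ => (D : A →ₗ[k] A)) G)
  rw [coeffMap_mul]
  · ring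
  · intro m n a b; simp [Derivation.leibniz]; ring

lemma coeff_epsD_pow (F : LaurentSeries A) (m : ℕ) (n : ℤ) :
    ((epsD D ^ m) F).coeff n = D^[m] (F.coeff (n - m)) := by
  induction m generalizing n with
  | zero => simp
  | succ m ih =>
    rw [pow_succ', Module.End.mul_apply, coeff_epsD, ih, Function.iterate_succ_apply']
    congr 3
    push_cast; ring

lemma Vanish.epsD_pow {a : ℤ} {F : LaurentSeries A} (h : Vanish a F) (m : ℕ) :
    Vanish (a + m) ((epsD D ^ m) F) := fun i hi => by
  rw [coeff_epsD_pow, h _ (by omega), iterate_map_zero]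

/-- The action of a power series `c(t)` with scalar coefficients on Laurent series, in which `t`
acts as `ε D`. -/
def act (c : PowerSeries k) (F : LaurentSeries A) : LaurentSeries A :=
  HahnSeries.ofSuppBddBelow
    (fun n => ∑ᶠ m : ℕ, PowerSeries.coeff m c • D^[m] (F.coeff (n - m))) <| by
    refine ⟨F.order, fun n hn => ?_⟩
    by_contra hlt
    refine hn (finsum_eq_zero_of_forall_eq_zero fun m => ?_)
    rw [HahnSeries.coeff_eq_zero_of_lt_order (by omega), iterate_map_zero, smul_zero]

lemma coeff_act (c : PowerSeries k) (F : LaurentSeries A) (n : ℤ) : (act D c F).coeff n =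
    ∑ᶠ m : ℕ, PowerSeries.coeff m c • D^[m] (F.coeff (n - m)) := rfl

/-- Up to high powers of `ε`, a power series in `ε D` acts as a finite sum. -/
lemma vanish_act_sub (c : PowerSeries k) {a : ℤ} {F : LaurentSeries A} (h : Vanish a F) (M : ℕ) :
    Vanish (a + M) (act D c F -
      ∑ m ∈ Finset.range M, PowerSeries.coeff m c • (epsD D ^ m) F) := fun i hi => by
  have hs : (Function.support fun m : ℕ => PowerSeries.coeff m c • D^[m] (F.coeff (i - m))) ⊆
      (Finset.range M : Set ℕ) := by
    intro m hm
    by_contra hmM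
    refine hm ?_
    have : M ≤ m := by simpa using hmM
    change PowerSeries.coeff m c • D^[m] (F.coeff (i - m)) = 0
    rw [h _ (by omega), iterate_map_zero, smul_zero]
  rw [HahnSeries.coeff_sub, coeff_act, finsum_eq_sum_of_support_subset _ hs, HahnSeries.coeff_sum,
    sub_eq_zero]
  exact Finset.sum_congr rfl fun m _ => by rw [HahnSeries.coeff_smul, coeff_epsD_pow]

lemma Vanish.act {a : ℤ} {F : LaurentSeries A} (h : Vanish a F) (c : PowerSeries k) :
    Vanish a (act D c F) := by
  simpa using vanish_act_sub D c h 0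

/-- A linear operator that intertwines `ε D` and preserves divisibility by powers of `ε`
intertwines the actions of all power series in `ε D`. -/
lemma act_comm (T : LaurentSeries A →ₗ[k] LaurentSeries A)
    (hT : ∀ F, T (epsD D F) = epsD D (T F)) (hv : ∀ a F, Vanish a F → Vanish a (T F))
    (c : PowerSeries k) (F : LaurentSeries A) : T (act D c F) = act D c (T F) := by
  obtain ⟨a, ha⟩ := exists_vanish F
  have hp (m : ℕ) : T ((epsD D ^ m) F) = (epsD D ^ m) (T F) := by
    induction m with
    | zero => rfl
    | succ m ih => rw [pow_succ', Module.End.mul_apply, hT, ih, Module.End.mul_apply]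
  refine eq_of_forall_vanish (a := a) fun M => ?_
  have h1 := hv _ _ (vanish_act_sub D c ha M)
  have h2 := vanish_act_sub D c (hv _ _ ha) M
  rw [map_sub, map_sum] at h1
  simp only [map_smul, hp] at h1
  simpa using h1.sub h2

lemma act_add (c : PowerSeries k) (F G : LaurentSeries A) :
    act D c (F + G) = act D c F + act D c G := by
  obtain ⟨a, ha⟩ := exists_vanish F
  obtain ⟨b, hb⟩ := exists_vanish G
  replace ha := ha.mono (min_le_left a b)
  replace hb := hb.mono (min_le_right a b)
  refine eq_of_forall_vanish (a := min a b) fun M => ?_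
  have := ((vanish_act_sub D c (ha.add hb) M).sub (vanish_act_sub D c ha M)).sub
    (vanish_act_sub D c hb M)
  simp only [map_add, smul_add, Finset.sum_add_distrib] at this
  convert this using 1
  abel

lemma act_smul (c : PowerSeries k) (b : k) (F : LaurentSeries A) :
    act D c (b • F) = b • act D c F := by
  obtain ⟨a, ha⟩ := exists_vanish F
  refine eq_of_forall_vanish (a := a) fun M => ?_
  have := (vanish_act_sub D c (ha.smul b) M).sub ((vanish_act_sub D c ha M).smul b)
  simp only [map_smul, smul_sub, Finset.smul_sum, smul_comm b] at this
  convert this using 1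
  abel

/-- `act` as a linear map. -/
def actL (c : PowerSeries k) : LaurentSeries A →ₗ[k] LaurentSeries A where
  toFun := act D c
  map_add' := act_add D c
  map_smul' := act_smul D c

lemma act_zero (c : PowerSeries k) : act D c 0 = 0 := (actL D c).map_zero

lemma sub_act (c c' : PowerSeries k) (F : LaurentSeries A) :
    act D (c - c') F = act D c F - act D c' F := by
  obtain ⟨a, ha⟩ := exists_vanish F
  refine eq_of_forall_vanish (a := a) fun M => ?_
  have := ((vanish_act_sub D (c - c') ha M).sub (vanish_act_sub D c ha M)).add
    (vanish_act_sub D c' ha M)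
  simp only [map_sub, sub_smul, Finset.sum_sub_distrib] at this
  convert this using 1
  abel

lemma one_act (F : LaurentSeries A) : act D 1 F = F := by
  ext n
  rw [coeff_act, finsum_eq_single _ 0]
  · simp
  · intro m hm; simp [PowerSeries.coeff_one, hm]

lemma X_act (F : LaurentSeries A) : act D PowerSeries.X F = epsD D F := by
  ext n
  rw [coeff_act, finsum_eq_single _ 1, coeff_epsD]
  · simp
  · intro m hm; simp [PowerSeries.coeff_X, hm]

/-- Reordering of a truncated double sum. -/
lemma sum_range_sum_antidiagonal {M : Type*} [AddCommMonoid M] (f : ℕ → ℕ → M) (N : ℕ) :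
    ∑ m ∈ Finset.range N, ∑ p ∈ Finset.HasAntidiagonal.antidiagonal m, f p.1 p.2 =
      ∑ s ∈ Finset.range N, ∑ t ∈ Finset.range (N - s), f s t := by
  rw [← Finset.sum_range_diag_flip]
  exact Finset.sum_congr rfl fun m _ => Finset.Nat.sum_antidiagonal_eq_sum_range_succ f m

lemma act_act (c c' : PowerSeries k) (F : LaurentSeries A) :
    act D c (act D c' F) = act D (c * c') F := by
  obtain ⟨a, ha⟩ := exists_vanish F
  refine eq_of_forall_vanish (a := a) fun M => ?_
  have h1 := vanish_act_sub D c (ha.act D c') M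
  have h2 := vanish_act_sub D (c * c') ha M
  have h3 : Vanish (a + M) (∑ s ∈ Finset.range M, PowerSeries.coeff s c • (epsD D ^ s)
      (act D c' F - ∑ t ∈ Finset.range (M - s), PowerSeries.coeff t c' • (epsD D ^ t) F)) := by
    refine Vanish.sum fun s hs => Vanish.smul (Vanish.mono
      ((vanish_act_sub D c' ha (M - s)).epsD_pow D s) ?_) _
    have := Finset.mem_range.1 hs
    omega
  have h4 : ∑ m ∈ Finset.range M, PowerSeries.coeff m (c * c') • (epsD D ^ m) F =
      ∑ s ∈ Finset.range M, ∑ t ∈ Finset.range (M - s),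
        (PowerSeries.coeff s c * PowerSeries.coeff t c') • (epsD D ^ (s + t)) F := by
    rw [← sum_range_sum_antidiagonal fun s t =>
      (PowerSeries.coeff s c * PowerSeries.coeff t c') • (epsD D ^ (s + t)) F]
    refine Finset.sum_congr rfl fun m _ => ?_
    rw [PowerSeries.coeff_mul, Finset.sum_smul]
    exact Finset.sum_congr rfl fun p hp => by rw [Finset.HasAntidiagonal.mem_antidiagonal.1 hp]
  rw [h4] at h2
  simp only [map_sub, map_sum, map_smul, smul_sub, Finset.sum_sub_distrib, Finset.smul_sum,
    smul_smul, ← Module.End.mul_apply, ← pow_add] at h3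
  convert (h1.add h3).sub h2 using 1
  abel

/-- The power series `e^{jt}`. -/
def expJ (j : ℤ) : PowerSeries k := PowerSeries.mk fun m => (j : k) ^ m / (m.factorial : k)

lemma laurent_smul_eq (c : k) (F : LaurentSeries A) :
    c • F = HahnSeries.C (algebraMap k A c) * F := by
  ext n
  rw [HahnSeries.C_apply, HahnSeries.coeff_single_zero_mul, HahnSeries.coeff_smul, Algebra.smul_def]

variable [CharZero k]

lemma exp_div_factorial_leibniz (j : k) (F G : LaurentSeries A) (m : ℕ) :
    (j ^ m / (m.factorial : k)) • (epsD D ^ m) (F * G) =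
      ∑ p ∈ Finset.HasAntidiagonal.antidiagonal m,
        ((j ^ p.1 / (p.1.factorial : k)) • (epsD D ^ p.1) F) *
        ((j ^ p.2 / (p.2.factorial : k)) • (epsD D ^ p.2) G) := by
  have key : (epsD D ^ m) (F * G) = ∑ p ∈ Finset.HasAntidiagonal.antidiagonal m,
      (m.choose p.1) • ((epsD D ^ p.1) F * (epsD D ^ p.2) G) := by
    induction m with
    | zero => simp
    | succ m ih =>
      rw [Finset.sum_antidiagonal_choose_succ_nsmul (M := LaurentSeries A)
        (fun i j => (epsD D ^ i) F * (epsD D ^ j) G) m, pow_succ', Module.End.mul_apply, ih,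
        map_sum, ← Finset.sum_add_distrib]
      refine Finset.sum_congr rfl fun p hp => ?_
      rw [map_nsmul, epsD_mul, pow_succ', pow_succ', Module.End.mul_apply, Module.End.mul_apply,
        smul_add, Nat.choose_symm_of_eq_add (Finset.HasAntidiagonal.mem_antidiagonal.1 hp).symm,
        add_comm]
  rw [key, Finset.smul_sum]
  refine Finset.sum_congr rfl fun p hp => ?_
  have hsm (c d : k) (F G : LaurentSeries A) : (c • F) * (d • G) = (c * d) • (F * G) := by
    simp only [laurent_smul_eq, map_mul]; ring
  rw [hsm, ← Nat.cast_smul_eq_nsmul k, smul_smul]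
  congr 1
  have hp' := Finset.HasAntidiagonal.mem_antidiagonal.1 hp
  have h1 := Nat.choose_mul_factorial_mul_factorial (n := m) (k := p.1) (by omega)
  rw [show m - p.1 = p.2 by omega] at h1
  have h2 : (m.factorial : k) ≠ 0 := Nat.cast_ne_zero.2 m.factorial_ne_zero
  have h3 : (p.1.factorial : k) ≠ 0 := Nat.cast_ne_zero.2 p.1.factorial_ne_zero
  have h4 : (p.2.factorial : k) ≠ 0 := Nat.cast_ne_zero.2 p.2.factorial_ne_zero
  have h5 : (m.factorial : k) = m.choose p.1 * p.1.factorial * p.2.factorial := by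
    rw [← h1]; push_cast; rfl
  have h6 : (m.choose p.1 : k) ≠ 0 := fun h => h2 (by rw [h5, h, zero_mul, zero_mul])
  rw [h5, ← hp', pow_add, hp']
  field_simp

/-- `e^{jεD}` is multiplicative. -/
lemma expJ_act_mul (j : ℤ) (F G : LaurentSeries A) :
    act D (expJ j) (F * G) = act D (expJ j) F * act D (expJ j) G := by
  obtain ⟨a, ha⟩ := exists_vanish F
  obtain ⟨b, hb⟩ := exists_vanish G
  refine eq_of_forall_vanish (a := a + b) fun M => ?_
  have h1 := vanish_act_sub D (expJ j) (ha.mul hb) M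
  have h2 := (vanish_act_sub D (expJ j) ha M).mul (hb.act D (expJ j))
  have h3 : Vanish (a + b + M) (∑ s ∈ Finset.range M,
      (PowerSeries.coeff s (expJ j : PowerSeries k) • (epsD D ^ s) F) * (act D (expJ j) G -
        ∑ t ∈ Finset.range (M - s),
          PowerSeries.coeff t (expJ j : PowerSeries k) • (epsD D ^ t) G)) := by
    refine Vanish.sum fun s hs => Vanish.mono
      (((ha.epsD_pow D s).smul (PowerSeries.coeff s (expJ j : PowerSeries k))).mul
        (vanish_act_sub D (expJ j) hb (M - s))) ?_
    have := Finset.mem_range.1 hs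
    omega
  have h4 : ∑ m ∈ Finset.range M, PowerSeries.coeff m (expJ j : PowerSeries k) •
      (epsD D ^ m) (F * G) = ∑ s ∈ Finset.range M, ∑ t ∈ Finset.range (M - s),
        (PowerSeries.coeff s (expJ j : PowerSeries k) • (epsD D ^ s) F) *
          (PowerSeries.coeff t (expJ j : PowerSeries k) • (epsD D ^ t) G) := by
    rw [← sum_range_sum_antidiagonal fun s t =>
        (PowerSeries.coeff s (expJ j : PowerSeries k) • (epsD D ^ s) F) *
          (PowerSeries.coeff t (expJ j : PowerSeries k) • (epsD D ^ t) G)]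
    refine Finset.sum_congr rfl fun m _ => ?_
    simp only [expJ, PowerSeries.coeff_mk]
    exact exp_div_factorial_leibniz D _ F G m
  rw [h4] at h1
  rw [show a + M + b = a + b + M by ring] at h2
  simp only [mul_sub, Finset.sum_sub_distrib, Finset.mul_sum] at h3
  rw [← Finset.sum_mul] at h3
  convert (h1.sub h2).sub h3 using 1
  ring

lemma expJ_eq_rescale (j : ℤ) : (expJ j : PowerSeries k) =
    PowerSeries.rescale (j : k) (PowerSeries.exp k) := by
  ext m
  simp [expJ, PowerSeries.coeff_exp, div_eq_mul_inv]

lemma expJ_zero : (expJ 0 : PowerSeries k) = 1 := by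
  rw [expJ_eq_rescale]; simp

lemma expJ_add (i j : ℤ) : (expJ (i + j) : PowerSeries k) = expJ i * expJ j := by
  rw [expJ_eq_rescale, expJ_eq_rescale, expJ_eq_rescale, Int.cast_add,
    PowerSeries.exp_mul_exp_eq_exp_add]

lemma expJ_act_one (j : ℤ) : act D (expJ j) (1 : LaurentSeries A) = 1 := by
  have h : act D (expJ j) (act D (expJ (-j)) (1 : LaurentSeries A)) = 1 := by
    rw [act_act, ← expJ_add, add_neg_cancel, expJ_zero, one_act]
  have h2 := expJ_act_mul D j 1 (act D (expJ (-j)) (1 : LaurentSeries A))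
  rw [one_mul, h, mul_one] at h2
  exact h2.symm

/-- The Bernoulli series `t / (e^t - 1)`. -/
lemma bernoulli_mul_expJ_sub_one :
    bernoulliPowerSeries k * (expJ 1 - 1) = PowerSeries.X := by
  rw [expJ_eq_rescale, Int.cast_one, PowerSeries.rescale_one]
  exact bernoulliPowerSeries_mul_exp_sub_one k

/-- The fixed points of `e^{εD}` are killed by `ε D`. -/
lemma epsD_eq_zero_of_expJ_act_eq {F : LaurentSeries A} (h : act D (expJ 1) F = F) :
    epsD D F = 0 := by
  rw [← X_act, ← bernoulli_mul_expJ_sub_one, ← act_act, sub_act, one_act, h, sub_self, act_zero]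

/-- If `D` is onto, then so is `e^{εD} - 1`. -/
lemma exists_expJ_act_sub_eq (hD : Function.Surjective D) (G : LaurentSeries A) :
    ∃ F, act D (expJ 1) F - F = G := by
  choose I hI using hD
  obtain ⟨a, ha⟩ := exists_vanish G
  let H : LaurentSeries A := HahnSeries.ofSuppBddBelow
    (fun n => if n < a - 1 then 0 else I (G.coeff (n + 1))) <| by
      refine ⟨a - 1, fun n hn => ?_⟩
      by_contra hlt
      exact hn (if_pos (not_le.1 hlt))
  have hH : epsD D H = G := by
    ext n
    rw [coeff_epsD]
    change D (if n - 1 < a - 1 then 0 else I (G.coeff (n - 1 + 1))) = G.coeff n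
    split_ifs with h
    · rw [map_zero, ha n (by omega)]
    · rw [hI, sub_add_cancel]
  refine ⟨act D (bernoulliPowerSeries k) H, ?_⟩
  have h1 := act_act D (expJ 1 - 1) (bernoulliPowerSeries k) H
  rw [sub_act, one_act, mul_comm, bernoulli_mul_expJ_sub_one, X_act, hH] at h1
  exact h1

end Laurent

end

section

variable {k : Type*} [Field k]

/-! ### Power series in `x` over the differential polynomials -/

section CoeffwisePowerSeries

variable {A : Type*} [CommRing A] [Algebra k A]

/-- The map `∑ fₙ xⁿ ↦ ∑ eₙ(fₙ) xⁿ` on power series. -/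
def psMap (e : ℕ → A →ₗ[k] A) : PowerSeries A →ₗ[k] PowerSeries A where
  toFun F := PowerSeries.mk fun n => e n (PowerSeries.coeff n F)
  map_add' F G := by ext n; simp
  map_smul' c F := by ext n; simp

lemma coeff_psMap (e : ℕ → A →ₗ[k] A) (F : PowerSeries A) (n : ℕ) :
    PowerSeries.coeff n (psMap e F) = e n (PowerSeries.coeff n F) := by simp [psMap]

lemma psMap_mul {e : ℕ → A →ₗ[k] A}
    (he : ∀ m n a b, e (m + n) (a * b) = e m a * b + a * e n b) (F G : PowerSeries A) :
    psMap e (F * G) = psMap e F * G + F * psMap e G := by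
  ext n
  rw [map_add, coeff_psMap, PowerSeries.coeff_mul, PowerSeries.coeff_mul, PowerSeries.coeff_mul,
    ← Finset.sum_add_distrib, map_sum]
  refine Finset.sum_congr rfl fun p hp => ?_
  rw [coeff_psMap, coeff_psMap, ← he, Finset.HasAntidiagonal.mem_antidiagonal.1 hp]

/-- The formal derivative of power series, as a `k`-linear map. -/
def psDeriv : PowerSeries A →ₗ[k] PowerSeries A where
  toFun F := PowerSeries.derivative A F
  map_add' F G := map_add _ F G
  map_smul' c F := by ext n; simp [PowerSeries.coeff_derivative]

lemma coeff_psDeriv (F : PowerSeries A) (n : ℕ) : PowerSeries.coeff n (psDeriv (k := k) F) =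
    PowerSeries.coeff (n + 1) F * (n + 1) := PowerSeries.coeff_derivative F n

lemma psDeriv_mul (F G : PowerSeries A) :
    psDeriv (k := k) (F * G) = psDeriv (k := k) F * G + F * psDeriv (k := k) G := by
  refine ((PowerSeries.derivative A).leibniz F G).trans ?_
  simp only [smul_eq_mul, psDeriv, LinearMap.coe_mk, AddHom.coe_mk]; ring

end CoeffwisePowerSeries

lemma dxX_eq (F : JetX k) :
    dxX F = psMap (fun _ => ((dxDer : Derivation k _ _) : Jet k →ₗ[k] Jet k)) F +
      psDeriv (k := k) F := by
  ext n : 1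
  rw [map_add, coeff_psMap, coeff_psDeriv, dxX, PowerSeries.coeff_mk, mul_comm]
  push_cast; rfl

/-- The total `x`-derivative on `JetX k` as a derivation. -/
def dxXDer : Derivation k (JetX k) (JetX k) :=
  Derivation.mk' (M := JetX k)
    { toFun := dxX
      map_add' := fun F G => by simp only [dxX_eq, map_add]; ring
      map_smul' := fun c F => by simp only [dxX_eq, map_smul, smul_add, RingHom.id_apply] }
    (fun F G => by
      simp only [LinearMap.coe_mk, AddHom.coe_mk, dxX_eq, smul_eq_mul]
      rw [psDeriv_mul, psMap_mul]
      · ring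
      · intro m n a b; simp [Derivation.leibniz]; ring)

lemma dxXDer_apply (F : JetX k) : dxXDer F = dxX F := rfl

lemma coeff_dxX (F : JetX k) (n : ℕ) : PowerSeries.coeff n (dxX F) =
    dx (PowerSeries.coeff n F) + ((n + 1 : ℕ) : Jet k) * PowerSeries.coeff (n + 1) F := by
  rw [dxX, PowerSeries.coeff_mk]

lemma dxX_C (f : Jet k) : dxX (PowerSeries.C f : JetX k) = PowerSeries.C (dx f) := by
  ext n : 1
  rw [coeff_dxX, PowerSeries.coeff_C, PowerSeries.coeff_C, PowerSeries.coeff_C,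
    if_neg (Nat.succ_ne_zero n), mul_zero, add_zero]
  split_ifs <;> simp [dx_zero]

lemma dxX_iterate_C (f : Jet k) (m : ℕ) :
    dxX^[m] (PowerSeries.C f : JetX k) = PowerSeries.C (dx^[m] f) := by
  induction m with
  | zero => rfl
  | succ m ih => rw [Function.iterate_succ_apply', ih, dxX_C, Function.iterate_succ_apply']

/-- Power series in `x` can be integrated. -/
lemma dxX_surjective [CharZero k] : Function.Surjective (dxX : JetX k → JetX k) := by
  intro G
  let F : ℕ → Jet k := fun n => Nat.rec (motive := fun _ => Jet k) 0
    (fun m fm => ((m + 1 : ℕ) : k)⁻¹ • (PowerSeries.coeff m G - dx fm)) n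
  have hF (m : ℕ) : F (m + 1) = ((m + 1 : ℕ) : k)⁻¹ • (PowerSeries.coeff m G - dx (F m)) := rfl
  refine ⟨PowerSeries.mk F, ?_⟩
  ext n : 1
  have hne : ((n + 1 : ℕ) : k) ≠ 0 := Nat.cast_ne_zero.2 n.succ_ne_zero
  rw [coeff_dxX, PowerSeries.coeff_mk, PowerSeries.coeff_mk, hF, ← nsmul_eq_mul,
    ← Nat.cast_smul_eq_nsmul k, smul_smul, mul_inv_cancel₀ hne, one_smul, add_sub_cancel]

/-- The derivation of `JetX k` that multiplies `xⁿ f` by `n` minus the differential degree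
of `f`. -/
def wtX : JetX k →ₗ[k] JetX k :=
  psMap fun n => (n : k) • LinearMap.id - ((wtDer : Derivation k _ _) : Jet k →ₗ[k] Jet k)

lemma coeff_wtX (F : JetX k) (n : ℕ) : PowerSeries.coeff n (wtX F) =
    (n : k) • PowerSeries.coeff n F - wtDer (PowerSeries.coeff n F) := coeff_psMap _ _ _

lemma wtX_mul (F G : JetX k) : wtX (F * G) = wtX F * G + F * wtX G := by
  refine psMap_mul ?_ F G
  intro m n a b
  simp only [LinearMap.sub_apply, LinearMap.smul_apply, LinearMap.id_apply, Nat.cast_add,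
    Derivation.coeFn_coe, Derivation.leibniz, smul_eq_mul]
  simp only [Algebra.smul_def, map_add]
  ring

lemma wtX_C (f : Jet k) : wtX (PowerSeries.C f : JetX k) = - PowerSeries.C (wtDer f) := by
  ext n : 1
  rw [coeff_wtX, map_neg, PowerSeries.coeff_C, PowerSeries.coeff_C]
  split_ifs with h
  · subst h; simp
  · simp

lemma wtX_dxX (F : JetX k) : wtX (dxX F) = dxX (wtX F) - dxX F := by
  ext n : 1
  simp only [map_sub, coeff_wtX, coeff_dxX, ← nsmul_eq_mul, map_add, wtDer_dx, map_nsmul]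
  simp only [← dxDer_apply, map_sub, Derivation.map_smul]
  simp only [← Nat.cast_smul_eq_nsmul k, smul_add, smul_sub, smul_smul]
  push_cast
  module

lemma psDeriv_dxX (F : JetX k) : psDeriv (k := k) (dxX F) = dxX (psDeriv (k := k) F) := by
  ext n : 1
  have h (f : Jet k) (j : ℕ) : dx (f * ((j : Jet k) + 1)) = dx f * ((j : Jet k) + 1) := by
    have : ((j : Jet k) + 1) = algebraMap k (Jet k) (j + 1) := by simp
    rw [this, dx_mul, dx_algebraMap, mul_zero, add_zero]
  simp only [coeff_psDeriv, coeff_dxX, h]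
  push_cast
  ring

lemma psDeriv_C (f : Jet k) : psDeriv (k := k) (PowerSeries.C f : JetX k) = 0 := by
  ext n : 1
  rw [coeff_psDeriv, PowerSeries.coeff_C, if_neg (Nat.succ_ne_zero n), zero_mul, map_zero]

/-! ### Laurent series in `ε` over `JetX k` -/

lemma shiftL_eq_act (j : ℤ) (F : LaurentJetX k) : shiftL j F = act dxXDer (expJ j) F := by
  ext n : 2
  rw [coeff_act]
  refine finsum_congr fun m => ?_
  rw [expJ, PowerSeries.coeff_mk]
  rfl

lemma epsDxL_eq (F : LaurentJetX k) : epsDxL F = epsD dxXDer F := by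
  ext n : 2
  rw [coeff_epsD]
  rfl

/-- `Λʲ` as a ring endomorphism of `LaurentJetX k`. -/
def shiftLHom [CharZero k] (j : ℤ) : LaurentJetX k →+* LaurentJetX k where
  toFun := shiftL j
  map_one' := by rw [shiftL_eq_act]; exact expJ_act_one dxXDer j
  map_mul' F G := by simp only [shiftL_eq_act]; exact expJ_act_mul dxXDer j F G
  map_zero' := by rw [shiftL_eq_act]; exact act_zero dxXDer _
  map_add' F G := by simp only [shiftL_eq_act]; exact act_add dxXDer _ F G

lemma shiftLHom_apply [CharZero k] (j : ℤ) (F : LaurentJetX k) : shiftLHom j F = shiftL j F := rfl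

lemma shiftL_zero_index [CharZero k] (F : LaurentJetX k) : shiftL 0 F = F := by
  rw [shiftL_eq_act, expJ_zero, one_act]

lemma shiftL_add_index [CharZero k] (i j : ℤ) (F : LaurentJetX k) :
    shiftL (i + j) F = shiftL i (shiftL j F) := by
  rw [shiftL_eq_act, shiftL_eq_act, shiftL_eq_act, act_act, expJ_add]

lemma epsDxL_add (F G : LaurentJetX k) : epsDxL (F + G) = epsDxL F + epsDxL G := by
  simp only [epsDxL_eq]; exact map_add _ F G

lemma epsDxL_mul (F G : LaurentJetX k) : epsDxL (F * G) = epsDxL F * G + F * epsDxL G := by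
  simp only [epsDxL_eq]; exact epsD_mul _ F G

lemma shiftL_epsDxL (j : ℤ) (F : LaurentJetX k) : shiftL j (epsDxL F) = epsDxL (shiftL j F) := by
  simp only [shiftL_eq_act, epsDxL_eq, ← X_act, act_act, mul_comm]

lemma epsDxL_eq_zero_of_shiftL_eq [CharZero k] {F : LaurentJetX k} (h : shiftL 1 F = F) :
    epsDxL F = 0 := by
  rw [shiftL_eq_act] at h
  rw [epsDxL_eq]
  exact epsD_eq_zero_of_expJ_act_eq dxXDer h

lemma exists_shiftL_sub_eq [CharZero k] (G : LaurentJetX k) : ∃ F, shiftL 1 F - F = G := by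
  simp only [shiftL_eq_act]
  exact exists_expJ_act_sub_eq dxXDer dxX_surjective G

/-- The derivation `∂/∂x` of `LaurentJetX k` with respect to the explicit variable `x`. -/
def explD : LaurentJetX k →ₗ[k] LaurentJetX k := coeffMap fun _ => psDeriv

/-- The derivation `ε ∂/∂ε + x ∂/∂x - ∑ m w^{α,m} ∂/∂w^{α,m}` of `LaurentJetX k`. -/
def scaleD : LaurentJetX k →ₗ[k] LaurentJetX k := coeffMap fun n => (n : k) • LinearMap.id + wtX

lemma coeff_explD (F : LaurentJetX k) (n : ℤ) :
    (explD F).coeff n = psDeriv (k := k) (F.coeff n) := rfl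

lemma coeff_scaleD (F : LaurentJetX k) (n : ℤ) :
    (scaleD F).coeff n = (n : k) • F.coeff n + wtX (F.coeff n) := rfl

lemma explD_mul (F G : LaurentJetX k) : explD (F * G) = explD F * G + F * explD G :=
  coeffMap_mul (fun _ _ a b => psDeriv_mul a b) F G

lemma scaleD_mul (F G : LaurentJetX k) : scaleD (F * G) = scaleD F * G + F * scaleD G := by
  refine coeffMap_mul ?_ F G
  intro m n a b
  simp only [LinearMap.add_apply, LinearMap.smul_apply, LinearMap.id_apply, Int.cast_add, wtX_mul,
    add_smul]
  simp only [Algebra.smul_def]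
  ring

lemma explD_epsDxL (F : LaurentJetX k) : explD (epsDxL F) = epsDxL (explD F) := by
  ext n : 2
  exact psDeriv_dxX _

lemma scaleD_epsDxL (F : LaurentJetX k) : scaleD (epsDxL F) = epsDxL (scaleD F) := by
  ext n : 2
  rw [coeff_scaleD]
  change (n : k) • dxX (F.coeff (n - 1)) + wtX (dxX (F.coeff (n - 1))) =
    dxX (((n - 1 : ℤ) : k) • F.coeff (n - 1) + wtX (F.coeff (n - 1)))
  rw [wtX_dxX, ← dxXDer_apply, ← dxXDer_apply, ← dxXDer_apply, map_add, Derivation.map_smul,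
    Int.cast_sub, Int.cast_one, sub_smul, one_smul]
  abel

lemma explD_shiftL (j : ℤ) (F : LaurentJetX k) : explD (shiftL j F) = shiftL j (explD F) := by
  rw [shiftL_eq_act, shiftL_eq_act]
  refine act_comm dxXDer explD (fun F => ?_) (fun a F h => h.coeffMap) _ F
  rw [← epsDxL_eq, ← epsDxL_eq, explD_epsDxL]

lemma scaleD_shiftL (j : ℤ) (F : LaurentJetX k) : scaleD (shiftL j F) = shiftL j (scaleD F) := by
  rw [shiftL_eq_act, shiftL_eq_act]
  refine act_comm dxXDer scaleD (fun F => ?_) (fun a F h => h.coeffMap) _ F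
  rw [← epsDxL_eq, ← epsDxL_eq, scaleD_epsDxL]

/-! ### The inclusion of `𝓡` -/

lemma coeff_inclL_nat (f : DiffRing k) (n : ℕ) :
    (inclL f).coeff (n : ℤ) = PowerSeries.C (PowerSeries.coeff n f) := by
  rw [inclL, RingHom.comp_apply, HahnSeries.ofPowerSeries_apply_coeff, PowerSeries.coeff_map]

lemma coeff_inclL_neg (f : DiffRing k) {n : ℤ} (hn : n < 0) : (inclL f).coeff n = 0 := by
  rw [inclL, RingHom.comp_apply, HahnSeries.ofPowerSeries_apply]
  refine HahnSeries.embDomain_of_notMem_range ?_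
  rintro ⟨m, hm⟩
  have : ((m : ℕ) : ℤ) = n := hm
  omega

lemma inclL_injective : Function.Injective (inclL : DiffRing k →+* LaurentJetX k) := by
  intro f g h
  ext n : 1
  have := congrArg (fun F => PowerSeries.coeff 0 (HahnSeries.coeff F (n : ℤ))) h
  simpa [coeff_inclL_nat] using this

/-- The inclusion of `𝓡` is compatible with power series in `ε ∂ₓ`. -/
lemma inclL_act (c : PowerSeries k) (f : DiffRing k) :
    inclL (PowerSeries.mk fun n => ∑ p ∈ Finset.HasAntidiagonal.antidiagonal n,
      PowerSeries.coeff p.1 c • dx^[p.1] (PowerSeries.coeff p.2 f)) = act dxXDer c (inclL f) := by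
  ext n : 2
  rw [coeff_act]
  rcases lt_or_ge n 0 with hn | hn
  · rw [coeff_inclL_neg _ hn, finsum_eq_zero_of_forall_eq_zero]
    intro m
    rw [coeff_inclL_neg _ (by omega), iterate_map_zero, smul_zero]
  · lift n to ℕ using hn
    have hs : (Function.support fun m : ℕ => PowerSeries.coeff m c • dxXDer^[m]
        ((inclL f).coeff ((n : ℤ) - m))) ⊆ (Finset.range n.succ : Set ℕ) := by
      intro m hm
      by_contra hmM
      refine hm ?_
      have : n.succ ≤ m := by simpa using hmM
      change PowerSeries.coeff m c • dxXDer^[m] ((inclL f).coeff ((n : ℤ) - m)) = 0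
      rw [coeff_inclL_neg _ (by omega), iterate_map_zero, smul_zero]
    rw [coeff_inclL_nat, PowerSeries.coeff_mk, finsum_eq_sum_of_support_subset _ hs,
      Finset.Nat.sum_antidiagonal_eq_sum_range_succ (fun i j =>
        PowerSeries.coeff i c • dx^[i] (PowerSeries.coeff j f)) n, map_sum]
    refine Finset.sum_congr rfl fun m hm => ?_
    have hm' : m ≤ n := Nat.lt_succ_iff.1 (Finset.mem_range.1 hm)
    rw [show (n : ℤ) - m = ((n - m : ℕ) : ℤ) by omega, coeff_inclL_nat]
    have : (dxXDer : Derivation k (JetX k) (JetX k))^[m]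
        (PowerSeries.C (PowerSeries.coeff (n - m) f)) =
          PowerSeries.C (dx^[m] (PowerSeries.coeff (n - m) f)) := dxX_iterate_C _ m
    rw [this]
    ext i : 1
    simp [PowerSeries.coeff_C]

lemma inclL_shift (j : ℤ) (f : DiffRing k) : inclL (shift j f) = shiftL j (inclL f) := by
  rw [shiftL_eq_act, ← inclL_act]
  simp only [shift, expJ, PowerSeries.coeff_mk]

lemma coeff_dxR (f : DiffRing k) (n : ℕ) :
    PowerSeries.coeff n (dxR f) = dx (PowerSeries.coeff n f) := by rw [dxR, PowerSeries.coeff_mk]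

lemma inclL_eps_mul_dxR (f : DiffRing k) : inclL (eps * dxR f) = epsDxL (inclL f) := by
  rw [epsDxL_eq, ← X_act, ← inclL_act]
  congr 1
  ext n : 1
  rw [PowerSeries.coeff_mk, eps]
  cases n with
  | zero => simp
  | succ n =>
    rw [PowerSeries.coeff_succ_X_mul, coeff_dxR, Finset.sum_eq_single (1, n)]
    · simp
    · intro p hp hne
      have := Finset.HasAntidiagonal.mem_antidiagonal.1 hp
      have h1 : p.1 ≠ 1 := fun h => hne (Prod.ext h (by simp; omega))
      simp [PowerSeries.coeff_X, h1]
    · intro h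
      exact absurd (Finset.HasAntidiagonal.mem_antidiagonal.2 (by simp; omega)) h

/-- `(1 - Λ⁻¹) 𝓑₋ u = ε ∂ₓ u`. -/
lemma inclL_bMinusU_sub [CharZero k] : inclL (bMinusU k) - shiftL (-1) (inclL (bMinusU k)) =
    epsDxL (inclL (PowerSeries.C (jetVar Label.two 0))) := by
  let c : PowerSeries k := PowerSeries.evalNegHom (bernoulliPowerSeries k)
  have hc : inclL (bMinusU k) = act dxXDer c (inclL (PowerSeries.C (jetVar Label.two 0))) := by
    rw [← inclL_act]
    congr 1
    ext n : 1
    rw [bMinusU, PowerSeries.coeff_mk, PowerSeries.coeff_mk, Finset.sum_eq_single (n, 0)]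
    · simp [c, bernoulliPowerSeries, PowerSeries.evalNegHom, mul_comm]
    · intro p hp hne
      have := Finset.HasAntidiagonal.mem_antidiagonal.1 hp
      have h1 : p.2 ≠ 0 := fun h => hne (Prod.ext (by simp; omega) h)
      have h0 : dx^[p.1] (0 : Jet k) = 0 := iterate_map_zero dxDer p.1
      rw [PowerSeries.coeff_C, if_neg h1, h0, smul_zero]
    · intro h
      exact absurd (Finset.HasAntidiagonal.mem_antidiagonal.2 (by simp)) h
  have hmul : (1 - expJ (-1)) * c = PowerSeries.X := by
    have h := congrArg PowerSeries.evalNegHom (bernoulli_mul_expJ_sub_one (k := k))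
    have h2 : PowerSeries.evalNegHom (expJ 1 : PowerSeries k) = expJ (-1) := by
      rw [expJ_eq_rescale, expJ_eq_rescale, PowerSeries.evalNegHom]
      simp
    rw [map_mul, map_sub, h2, map_one, PowerSeries.evalNegHom_X] at h
    linear_combination -h
  rw [hc, shiftL_eq_act, epsDxL_eq, ← X_act, ← hmul, ← act_act, sub_act, one_act]

/-! ### `𝓡` as a ring with shifts -/

/-- `Λʲ` as a ring endomorphism of `𝓡`. -/
def shiftHom [CharZero k] (j : ℤ) : DiffRing k →+* DiffRing k where
  toFun := shift j
  map_one' := inclL_injective (by rw [inclL_shift, map_one, ← shiftLHom_apply, map_one])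
  map_mul' f g := inclL_injective (by
    simp only [inclL_shift, map_mul, ← shiftLHom_apply])
  map_zero' := inclL_injective (by rw [inclL_shift, map_zero, ← shiftLHom_apply, map_zero])
  map_add' f g := inclL_injective (by
    simp only [inclL_shift, map_add, ← shiftLHom_apply])

lemma shiftHom_apply [CharZero k] (j : ℤ) (f : DiffRing k) : shiftHom j f = shift j f := rfl

lemma shift_zero_index [CharZero k] (f : DiffRing k) : shift 0 f = f :=
  inclL_injective (by rw [inclL_shift, shiftL_zero_index])

lemma shift_add_index [CharZero k] (i j : ℤ) (f : DiffRing k) :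
    shift (i + j) f = shift i (shift j f) :=
  inclL_injective (by simp only [inclL_shift, shiftL_add_index])

lemma shift_eps_mul_dxR [CharZero k] (j : ℤ) (f : DiffRing k) :
    shift j (eps * dxR f) = eps * dxR (shift j f) :=
  inclL_injective (by simp only [inclL_shift, inclL_eps_mul_dxR, shiftL_epsDxL])

/-! ### Elements of `LaurentJetX k` that belong to `𝓡` -/

lemma explD_inclL (f : DiffRing k) : explD (inclL f) = 0 := by
  ext n : 2
  rw [coeff_explD]
  rcases lt_or_ge n 0 with hn | hn
  · rw [coeff_inclL_neg _ hn, map_zero]; rfl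
  · lift n to ℕ using hn
    rw [coeff_inclL_nat, psDeriv_C]; rfl

lemma scaleD_inclL {f : DiffRing k}
    (h : ∀ n : ℕ, wtDer (PowerSeries.coeff n f) = (n : k) • PowerSeries.coeff n f) :
    scaleD (inclL f) = 0 := by
  ext n : 2
  rw [coeff_scaleD]
  rcases lt_or_ge n 0 with hn | hn
  · rw [coeff_inclL_neg _ hn, map_zero, smul_zero, add_zero]; rfl
  · lift n to ℕ using hn
    rw [coeff_inclL_nat, wtX_C, h]
    ext i : 1
    simp [PowerSeries.coeff_C]

lemma scaleD_inclL_C {f : Jet k} (h : wtDer f = 0) : scaleD (inclL (PowerSeries.C f)) = 0 := by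
  refine scaleD_inclL fun n => ?_
  rw [PowerSeries.coeff_C]
  split_ifs with hn
  · simp [hn, h]
  · simp

lemma scaleD_inclL_bMinusU : scaleD (inclL (bMinusU k)) = 0 := by
  refine scaleD_inclL fun n => ?_
  have : dx^[n] (jetVar Label.two 0 : Jet k) = jetVar Label.two n := by
    induction n with
    | zero => rfl
    | succ n ih => rw [Function.iterate_succ_apply', ih, dx_jetVar]
  rw [bMinusU, PowerSeries.coeff_mk, this, Derivation.map_smul, wtDer_jetVar, smul_comm,
    Nat.cast_smul_eq_nsmul]

/-- An element that does not depend explicitly on `x` and is homogeneous of degree `0` belongs to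
`𝓡`: homogeneity rules out the negative powers of `ε`. -/
lemma exists_inclL_eq [CharZero k] {F : LaurentJetX k} (h1 : explD F = 0) (h2 : scaleD F = 0) :
    ∃ f, inclL f = F := by
  have hC (n : ℤ) : F.coeff n = PowerSeries.C (PowerSeries.coeff 0 (F.coeff n)) := by
    ext i : 1
    rw [PowerSeries.coeff_C]
    split_ifs with hi
    · rw [hi]
    · obtain ⟨i, rfl⟩ := Nat.exists_eq_succ_of_ne_zero hi
      have h := congrArg (fun G : LaurentJetX k => PowerSeries.coeff i (G.coeff n)) h1
      have h' : PowerSeries.coeff (i + 1) (F.coeff n) * ((i : Jet k) + 1) = 0 := by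
        rw [← coeff_psDeriv (k := k)]; simpa [coeff_explD] using h
      have hne : ((i + 1 : ℕ) : k) ≠ 0 := Nat.cast_ne_zero.2 i.succ_ne_zero
      have h3 : ((i + 1 : ℕ) : k) • PowerSeries.coeff (i + 1) (F.coeff n) = 0 := by
        rw [Nat.cast_smul_eq_nsmul, nsmul_eq_mul, mul_comm]; push_cast; exact h'
      exact (smul_eq_zero.1 h3).resolve_left hne
  have hneg (n : ℤ) (hn : n < 0) : F.coeff n = 0 := by
    have h' : (n : k) • PowerSeries.coeff 0 (F.coeff n) -
        wtDer (PowerSeries.coeff 0 (F.coeff n)) = 0 := by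
      have h3 : PowerSeries.coeff 0 ((scaleD F).coeff n) = 0 := by rw [h2]; exact map_zero _
      rw [coeff_scaleD, map_add, coeff_wtX] at h3
      simpa [sub_eq_add_neg] using h3
    rw [hC, eq_zero_of_wtDer_eq_neg hn (f := PowerSeries.coeff 0 (F.coeff n)), map_zero]
    rw [← Int.cast_smul_eq_zsmul k]
    exact (sub_eq_zero.1 h').symm
  refine ⟨PowerSeries.mk fun n => PowerSeries.coeff 0 (F.coeff (n : ℤ)), ?_⟩
  ext n : 2
  rcases lt_or_ge n 0 with hn | hn
  · rw [coeff_inclL_neg _ hn, hneg n hn]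
  · lift n to ℕ using hn
    rw [coeff_inclL_nat, PowerSeries.coeff_mk, ← hC]

end

section

variable {k : Type*} [Field k]

/-! ### The dressing ring -/

lemma coeff_zero_shift (j : ℤ) (f : DiffRing k) :
    PowerSeries.coeff 0 (shift j f) = PowerSeries.coeff 0 f := by
  rw [shift, PowerSeries.coeff_mk, Finset.Nat.sum_antidiagonal_eq_sum_range_succ fun p q =>
    ((j : k) ^ p / (p.factorial : k)) • dx^[p] (PowerSeries.coeff q f)]
  simp

lemma coeff_one_shift (j : ℤ) (f : DiffRing k) :
    PowerSeries.coeff 1 (shift j f) =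
      PowerSeries.coeff 1 f + (j : k) • dx (PowerSeries.coeff 0 f) := by
  rw [shift, PowerSeries.coeff_mk, Finset.Nat.sum_antidiagonal_eq_sum_range_succ fun p q =>
    ((j : k) ^ p / (p.factorial : k)) • dx^[p] (PowerSeries.coeff q f)]
  simp [Finset.sum_range_succ]

section qShiftFactor

lemma qShiftFactor_zero (n : ℤ) : (qShiftFactor 0 n : DiffRing k) = 1 := by simp [qShiftFactor]

lemma qShiftFactor_one (n : ℤ) :
    (qShiftFactor 1 n : DiffRing k) = shift 1 (PowerSeries.C (expU n)) := by simp [qShiftFactor]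

variable [CharZero k]

lemma qShiftFactor_exp_zero (j : ℤ) : (qShiftFactor j 0 : DiffRing k) = 1 := by
  simp only [qShiftFactor, neg_zero, expU_zero, map_one, ← shiftHom_apply, Finset.prod_const_one,
    mul_one]

lemma qShiftFactor_exp_add (j m n : ℤ) : (qShiftFactor j (m + n) : DiffRing k) =
    qShiftFactor j m * qShiftFactor j n := by
  simp only [qShiftFactor, neg_add, expU_add, map_mul, ← shiftHom_apply, Finset.prod_mul_distrib]
  ring

lemma qShiftFactor_succ (j n : ℤ) : (qShiftFactor (j + 1) n : DiffRing k) =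
    qShiftFactor 1 n * shift 1 (qShiftFactor j n) := by
  rw [qShiftFactor_one]
  rcases lt_or_ge j 0 with hj | hj
  · obtain ⟨a, rfl⟩ : ∃ a : ℕ, j = -((a : ℤ) + 1) := ⟨(-j - 1).toNat, by omega⟩
    have h1 : (-((a : ℤ) + 1) + 1).toNat = 0 := by omega
    have h2 : (-(-((a : ℤ) + 1) + 1)).toNat = a := by omega
    have h3 : (-((a : ℤ) + 1)).toNat = 0 := by omega
    have h4 : (-(-((a : ℤ) + 1))).toNat = a + 1 := by omega
    simp only [qShiftFactor, h1, h2, h3, h4, Finset.range_zero, Finset.prod_empty, one_mul]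
    rw [← shiftHom_apply 1 (∏ _ ∈ _, _), map_prod, Finset.prod_range_succ', ← mul_assoc, mul_comm,
      ← mul_assoc]
    have h5 : shift 1 (PowerSeries.C (expU n)) * shiftHom 1 (shift (-((0 : ℕ) : ℤ))
        (PowerSeries.C (expU (-n)))) = (1 : DiffRing k) := by
      rw [Nat.cast_zero, neg_zero, shift_zero_index, shiftHom_apply, ← shiftHom_apply,
        ← shiftHom_apply, ← map_mul, ← map_mul, ← expU_add, add_neg_cancel, expU_zero, map_one,
        map_one]
    rw [mul_comm (shiftHom 1 _), h5, one_mul]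
    refine Finset.prod_congr rfl fun i _ => ?_
    rw [shiftHom_apply, ← shift_add_index]
    congr 1
    push_cast; ring
  · obtain ⟨a, rfl⟩ : ∃ a : ℕ, j = a := ⟨j.toNat, by omega⟩
    have h1 : ((a : ℤ) + 1).toNat = a + 1 := by omega
    have h2 : (-((a : ℤ) + 1)).toNat = 0 := by omega
    have h3 : (-(a : ℤ)).toNat = 0 := by omega
    simp only [qShiftFactor, h1, h2, h3, Int.toNat_natCast, Finset.range_zero, Finset.prod_empty,
      mul_one]
    rw [← shiftHom_apply 1 (∏ _ ∈ _, _), map_prod, Finset.prod_range_succ', mul_comm]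
    congr 1
    refine Finset.prod_congr rfl fun i _ => ?_
    rw [shiftHom_apply, ← shift_add_index]
    congr 1
    push_cast; ring

/-- The cocycle property of the factors `Λʲqⁿ / qⁿ`. -/
lemma qShiftFactor_add (i j n : ℤ) : (qShiftFactor (i + j) n : DiffRing k) =
    qShiftFactor i n * shift i (qShiftFactor j n) := by
  have hunit : IsUnit (qShiftFactor 1 n : DiffRing k) := by
    refine IsUnit.of_mul_eq_one (qShiftFactor 1 (-n)) ?_
    rw [← qShiftFactor_exp_add, add_neg_cancel, qShiftFactor_exp_zero]
  have hinj (f g : DiffRing k) (h : shift 1 f = shift 1 g) : f = g := by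
    have := congrArg (shift (-1)) h
    rwa [← shift_add_index, ← shift_add_index, neg_add_cancel, shift_zero_index,
      shift_zero_index] at this
  have hmul (a : ℤ) (f g : DiffRing k) : shift a (f * g) = shift a f * shift a g :=
    map_mul (shiftHom a) f g
  induction i with
  | zero => rw [zero_add, qShiftFactor_zero, one_mul, shift_zero_index]
  | succ i ih =>
    rw [show (i : ℤ) + 1 + j = (i + j) + 1 by ring, qShiftFactor_succ, ih, hmul, ← mul_assoc,
      ← qShiftFactor_succ, ← shift_add_index, add_comm 1 (i : ℤ)]
  | pred i ih =>
    apply hinj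
    apply hunit.mul_left_cancel
    rw [← qShiftFactor_succ, hmul, ← mul_assoc, ← qShiftFactor_succ, ← shift_add_index,
      show -(i : ℤ) - 1 + j + 1 = -i + j by ring, ih, show -(i : ℤ) - 1 + 1 = -i by ring,
      show 1 + (-(i : ℤ) - 1) = -i by ring]

/-- `Λʲ` on the dressing ring, one power of the symbol at a time. -/
lemma shiftD_eq_mapT (j : ℤ) (F : DressingRing k) : shiftD j F =
    mapT (fun n => (AddMonoidHom.mulRight (inclL (qShiftFactor j n))).comp
      (shiftLHom j).toAddMonoidHom) F := rfl

/-- `Λʲ` as a ring endomorphism of the dressing ring. -/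
def shiftDHom (j : ℤ) : DressingRing k →+* DressingRing k where
  toFun := shiftD j
  map_zero' := by rw [shiftD_eq_mapT, map_zero]
  map_add' F G := by simp only [shiftD_eq_mapT, map_add]
  map_one' := by
    rw [shiftD_eq_mapT, ← map_one LaurentPolynomial.C, mapT_C]
    simp [qShiftFactor_exp_zero]
  map_mul' F G := by
    simp only [shiftD_eq_mapT]
    refine mapT_mul _ _ _ ?_ F G
    intro m n a b
    simp only [AddMonoidHom.comp_apply, AddMonoidHom.mulRight_apply, RingHom.toAddMonoidHom_eq_coe,
      AddMonoidHom.coe_coe, map_mul, qShiftFactor_exp_add]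
    ring

lemma coeff_shiftD (j : ℤ) (F : DressingRing k) (n : ℤ) :
    (shiftD j F).coeff n = shiftL j (F.coeff n) * inclL (qShiftFactor j n) := by
  rw [shiftD_eq_mapT, coeff_mapT]; rfl

lemma shiftD_zero_index (F : DressingRing k) : shiftD 0 F = F := by
  refine LaurentPolynomial.ext fun n => ?_
  rw [coeff_shiftD, shiftL_zero_index, qShiftFactor_zero, map_one, mul_one]

lemma shiftD_add_index (i j : ℤ) (F : DressingRing k) :
    shiftD (i + j) F = shiftD i (shiftD j F) := by
  refine LaurentPolynomial.ext fun n => ?_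
  rw [coeff_shiftD, coeff_shiftD, coeff_shiftD, shiftL_add_index, qShiftFactor_add, map_mul,
    ← shiftLHom_apply i (_ * _), map_mul, shiftLHom_apply, shiftLHom_apply, inclL_shift]
  ring

lemma shiftD_C (j : ℤ) (c : LaurentJetX k) :
    shiftD j (LaurentPolynomial.C c) = LaurentPolynomial.C (shiftL j c) := by
  rw [shiftD_eq_mapT, mapT_C]
  simp only [qShiftFactor_exp_zero, map_one, AddMonoidHom.comp_apply, AddMonoidHom.mulRight_apply,
    mul_one]
  rfl

lemma shiftD_incl (j : ℤ) (f : DiffRing k) : shiftD j (incl f) = incl (shift j f) := by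
  rw [incl, RingHom.comp_apply, shiftD_C, RingHom.comp_apply, inclL_shift]

end qShiftFactor

lemma incl_injective : Function.Injective (incl : DiffRing k →+* DressingRing k) := by
  intro f g h
  have := congrArg (fun F : DressingRing k => F.coeff 0) h
  exact inclL_injective (by simpa [incl, LaurentPolynomial.C_apply] using this)

/-- Multiplication of a Laurent series by `n 𝓑₋ u`, as an additive map. -/
def bMulHom (n : ℤ) : LaurentJetX k →+ LaurentJetX k :=
  n • AddMonoidHom.mulLeft (inclL (bMinusU k))

lemma bMulHom_apply (n : ℤ) (c : LaurentJetX k) : bMulHom n c = n • (inclL (bMinusU k) * c) := rfl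

/-- `ε ∂ₓ` as an additive endomorphism of `LaurentJetX k`. -/
def epsDxLHom : LaurentJetX k →+ LaurentJetX k := AddMonoidHom.mk' epsDxL epsDxL_add

lemma epsDx_eq_mapT (F : DressingRing k) : epsDx F = mapT (fun n => epsDxLHom + bMulHom n) F := rfl

lemma coeff_epsDx (F : DressingRing k) (n : ℤ) : (epsDx F).coeff n =
    epsDxL (F.coeff n) + n • (inclL (bMinusU k) * F.coeff n) := by
  rw [epsDx_eq_mapT, coeff_mapT]; rfl

lemma epsDx_add (F G : DressingRing k) : epsDx (F + G) = epsDx F + epsDx G := by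
  simp only [epsDx_eq_mapT, map_add]

lemma epsDx_mul (F G : DressingRing k) : epsDx (F * G) = epsDx F * G + F * epsDx G := by
  simp only [epsDx_eq_mapT]
  refine mapT_leibniz _ ?_ F G
  intro m n a b
  change epsDxL (a * b) + (m + n) • (inclL (bMinusU k) * (a * b)) =
    (epsDxL a + m • (inclL (bMinusU k) * a)) * b + a * (epsDxL b + n • (inclL (bMinusU k) * b))
  rw [epsDxL_mul]
  simp only [zsmul_eq_mul]
  push_cast
  ring

lemma epsDx_C (c : LaurentJetX k) :
    epsDx (LaurentPolynomial.C c) = LaurentPolynomial.C (epsDxL c) := by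
  rw [epsDx_eq_mapT, mapT_C, AddMonoidHom.add_apply, bMulHom_apply, zero_smul, add_zero]; rfl

lemma epsDx_incl (f : DiffRing k) : epsDx (incl f) = incl (eps * dxR f) := by
  rw [incl, RingHom.comp_apply, epsDx_C, RingHom.comp_apply, inclL_eps_mul_dxR]

lemma epsDxL_zsmul (n : ℤ) (F : LaurentJetX k) : epsDxL (n • F) = n • epsDxL F :=
  map_zsmul epsDxLHom n F

lemma shiftD_epsDx [CharZero k] (j : ℤ) (F : DressingRing k) :
    shiftD j (epsDx F) = epsDx (shiftD j F) := by
  have h1 (F : DressingRing k) : shiftD 1 (epsDx F) = epsDx (shiftD 1 F) := by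
    refine LaurentPolynomial.ext fun n => ?_
    rw [coeff_shiftD, coeff_epsDx, coeff_epsDx, coeff_shiftD, epsDxL_mul, qShiftFactor_one,
      inclL_shift, ← shiftL_epsDxL, ← shiftL_epsDxL, ← shiftLHom_apply, ← shiftLHom_apply,
      ← shiftLHom_apply, ← shiftLHom_apply, ← shiftLHom_apply]
    have hexp : epsDxL (inclL (PowerSeries.C (expU n) : DiffRing k)) =
        n • (inclL (PowerSeries.C (expU n)) *
          epsDxL (inclL (PowerSeries.C (jetVar Label.two 0)))) := by
      rw [← inclL_eps_mul_dxR, ← inclL_eps_mul_dxR, ← map_mul, ← map_zsmul]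
      congr 1
      have hd (f : Jet k) : dxR (PowerSeries.C f) = PowerSeries.C (dx f) := by
        ext i : 1
        rw [coeff_dxR, PowerSeries.coeff_C, PowerSeries.coeff_C]
        split_ifs
        · rfl
        · exact dx_zero
      rw [hd, hd, dx_expU, dx_jetVar, map_zsmul, map_mul]
      simp only [zsmul_eq_mul]
      ring
    have hb : shiftLHom 1 (epsDxL (inclL (PowerSeries.C (jetVar Label.two 0)))) =
        shiftLHom 1 (inclL (bMinusU k)) - inclL (bMinusU k) := by
      rw [← inclL_bMinusU_sub, map_sub, shiftLHom_apply 1 (shiftL _ _), ← shiftL_add_index,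
        add_neg_cancel, shiftL_zero_index]
    rw [hexp, map_add, map_zsmul, map_zsmul, map_mul, map_mul, hb]
    simp only [zsmul_eq_mul]
    ring
  induction j generalizing F with
  | zero => rw [shiftD_zero_index, shiftD_zero_index]
  | succ i ih =>
    rw [add_comm, shiftD_add_index, shiftD_add_index, ih, h1]
  | pred i ih =>
    have h2 (F : DressingRing k) : shiftD (-1) (epsDx F) = epsDx (shiftD (-1) F) := by
      have h := h1 (shiftD (-1) F)
      rw [← shiftD_add_index, add_neg_cancel, shiftD_zero_index] at h
      rw [← h, ← shiftD_add_index, neg_add_cancel, shiftD_zero_index]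
    rw [show -(i : ℤ) - 1 = -1 + -i by ring, shiftD_add_index, shiftD_add_index, ih, h2]

/-! ### Symmetries of the dressing ring -/

/-- Derivations of the dressing ring that commute with `Λ` and `ε ∂ₓ` and kill the coefficients of
the Lax operator. -/
structure IsSymmetry (δ : DressingRing k →+ DressingRing k) : Prop where
  leibniz : ∀ F G, δ (F * G) = δ F * G + F * δ G
  shift : ∀ j F, δ (shiftD j F) = shiftD j (δ F)
  epsDx : ∀ F, δ (epsDx F) = epsDx (δ F)
  lax : ∀ n, δ (laxD k n) = 0

/-- The derivation `q ∂/∂q` of the dressing ring. -/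
def symbolD : DressingRing k →+ DressingRing k := mapT fun n => n • AddMonoidHom.id _

/-- The extension of an additive endomorphism of `LaurentJetX k` to the dressing ring that
treats the symbol as a constant. -/
def coeffD (η : LaurentJetX k →ₗ[k] LaurentJetX k) : DressingRing k →+ DressingRing k :=
  mapT fun _ => η.toAddMonoidHom

lemma coeff_coeffD (η : LaurentJetX k →ₗ[k] LaurentJetX k) (F : DressingRing k) (n : ℤ) :
    (coeffD η F).coeff n = η (F.coeff n) := coeff_mapT _ F n

lemma coeff_symbolD (F : DressingRing k) (n : ℤ) : (symbolD F).coeff n = n • F.coeff n :=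
  coeff_mapT _ F n

lemma laxD_cases (p : DressingRing k → Prop) (h1 : p (incl 1)) (h0 : p (incl 0))
    (hv : p (incl (PowerSeries.C (jetVar Label.one 0)))) (hu : p (incl (PowerSeries.C (expU 1))))
    (n : ℤ) : p (laxD k n) := by
  unfold laxD lax
  split_ifs
  · exact h1
  · exact hv
  · exact hu
  · exact h0

section

variable [CharZero k]

lemma isSymmetry_symbolD : IsSymmetry (symbolD : DressingRing k →+ DressingRing k) where
  leibniz F G := by
    refine mapT_leibniz _ ?_ F G
    intro m n a b
    change (m + n) • (a * b) = (m • a) * b + a * (n • b)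
    simp only [zsmul_eq_mul]
    push_cast; ring
  shift j F := by
    refine LaurentPolynomial.ext fun n => ?_
    simp only [coeff_shiftD, coeff_symbolD, ← shiftLHom_apply, map_zsmul, smul_mul_assoc]
  epsDx F := by
    refine LaurentPolynomial.ext fun n => ?_
    simp only [coeff_epsDx, coeff_symbolD, epsDxL_zsmul, mul_smul_comm, zsmul_add]
  lax n := by
    have h (f : DiffRing k) : symbolD (incl f) = 0 := by
      rw [incl, RingHom.comp_apply, symbolD, mapT_C]; simp
    exact laxD_cases (fun F => symbolD F = 0) (h _) (h _) (h _) (h _) n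

lemma isSymmetry_coeffD {η : LaurentJetX k →ₗ[k] LaurentJetX k}
    (leib : ∀ F G, η (F * G) = η F * G + F * η G) (hs : ∀ j F, η (shiftL j F) = shiftL j (η F))
    (hd : ∀ F, η (epsDxL F) = epsDxL (η F)) (hb : η (inclL (bMinusU k)) = 0)
    (hv : η (inclL (PowerSeries.C (jetVar Label.one 0))) = 0)
    (hu : ∀ n, η (inclL (PowerSeries.C (expU n))) = 0) : IsSymmetry (coeffD η) where
  leibniz F G := mapT_leibniz _ (fun _ _ a b => leib a b) F G
  shift j F := by
    have h1 : η 1 = 0 := by simpa [expU_zero] using hu 0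
    have hmul (f g : DiffRing k) (hf : η (inclL f) = 0) (hg : η (inclL g) = 0) :
        η (inclL (f * g)) = 0 := by rw [map_mul, leib, hf, hg, zero_mul, mul_zero, add_zero]
    have hsh (i n : ℤ) : η (inclL (ExtendedToda.shift i (PowerSeries.C (expU n)))) = 0 := by
      rw [inclL_shift, hs, hu, ← shiftLHom_apply, map_zero]
    have hq (n : ℤ) : η (inclL (qShiftFactor j n)) = 0 :=
      hmul _ _ (Finset.prod_induction _ (fun f => η (inclL f) = 0) hmul (by rw [map_one, h1])
        fun i _ => hsh _ _) (Finset.prod_induction _ (fun f => η (inclL f) = 0) hmul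
          (by rw [map_one, h1]) fun i _ => hsh _ _)
    refine LaurentPolynomial.ext fun n => ?_
    rw [coeff_coeffD, coeff_shiftD, coeff_shiftD, coeff_coeffD, leib, hq, mul_zero, add_zero, hs]
  epsDx F := by
    refine LaurentPolynomial.ext fun n => ?_
    rw [coeff_coeffD, coeff_epsDx, coeff_epsDx, coeff_coeffD, map_add, hd, map_zsmul, leib, hb,
      zero_mul, zero_add]
  lax n := by
    have h (f : DiffRing k) (hf : η (inclL f) = 0) : coeffD η (incl f) = 0 := by
      rw [incl, RingHom.comp_apply, coeffD, mapT_C, LinearMap.toAddMonoidHom_coe, hf, map_zero]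
    refine laxD_cases (fun F => coeffD η F = 0) (h _ ?_) (by rw [map_zero, map_zero]) (h _ hv)
      (h _ (hu 1)) n
    simpa [expU_zero] using hu 0

lemma isSymmetry_explD : IsSymmetry (coeffD (explD (k := k))) :=
  isSymmetry_coeffD explD_mul explD_shiftL explD_epsDxL (explD_inclL _) (explD_inclL _)
    fun _ => explD_inclL _

lemma isSymmetry_scaleD : IsSymmetry (coeffD (scaleD (k := k))) :=
  isSymmetry_coeffD scaleD_mul scaleD_shiftL scaleD_epsDxL scaleD_inclL_bMinusU
    (scaleD_inclL_C (by rw [wtDer_jetVar, zero_smul])) fun n => scaleD_inclL_C (wtDer_expU n)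

/-- An element of the dressing ring that is invariant under all symmetries belongs to `𝓡`. -/
lemma exists_incl_eq {F : DressingRing k}
    (h : ∀ δ : DressingRing k →+ DressingRing k, IsSymmetry δ → δ F = 0) : ∃ f, incl f = F := by
  have hne (n : ℤ) (hn : n ≠ 0) : F.coeff n = 0 := by
    have h1 := congrArg (fun G : DressingRing k => G.coeff n) (h _ isSymmetry_symbolD)
    have h2 : (n : k) • F.coeff n = 0 := by
      rw [Int.cast_smul_eq_zsmul, ← coeff_symbolD]; exact h1
    rw [← one_smul k (F.coeff n), ← inv_mul_cancel₀ (Int.cast_ne_zero.2 hn : (n : k) ≠ 0),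
      mul_smul, h2, smul_zero]
  obtain ⟨f, hf⟩ := exists_inclL_eq (F := F.coeff 0)
    (by rw [← coeff_coeffD, h _ isSymmetry_explD]; rfl)
    (by rw [← coeff_coeffD, h _ isSymmetry_scaleD]; rfl)
  refine ⟨f, ?_⟩
  refine LaurentPolynomial.ext fun n => ?_
  rw [incl, RingHom.comp_apply, LaurentPolynomial.C_apply]
  split_ifs with hn
  · rw [hn, hf]
  · rw [hne n hn]

lemma expU_ne_one {n : ℤ} (hn : n ≠ 0) : (expU n : Jet k) ≠ 1 := by
  intro h
  rw [← expU_zero] at h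
  have := congrArg (fun f : Jet k => f.coeff n) h
  simp only [expU, LaurentPolynomial.T_apply, if_true, if_neg hn.symm] at this
  exact one_ne_zero this

lemma coeff_mul_of_vanish {A : Type*} [CommRing A] {F G : LaurentSeries A} {a b : ℤ}
    (hF : Vanish a F) (hG : Vanish b G) :
    (F * G).coeff (a + b) = F.coeff a * G.coeff b := by
  rw [HahnSeries.coeff_mul, Finset.sum_eq_single (a, b)]
  · intro p hp hne
    have hp' := (Finset.mem_antidiagonal.1 hp).2.2
    by_cases h1 : p.1 < a
    · rw [hF _ h1, zero_mul]
    · have h2 : p.2 < b := by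
        by_contra h2
        exact hne (Prod.ext (by simp; omega) (by simp; omega))
      rw [hG _ h2, mul_zero]
  · intro h
    by_contra h3
    exact h (Finset.mem_antidiagonal.2 ⟨fun h0 => h3 (by rw [h0, zero_mul]),
      fun h0 => h3 (by rw [h0, mul_zero]), rfl⟩)

/-- The fixed points of `Λ` in the dressing ring are killed by `ε ∂ₓ`. They do not involve the
symbol, since multiplication by a nontrivial power of `e^u` has no fixed points. -/
lemma epsDx_eq_zero_of_shiftD_eq {F : DressingRing k} (h : shiftD 1 F = F) : epsDx F = 0 := by
  refine LaurentPolynomial.ext fun n => ?_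
  have hn := congrArg (fun G : DressingRing k => G.coeff n) h
  simp only [coeff_shiftD] at hn
  rw [coeff_epsDx]
  by_cases h0 : n = 0
  · subst h0
    rw [qShiftFactor_exp_zero, map_one, mul_one] at hn
    rw [epsDxL_eq_zero_of_shiftL_eq hn, zero_smul, add_zero]; rfl
  · obtain ⟨a, ha⟩ := exists_vanish (F.coeff n)
    have hv : ∀ M : ℕ, Vanish (a + M) (F.coeff n) := by
      intro M
      induction M with
      | zero => simpa using ha
      | succ M ih =>
        intro i hi
        by_cases hlt : i < a + M
        · exact ih i hlt
        · have hi' : i = a + M := by push_cast at hi; omega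
          have hq : Vanish 0 (inclL (qShiftFactor 1 n : DiffRing k)) :=
            fun j hj => coeff_inclL_neg _ hj
          have hsv : Vanish (a + M) (shiftL 1 (F.coeff n)) := by
            rw [shiftL_eq_act]; exact ih.act dxXDer _
          have hc := coeff_mul_of_vanish hsv hq
          have hlead : (shiftL 1 (F.coeff n)).coeff (a + M) = (F.coeff n).coeff (a + M) := by
            have := vanish_act_sub dxXDer (expJ 1) ih 1 (a + M) (by omega)
            rw [shiftL_eq_act]
            simpa [expJ, sub_eq_zero] using this
          have hq0 : (inclL (qShiftFactor 1 n : DiffRing k)).coeff 0 = PowerSeries.C (expU n) := by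
            have := coeff_inclL_nat (qShiftFactor 1 n : DiffRing k) 0
            rw [Nat.cast_zero] at this
            rw [this, qShiftFactor_one, coeff_zero_shift]; simp
          rw [hn, add_zero, hlead, hq0] at hc
          have hz : (F.coeff n).coeff (a + M) * (PowerSeries.C (expU n) - 1) = 0 := by
            rw [mul_sub, mul_one, ← hc, sub_self]
          rw [hi']
          refine (mul_eq_zero.1 hz).resolve_right fun hz' => expU_ne_one (k := k) h0 ?_
          have := congrArg (PowerSeries.coeff 0) (sub_eq_zero.1 hz')
          simpa using this
    have hzero : F.coeff n = 0 := eq_of_forall_vanish (a := a) (by simpa using hv)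
    rw [hzero, mul_zero, zsmul_zero, add_zero]
    exact map_zero epsDxLHom

end

end

section

/-! ### Rings of difference operators that are bounded below -/

/-- An action of `ℤ` on a commutative ring by ring endomorphisms `f ↦ Λʲ f`. -/
structure ShiftAction (R : Type*) [CommRing R] where
  /-- The endomorphism `f ↦ Λʲ f`. -/
  hom : ℤ → R →+* R
  zero_apply : ∀ f, hom 0 f = f
  add_apply : ∀ i j f, hom (i + j) f = hom i (hom j f)

/-- The opposite action `f ↦ Λ⁻ʲ f`. -/
def ShiftAction.rev {R : Type*} [CommRing R] (τ : ShiftAction R) : ShiftAction R where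
  hom j := τ.hom (-j)
  zero_apply f := by rw [neg_zero, τ.zero_apply]
  add_apply i j f := by rw [neg_add, τ.add_apply]

lemma ShiftAction.rev_hom {R : Type*} [CommRing R] (τ : ShiftAction R) (j : ℤ) (f : R) :
    τ.rev.hom j f = τ.hom (-j) f := rfl

variable {R : Type*} [CommRing R] (τ : ShiftAction R)

lemma opMul_eq_sum (A B : ℤ → R) (n : ℤ) (s : Finset ℤ)
    (h : ∀ i ∉ s, A i = 0 ∨ B (n - i) = 0) :
    opMul (fun j => τ.hom j) A B n = ∑ i ∈ s, A i * τ.hom i (B (n - i)) := by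
  refine finsum_eq_sum_of_support_subset _ fun i hi => ?_
  by_contra hs
  rcases h i hs with h | h
  · exact hi (by simp [h])
  · exact hi (by simp [h])

lemma opMul_bound {A B : ℤ → R} {a b : ℤ} (hA : ∀ n < a, A n = 0) (hB : ∀ n < b, B n = 0) :
    ∀ n < a + b, opMul (fun j => τ.hom j) A B n = 0 := fun n hn => by
  rw [opMul_eq_sum τ A B n ∅, Finset.sum_empty]
  intro i _
  by_cases h : i < a
  · exact Or.inl (hA i h)
  · exact Or.inr (hB _ (by omega))

/-- Difference operators `∑_{j ≥ N} aⱼ Λʲ`. For the action `τ.rev` these are the operators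
`∑_{j ≤ N} aⱼ Λʲ` of the action `τ`, written in the powers of `Λ⁻¹`. -/
structure LowerOp (τ : ShiftAction R) where
  /-- The coefficient of `Λʲ`. -/
  coeff : ℤ → R
  exists_bound : ∃ N, ∀ n < N, coeff n = 0

namespace LowerOp

variable {τ}

lemma ext {A B : LowerOp τ} (h : ∀ n, A.coeff n = B.coeff n) : A = B := by
  cases A; cases B
  congr 1
  exact funext h

lemma coeff_injective : Function.Injective (coeff : LowerOp τ → ℤ → R) :=
  fun _ _ h => ext (congrFun h)

instance : Zero (LowerOp τ) := ⟨⟨0, 0, fun _ _ => rfl⟩⟩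

instance : Add (LowerOp τ) where
  add A B := ⟨A.coeff + B.coeff, by
    obtain ⟨a, ha⟩ := A.exists_bound
    obtain ⟨b, hb⟩ := B.exists_bound
    exact ⟨min a b, fun n hn => by
      rw [Pi.add_apply, ha n (by omega), hb n (by omega), add_zero]⟩⟩

instance : Neg (LowerOp τ) where
  neg A := ⟨-A.coeff, by
    obtain ⟨a, ha⟩ := A.exists_bound
    exact ⟨a, fun n hn => by rw [Pi.neg_apply, ha n hn, neg_zero]⟩⟩

instance : Sub (LowerOp τ) where
  sub A B := ⟨A.coeff - B.coeff, by
    obtain ⟨a, ha⟩ := A.exists_bound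
    obtain ⟨b, hb⟩ := B.exists_bound
    exact ⟨min a b, fun n hn => by
      rw [Pi.sub_apply, ha n (by omega), hb n (by omega), sub_zero]⟩⟩

instance : SMul ℕ (LowerOp τ) where
  smul m A := ⟨m • A.coeff, by
    obtain ⟨a, ha⟩ := A.exists_bound
    exact ⟨a, fun n hn => by rw [Pi.smul_apply, ha n hn, smul_zero]⟩⟩

instance : SMul ℤ (LowerOp τ) where
  smul m A := ⟨m • A.coeff, by
    obtain ⟨a, ha⟩ := A.exists_bound
    exact ⟨a, fun n hn => by rw [Pi.smul_apply, ha n hn, smul_zero]⟩⟩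

instance : AddCommGroup (LowerOp τ) :=
  coeff_injective.addCommGroup coeff rfl (fun _ _ => rfl) (fun _ => rfl) (fun _ _ => rfl)
    (fun _ _ => rfl) fun _ _ => rfl

lemma add_coeff (A B : LowerOp τ) (n : ℤ) : (A + B).coeff n = A.coeff n + B.coeff n := rfl

lemma sub_coeff (A B : LowerOp τ) (n : ℤ) : (A - B).coeff n = A.coeff n - B.coeff n := rfl

instance : Mul (LowerOp τ) where
  mul A B := ⟨opMul (fun j => τ.hom j) A.coeff B.coeff, by
    obtain ⟨a, ha⟩ := A.exists_bound
    obtain ⟨b, hb⟩ := B.exists_bound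
    exact ⟨a + b, opMul_bound τ ha hb⟩⟩

lemma coe_mul (A B : LowerOp τ) (n : ℤ) : (A * B).coeff n =
    opMul (fun j => τ.hom j) A.coeff B.coeff n := rfl

lemma mul_coeff (A B : LowerOp τ) (n : ℤ) {a b : ℤ} (hA : ∀ n < a, A.coeff n = 0)
    (hB : ∀ n < b, B.coeff n = 0) :
    (A * B).coeff n = ∑ i ∈ Finset.Icc a (n - b), A.coeff i * τ.hom i (B.coeff (n - i)) := by
  rw [coe_mul, opMul_eq_sum]
  intro i hi
  rw [Finset.mem_Icc, not_and_or] at hi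
  rcases hi with hi | hi
  · exact Or.inl (hA i (by omega))
  · exact Or.inr (hB _ (by omega))

/-- The operator `Λʲ`. -/
def lam (j : ℤ) : LowerOp τ := ⟨opShift j, j, fun _ hn => if_neg hn.ne⟩

lemma lam_coeff (j n : ℤ) : (lam j : LowerOp τ).coeff n = if n = j then 1 else 0 := rfl

lemma lam_mul_coeff (j : ℤ) (A : LowerOp τ) (n : ℤ) :
    (lam j * A).coeff n = τ.hom j (A.coeff (n - j)) := by
  rw [coe_mul, opMul_eq_sum τ _ _ n {j}]
  · simp [lam_coeff]
  · intro i hi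
    exact Or.inl (if_neg (by simpa using hi))

lemma mul_lam_coeff (A : LowerOp τ) (j n : ℤ) : (A * lam j).coeff n = A.coeff (n - j) := by
  rw [coe_mul, opMul_eq_sum τ _ _ n {n - j}]
  · simp [lam_coeff]
  · intro i hi
    refine Or.inr (if_neg fun h => hi ?_)
    rw [Finset.mem_singleton]
    omega

lemma mul_assoc' (A B C : LowerOp τ) : A * B * C = A * (B * C) := by
  obtain ⟨a, ha⟩ := A.exists_bound
  obtain ⟨b, hb⟩ := B.exists_bound
  obtain ⟨c, hc⟩ := C.exists_bound
  refine ext fun n => ?_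
  have hAB : ∀ m < a + b, (A * B).coeff m = 0 := opMul_bound τ ha hb
  have hBC : ∀ m < b + c, (B * C).coeff m = 0 := opMul_bound τ hb hc
  rw [mul_coeff (A * B) C n hAB hc, mul_coeff A (B * C) n ha hBC]
  have h1 : ∀ i ∈ Finset.Icc (a + b) (n - c), (A * B).coeff i * τ.hom i (C.coeff (n - i)) =
      ∑ j ∈ Finset.Icc a (n - (b + c)),
        A.coeff j * τ.hom j (B.coeff (i - j)) * τ.hom i (C.coeff (n - i)) := by
    intro i hi
    rw [Finset.mem_Icc] at hi
    rw [coe_mul, opMul_eq_sum τ _ _ i (Finset.Icc a (n - (b + c))), Finset.sum_mul]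
    intro j hj
    rw [Finset.mem_Icc, not_and_or] at hj
    rcases hj with hj | hj
    · exact Or.inl (ha j (by omega))
    · exact Or.inr (hb _ (by omega))
  have h2 : ∀ j ∈ Finset.Icc a (n - (b + c)), A.coeff j * τ.hom j ((B * C).coeff (n - j)) =
      ∑ i ∈ Finset.Icc (a + b) (n - c),
        A.coeff j * τ.hom j (B.coeff (i - j)) * τ.hom i (C.coeff (n - i)) := by
    intro j hj
    rw [Finset.mem_Icc] at hj
    rw [coe_mul, opMul_eq_sum τ _ _ (n - j)
      ((Finset.Icc (a + b) (n - c)).map (Equiv.subRight j).toEmbedding), Finset.sum_map, map_sum,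
      Finset.mul_sum]
    · refine Finset.sum_congr rfl fun i _ => ?_
      simp only [Equiv.coe_toEmbedding, Equiv.subRight_apply]
      rw [map_mul, ← τ.add_apply, mul_assoc, add_sub_cancel, sub_sub_sub_cancel_right]
    · intro l hl
      simp only [Finset.mem_map_equiv, Finset.mem_Icc, Equiv.subRight_symm_apply] at hl
      rw [not_and_or] at hl
      rcases hl with hl | hl
      · exact Or.inl (hb _ (by omega))
      · exact Or.inr (hc _ (by omega))
  rw [Finset.sum_congr rfl h1, Finset.sum_congr rfl h2, Finset.sum_comm]

instance : One (LowerOp τ) := ⟨lam 0⟩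

lemma one_coeff (n : ℤ) : (1 : LowerOp τ).coeff n = if n = 0 then 1 else 0 := rfl

instance : Ring (LowerOp τ) :=
  { (inferInstance : AddCommGroup (LowerOp τ)) with
    mul := (· * ·)
    one := 1
    mul_assoc := mul_assoc'
    one_mul := fun A => ext fun n => by
      change (lam 0 * A : LowerOp τ).coeff n = _
      rw [lam_mul_coeff, sub_zero, τ.zero_apply]
    mul_one := fun A => ext fun n => by
      change (A * lam 0 : LowerOp τ).coeff n = _
      rw [mul_lam_coeff, sub_zero]
    zero_mul := fun A => ext fun n => by
      exact (opMul_eq_sum τ (fun _ => 0) A.coeff n ∅ fun _ _ => Or.inl rfl).trans Finset.sum_empty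
    mul_zero := fun A => ext fun n => by
      exact (opMul_eq_sum τ A.coeff (fun _ => 0) n ∅ fun _ _ => Or.inr rfl).trans Finset.sum_empty
    left_distrib := fun A B C => ext fun n => by
      obtain ⟨a, ha⟩ := A.exists_bound
      obtain ⟨b, hb⟩ := B.exists_bound
      obtain ⟨c, hc⟩ := C.exists_bound
      have hb' : ∀ n < min b c, B.coeff n = 0 := fun n hn => hb n (by omega)
      have hc' : ∀ n < min b c, C.coeff n = 0 := fun n hn => hc n (by omega)
      have hs : ∀ n < min b c, (B + C).coeff n = 0 := fun n hn => by
        rw [add_coeff, hb' n hn, hc' n hn, add_zero]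
      rw [add_coeff, mul_coeff _ _ _ ha hs, mul_coeff _ _ _ ha hb', mul_coeff _ _ _ ha hc',
        ← Finset.sum_add_distrib]
      exact Finset.sum_congr rfl fun i _ => by rw [add_coeff, map_add, mul_add]
    right_distrib := fun A B C => ext fun n => by
      obtain ⟨a, ha⟩ := A.exists_bound
      obtain ⟨b, hb⟩ := B.exists_bound
      obtain ⟨c, hc⟩ := C.exists_bound
      have ha' : ∀ n < min a b, A.coeff n = 0 := fun n hn => ha n (by omega)
      have hb' : ∀ n < min a b, B.coeff n = 0 := fun n hn => hb n (by omega)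
      have hs : ∀ n < min a b, (A + B).coeff n = 0 := fun n hn => by
        rw [add_coeff, ha' n hn, hb' n hn, add_zero]
      rw [add_coeff, mul_coeff _ _ _ hs hc, mul_coeff _ _ _ ha' hc, mul_coeff _ _ _ hb' hc,
        ← Finset.sum_add_distrib]
      exact Finset.sum_congr rfl fun i _ => by rw [add_coeff, add_mul] }

/-- A ring homomorphism that intertwines two shift actions, applied to the coefficients. -/
def mapHom {S : Type*} [CommRing S] {σ : ShiftAction S} (f : R →+* S)
    (hf : ∀ j x, f (τ.hom j x) = σ.hom j (f x)) : LowerOp τ →+* LowerOp σ where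
  toFun A := ⟨fun n => f (A.coeff n), by
    obtain ⟨a, ha⟩ := A.exists_bound
    exact ⟨a, fun n hn => by rw [ha n hn, map_zero]⟩⟩
  map_zero' := ext fun n => map_zero f
  map_one' := ext fun n => by
    change f ((1 : LowerOp τ).coeff n) = (1 : LowerOp σ).coeff n
    rw [one_coeff, one_coeff]
    split_ifs
    · exact map_one f
    · exact map_zero f
  map_add' A B := ext fun n => map_add f _ _
  map_mul' A B := ext fun n => by
    obtain ⟨a, ha⟩ := A.exists_bound
    obtain ⟨b, hb⟩ := B.exists_bound
    change f ((A * B).coeff n) = _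
    rw [mul_coeff _ _ _ ha hb, mul_coeff (τ := σ) _ _ _ (a := a) (b := b), map_sum]
    · exact Finset.sum_congr rfl fun i _ => by rw [map_mul, hf]
    · intro m hm
      change f (A.coeff m) = 0
      rw [ha m hm, map_zero]
    · intro m hm
      change f (B.coeff m) = 0
      rw [hb m hm, map_zero]

/-- An additive endomorphism of the coefficient ring applied to the coefficients. -/
def mapAdd (δ : R →+ R) : LowerOp τ →+ LowerOp τ where
  toFun A := ⟨fun n => δ (A.coeff n), by
    obtain ⟨a, ha⟩ := A.exists_bound
    exact ⟨a, fun n hn => by rw [ha n hn, map_zero]⟩⟩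
  map_zero' := ext fun n => map_zero δ
  map_add' A B := ext fun n => map_add δ _ _

lemma mapAdd_coeff (δ : R →+ R) (A : LowerOp τ) (n : ℤ) :
    (mapAdd δ A).coeff n = δ (A.coeff n) := rfl

lemma mapAdd_mul {δ : R →+ R} (hl : ∀ f g, δ (f * g) = δ f * g + f * δ g)
    (hs : ∀ j f, δ (τ.hom j f) = τ.hom j (δ f)) (A B : LowerOp τ) :
    mapAdd δ (A * B) = mapAdd δ A * B + A * mapAdd δ B := ext fun n => by
  obtain ⟨a, ha⟩ := A.exists_bound
  obtain ⟨b, hb⟩ := B.exists_bound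
  have ha' : ∀ n < a, (mapAdd δ A).coeff n = 0 := fun n hn => by
    rw [mapAdd_coeff, ha n hn, map_zero]
  have hb' : ∀ n < b, (mapAdd δ B).coeff n = 0 := fun n hn => by
    rw [mapAdd_coeff, hb n hn, map_zero]
  rw [mapAdd_coeff, add_coeff, mul_coeff _ _ _ ha hb, mul_coeff _ _ _ ha' hb,
    mul_coeff _ _ _ ha hb', map_sum, ← Finset.sum_add_distrib]
  exact Finset.sum_congr rfl fun i _ => by rw [hl, hs]; rfl

lemma mapAdd_lam {δ : R →+ R} (hl : ∀ f g, δ (f * g) = δ f * g + f * δ g) (j : ℤ) :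
    mapAdd δ (lam j : LowerOp τ) = 0 := ext fun n => by
  have h1 : δ 1 = 0 := by simpa using hl 1 1
  rw [mapAdd_coeff, lam_coeff]
  split_ifs
  · exact h1
  · exact map_zero δ

/-! ### Inversion of operators -/

/-- The sequence determined by a recursion in which each term depends on the previous ones. -/
def strongSeq (F : ℕ → (ℕ → R) → R) (n : ℕ) : R :=
  F n fun i => if _h : i < n then strongSeq F i else 0
termination_by n

/-- The operator `∑_{j ≥ 0} rⱼ Λʲ`. -/
def ofNat (r : ℕ → R) : LowerOp τ :=
  ⟨fun n => if 0 ≤ n then r n.toNat else 0, 0, fun _ hn => if_neg (not_le.2 hn)⟩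

lemma ofNat_coeff (r : ℕ → R) (n : ℕ) : (ofNat r : LowerOp τ).coeff n = r n := by
  change (if (0 : ℤ) ≤ n then r (n : ℤ).toNat else 0) = _
  simp

lemma ofNat_coeff_neg (r : ℕ → R) {n : ℤ} (hn : n < 0) : (ofNat r : LowerOp τ).coeff n = 0 :=
  if_neg (not_le.2 hn)

lemma mul_coeff_nat {A B : LowerOp τ} (hA : ∀ n < 0, A.coeff n = 0) (hB : ∀ n < 0, B.coeff n = 0)
    (n : ℕ) : (A * B).coeff n =
      ∑ i ∈ Finset.range (n + 1), A.coeff i * τ.hom i (B.coeff ((n - i : ℕ) : ℤ)) := by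
  rw [coe_mul, opMul_eq_sum τ _ _ _ ((Finset.range (n + 1)).map Nat.castEmbedding),
    Finset.sum_map]
  · refine Finset.sum_congr rfl fun i hi => ?_
    have := Finset.mem_range.1 hi
    simp only [Nat.castEmbedding_apply]
    rw [show ((n - i : ℕ) : ℤ) = (n : ℤ) - i by omega]
  · intro i hi
    by_cases h : i < 0
    · exact Or.inl (hA i h)
    · refine Or.inr (hB _ ?_)
      by_contra h2
      refine hi (Finset.mem_map.2 ⟨i.toNat, ?_, ?_⟩)
      · rw [Finset.mem_range]; omega
      · simp only [Nat.castEmbedding_apply]; omega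

lemma exists_right_inverse {A : LowerOp τ} (hA : ∀ n < 0, A.coeff n = 0) (hu : IsUnit (A.coeff 0)) :
    ∃ B : LowerOp τ, (∀ n < 0, B.coeff n = 0) ∧ A * B = 1 ∧ IsUnit (B.coeff 0) := by
  obtain ⟨u, hu⟩ := hu
  let r : ℕ → R := strongSeq fun n r => u⁻¹.1 * ((if n = 0 then 1 else 0) -
    ∑ i ∈ Finset.range n, A.coeff ((i + 1 : ℕ) : ℤ) * τ.hom ((i + 1 : ℕ) : ℤ) (r (n - (i + 1))))
  have hr (n : ℕ) : r n = u⁻¹.1 * ((if n = 0 then 1 else 0) -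
      ∑ i ∈ Finset.range n,
        A.coeff ((i + 1 : ℕ) : ℤ) * τ.hom ((i + 1 : ℕ) : ℤ) (r (n - (i + 1)))) := by
    change strongSeq _ n = _
    rw [strongSeq]
    refine congrArg (fun z => u⁻¹.1 * ((if n = 0 then 1 else 0) - z))
      (Finset.sum_congr rfl fun i hi => ?_)
    have := Finset.mem_range.1 hi
    exact congrArg (fun z => A.coeff ((i + 1 : ℕ) : ℤ) * τ.hom ((i + 1 : ℕ) : ℤ) z)
      (dif_pos (by omega))
  have hneg : ∀ n < 0, (ofNat r : LowerOp τ).coeff n = 0 := fun n hn => ofNat_coeff_neg r hn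
  refine ⟨ofNat r, hneg, ext fun n => ?_, ?_⟩
  · rcases lt_or_ge n 0 with hn | hn
    · rw [one_coeff, if_neg hn.ne]
      exact opMul_bound τ hA hneg n (by omega)
    · lift n to ℕ using hn
      rw [mul_coeff_nat hA hneg, Finset.sum_range_succ', Nat.cast_zero, τ.zero_apply]
      simp only [ofNat_coeff]
      rw [Nat.sub_zero, hr n, ← mul_assoc, ← hu, Units.mul_inv, one_mul, add_sub_cancel, one_coeff]
      simp
  · have := ofNat_coeff (τ := τ) r 0
    rw [Nat.cast_zero] at this
    rw [this, hr]
    simp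

lemma exists_inverse {A : LowerOp τ} (hA : ∀ n < 0, A.coeff n = 0) (hu : IsUnit (A.coeff 0)) :
    ∃ B : LowerOp τ, (∀ n < 0, B.coeff n = 0) ∧ A * B = 1 ∧ B * A = 1 := by
  obtain ⟨B, hB, hAB, huB⟩ := exists_right_inverse hA hu
  obtain ⟨C, _, hBC, _⟩ := exists_right_inverse hB huB
  refine ⟨B, hB, hAB, ?_⟩
  have : A = C := by rw [← mul_one A, ← hBC, ← mul_assoc, hAB, one_mul]
  rw [this, hBC]

/-! ### Reversal -/

lemma opMul_rev (A B : ℤ → R) (n : ℤ) :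
    opMul (fun j => τ.rev.hom j) (fun i => A (-i)) (fun i => B (-i)) n =
      opMul (fun j => τ.hom j) A B (-n) := by
  unfold opMul
  rw [← finsum_comp_equiv (Equiv.neg ℤ)]
  refine finsum_congr fun i => ?_
  simp only [Equiv.neg_apply]
  rw [neg_sub', ShiftAction.rev_hom]
  simp only [neg_neg]

/-- The operators `A`, bounded below, and `B`, bounded above, are the same (finite) operator. -/
def Matches (A : LowerOp τ) (B : LowerOp τ.rev) : Prop := ∀ n, A.coeff n = B.coeff (-n)

lemma Matches.add {A A' : LowerOp τ} {B B' : LowerOp τ.rev} (h : Matches A B)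
    (h' : Matches A' B') : Matches (A + A') (B + B') := fun n => by
  rw [add_coeff, add_coeff, h, h']

lemma Matches.sub {A A' : LowerOp τ} {B B' : LowerOp τ.rev} (h : Matches A B)
    (h' : Matches A' B') : Matches (A - A') (B - B') := fun n => by
  rw [sub_coeff, sub_coeff, h, h']

lemma Matches.mul {A A' : LowerOp τ} {B B' : LowerOp τ.rev} (h : Matches A B)
    (h' : Matches A' B') : Matches (A * A') (B * B') := fun n => by
  have hB : (fun i => B.coeff i) = fun i => A.coeff (-i) := funext fun i => by rw [h, neg_neg]
  have hB' : (fun i => B'.coeff i) = fun i => A'.coeff (-i) := funext fun i => by rw [h', neg_neg]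
  rw [coe_mul, coe_mul]
  change _ = opMul (fun j => τ.rev.hom j) (fun i => B.coeff i) (fun i => B'.coeff i) (-n)
  rw [hB, hB', opMul_rev, neg_neg]

lemma Matches.one : Matches (1 : LowerOp τ) 1 := fun n => by
  rw [one_coeff, one_coeff]
  simp

lemma Matches.mapAdd {A : LowerOp τ} {B : LowerOp τ.rev} (h : Matches A B) (δ : R →+ R) :
    Matches (mapAdd δ A) (LowerOp.mapAdd δ B) := fun n => by
  rw [mapAdd_coeff, mapAdd_coeff, h]

lemma Matches.pow {A : LowerOp τ} {B : LowerOp τ.rev} (h : Matches A B) (p : ℕ) :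
    Matches (A ^ p) (B ^ p) := by
  induction p with
  | zero => rw [pow_zero, pow_zero]; exact Matches.one
  | succ p ih => rw [pow_succ, pow_succ]; exact ih.mul h

end LowerOp

end

section

namespace LowerOp

/-! ### Dressing operators for a second order operator -/

section Dressing

variable {R : Type*} [CommRing R] {τ : ShiftAction R}

lemma tridiagonal_mul_coeff {L : LowerOp τ} (hL : ∀ n, n ≠ -1 → n ≠ 0 → n ≠ 1 → L.coeff n = 0)
    (A : LowerOp τ) (n : ℤ) : (L * A).coeff n = L.coeff (-1) * τ.hom (-1) (A.coeff (n + 1)) +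
      L.coeff 0 * A.coeff n + L.coeff 1 * τ.hom 1 (A.coeff (n - 1)) := by
  rw [coe_mul, opMul_eq_sum τ _ _ n {-1, 0, 1}]
  · rw [Finset.sum_insert (by decide), Finset.sum_insert (by decide), Finset.sum_singleton,
      τ.zero_apply, sub_neg_eq_add, sub_zero, add_assoc]
  · intro i hi
    simp only [Finset.mem_insert, Finset.mem_singleton, not_or] at hi
    exact Or.inl (hL i hi.1 hi.2.1 hi.2.2)

/-- An operator `L = a Λ⁻¹ + v + b Λ` is conjugate to `Λ⁻¹`: if `q₀ = a Λ⁻¹ q₀` and `Λ q₀ = t q₀`,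
then `L Q = Q Λ⁻¹` has a solution `Q = q₀ ∑_{j ≥ 0} rⱼ Λʲ`, provided that `r - Λ⁻¹ r = s` can be
solved in a subring `S` which contains the data. -/
lemma exists_intertwiner {L : LowerOp τ} (hL : ∀ n, n ≠ -1 → n ≠ 0 → n ≠ 1 → L.coeff n = 0)
    (S : Subring R) (hS : ∀ s ∈ S, ∃ r ∈ S, r - τ.hom (-1) r = s)
    (hτ : ∀ s ∈ S, τ.hom 1 s ∈ S) {q₀ t : R} (hv : L.coeff 0 ∈ S) (hbt : L.coeff 1 * t ∈ S)
    (hq : L.coeff (-1) * τ.hom (-1) q₀ = q₀) (ht : τ.hom 1 q₀ = t * q₀) :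
    ∃ Q : LowerOp τ, (∀ n < 0, Q.coeff n = 0) ∧ Q.coeff 0 = q₀ ∧ L * Q = Q * lam (-1) := by
  choose! I hIS hI using hS
  -- `z n = (r n, r (n + 1))`
  let z : ℕ → R × R := fun n => Nat.rec (motive := fun _ => R × R) (1, I (L.coeff 0))
    (fun _ y => (y.2, I (L.coeff 0 * y.2 + L.coeff 1 * t * τ.hom 1 y.1))) n
  have hz (n : ℕ) : (z n).1 ∈ S ∧ (z n).2 ∈ S := by
    induction n with
    | zero => exact ⟨S.one_mem, hIS _ hv⟩
    | succ n ih => exact ⟨ih.2, hIS _ (S.add_mem (S.mul_mem hv ih.2) (S.mul_mem hbt (hτ _ ih.1)))⟩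
  let Q : LowerOp τ := ofNat fun n => q₀ * (z n).1
  have hQ (n : ℕ) : Q.coeff (n : ℤ) = q₀ * (z n).1 := ofNat_coeff _ n
  have hQneg {n : ℤ} (hn : n < 0) : Q.coeff n = 0 := ofNat_coeff_neg _ hn
  have hQ0 : Q.coeff 0 = q₀ := (hQ 0).trans (mul_one q₀)
  have h1 : (z 1).1 - τ.hom (-1) (z 1).1 = L.coeff 0 := hI _ hv
  have h2 (n : ℕ) : (z (n + 2)).1 - τ.hom (-1) (z (n + 2)).1 =
      L.coeff 0 * (z (n + 1)).1 + L.coeff 1 * t * τ.hom 1 (z n).1 :=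
    hI _ (S.add_mem (S.mul_mem hv (hz n).2) (S.mul_mem hbt (hτ _ (hz n).1)))
  refine ⟨Q, fun n hn => hQneg hn, hQ0, ext fun n => ?_⟩
  rw [tridiagonal_mul_coeff hL, mul_lam_coeff, sub_neg_eq_add]
  rcases lt_or_ge n 0 with hn | hn
  · rw [hQneg hn, hQneg (n := n - 1) (by omega), map_zero]
    rcases eq_or_ne n (-1) with rfl | hn'
    · rw [neg_add_cancel, hQ0, hq]
      ring
    · rw [hQneg (n := n + 1) (by omega), map_zero]
      ring
  lift n to ℕ using hn
  cases n with
  | zero =>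
    have e1 : Q.coeff (((0 : ℕ) : ℤ) + 1) = q₀ * (z 1).1 := hQ 1
    rw [e1, hQneg (n := ((0 : ℕ) : ℤ) - 1) (by omega), Nat.cast_zero, hQ0, map_mul, map_zero]
    linear_combination τ.hom (-1) (z 1).1 * hq - q₀ * h1
  | succ n =>
    have e1 : Q.coeff (((n + 1 : ℕ) : ℤ) + 1) = q₀ * (z (n + 2)).1 := hQ (n + 2)
    have e2 : Q.coeff (((n + 1 : ℕ) : ℤ) - 1) = q₀ * (z n).1 := by
      rw [← hQ n]
      congr 1
      push_cast
      ring
    rw [e1, e2, hQ, map_mul, map_mul, ht]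
    linear_combination τ.hom (-1) (z (n + 2)).1 * hq - q₀ * h2 n

variable {L Q Q' : LowerOp τ}

lemma lam_mul_eq_of_intertwiner (hLQ : L * Q = Q * lam (-1)) (h1 : Q * Q' = 1) (h2 : Q' * Q = 1) :
    lam (-1) * Q' = Q' * L := by
  calc lam (-1) * Q' = Q' * Q * lam (-1) * Q' := by rw [h2, one_mul]
    _ = Q' * (Q * lam (-1)) * Q' := by rw [mul_assoc Q' Q]
    _ = Q' * L * (Q * Q') := by rw [← hLQ]; simp only [mul_assoc]
    _ = Q' * L := by rw [h1, mul_one]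

variable {d : R →+ R}

/-- The logarithmic derivative `W = Qₓ Q⁻¹` of a dressing operator satisfies `[W, L] = Lₓ`. -/
lemma logDeriv_comm (hl : ∀ f g, d (f * g) = d f * g + f * d g)
    (hs : ∀ j f, d (τ.hom j f) = τ.hom j (d f))
    (hLQ : L * Q = Q * lam (-1)) (h1 : Q * Q' = 1) (h2 : Q' * Q = 1) :
    mapAdd d Q * Q' * L - L * (mapAdd d Q * Q') = mapAdd d L := by
  have h := congrArg (mapAdd d) hLQ
  rw [mapAdd_mul hl hs, mapAdd_mul hl hs, mapAdd_lam hl, mul_zero, add_zero] at h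
  have e : mapAdd d Q * Q' * L = mapAdd d L * Q * Q' + L * mapAdd d Q * Q' := by
    rw [← add_mul, h, mul_assoc, mul_assoc, lam_mul_eq_of_intertwiner hLQ h1 h2]
  rw [e, mul_assoc (mapAdd d L), h1, mul_one, mul_assoc L]
  abel

/-- The logarithmic derivative of a dressing operator `Q` of `L` is annihilated by every derivation
`δ` that annihilates `L`, as `Q⁻¹ δQ` commutes with `Λ`, hence is constant. -/
lemma mapAdd_logDeriv_eq_zero (hl : ∀ f g, d (f * g) = d f * g + f * d g)
    (hs : ∀ j f, d (τ.hom j f) = τ.hom j (d f)) (hd : ∀ f, τ.hom (-1) f = f → d f = 0)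
    {δ : R →+ R} (hδl : ∀ f g, δ (f * g) = δ f * g + f * δ g)
    (hδs : ∀ j f, δ (τ.hom j f) = τ.hom j (δ f)) (hδd : ∀ f, δ (d f) = d (δ f))
    (hδL : mapAdd δ L = 0) (hLQ : L * Q = Q * lam (-1)) (h1 : Q * Q' = 1) (h2 : Q' * Q = 1) :
    mapAdd δ (mapAdd d Q * Q') = 0 := by
  have h := congrArg (mapAdd δ) hLQ
  rw [mapAdd_mul hδl hδs, mapAdd_mul hδl hδs, mapAdd_lam hδl, mul_zero, add_zero, hδL, zero_mul,
    zero_add] at h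
  set C := Q' * mapAdd δ Q with hC
  have hCc : lam (-1) * C = C * lam (-1) := by
    rw [hC, ← mul_assoc, lam_mul_eq_of_intertwiner hLQ h1 h2, mul_assoc, mul_assoc, h]
  have hdC : mapAdd d C = 0 := ext fun n => by
    have := congrArg (fun A => coeff A (n - 1)) hCc
    simp only [lam_mul_coeff, mul_lam_coeff, sub_neg_eq_add, sub_add_cancel] at this
    exact hd _ this
  have hQ : mapAdd δ Q = Q * C := by rw [hC, ← mul_assoc, h1, one_mul]
  have hQ' : mapAdd δ Q' = -(C * Q') := by
    have e := congrArg (mapAdd δ) h2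
    rw [mapAdd_mul hδl hδs, show (1 : LowerOp τ) = lam 0 from rfl, mapAdd_lam hδl, ← hC] at e
    have e2 : (mapAdd δ Q' * Q + C) * Q' = 0 := by rw [e, zero_mul]
    rw [add_mul, mul_assoc, h1, mul_one] at e2
    exact eq_neg_of_add_eq_zero_left e2
  have hcomm : mapAdd δ (mapAdd d Q) = mapAdd d (mapAdd δ Q) := ext fun n => hδd _
  rw [mapAdd_mul hδl hδs, hcomm, hQ, mapAdd_mul hl hs, hdC, mul_zero, add_zero, hQ', mul_neg,
    mul_assoc, add_neg_cancel]

end Dressing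

end LowerOp

/-! ### Dressing operators of the Lax operator and its logarithm -/

variable {k : Type*} [Field k]

/-- `ε∂ₓ` as an additive endomorphism of the dressing ring. -/
def epsDxHom (k : Type*) [Field k] : DressingRing k →+ DressingRing k :=
  AddMonoidHom.mk' epsDx epsDx_add

lemma epsDxHom_mul (F G : DressingRing k) :
    epsDxHom k (F * G) = epsDxHom k F * G + F * epsDxHom k G := epsDx_mul F G

lemma incl_two_mul (f : DiffRing k) : incl (2 * f) = 2 * incl f := by rw [map_mul, map_ofNat]

lemma lax_one : lax k 1 = 1 := rfl
lemma lax_zero : lax k 0 = PowerSeries.C (jetVar Label.one 0) := rfl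
lemma lax_neg_one : lax k (-1) = PowerSeries.C (expU 1) := rfl
lemma lax_eq_zero {n : ℤ} (h1 : n ≠ -1) (h2 : n ≠ 0) (h3 : n ≠ 1) : lax k n = 0 := by
  rw [lax, if_neg h3, if_neg h2, if_neg h1]

lemma eps_dxR_add (f g : DiffRing k) : eps * dxR (f + g) = eps * dxR f + eps * dxR g :=
  inclL_injective (by simp only [map_add, inclL_eps_mul_dxR, epsDxL_add])

lemma eps_dxR_mul (f g : DiffRing k) :
    eps * dxR (f * g) = eps * dxR f * g + f * (eps * dxR g) :=
  inclL_injective (by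
    rw [map_add, map_mul inclL (eps * dxR f), map_mul inclL f (eps * _), inclL_eps_mul_dxR,
      inclL_eps_mul_dxR, inclL_eps_mul_dxR, map_mul, epsDxL_mul])

variable [CharZero k]

open LowerOp

/-- The action of `Λ` on `𝓡`. -/
def shiftAction (k : Type*) [Field k] [CharZero k] : ShiftAction (DiffRing k) :=
  ⟨shiftHom, shift_zero_index, shift_add_index⟩

/-- The action of `Λ` on the dressing ring. -/
def shiftDAction (k : Type*) [Field k] [CharZero k] : ShiftAction (DressingRing k) :=
  ⟨shiftDHom, shiftD_zero_index, shiftD_add_index⟩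

/-- `L` as an operator bounded below. -/
def laxUp (k : Type*) [Field k] [CharZero k] : LowerOp (shiftAction k) :=
  ⟨lax k, -1, fun _ _ => lax_eq_zero (by omega) (by omega) (by omega)⟩

/-- `L` as an operator bounded above. -/
def laxDown (k : Type*) [Field k] [CharZero k] : LowerOp (shiftAction k).rev :=
  ⟨fun n => lax k (-n), -1, fun _ _ => lax_eq_zero (by omega) (by omega) (by omega)⟩

/-- The inclusion of `𝓡` into the dressing ring, for operators bounded below. -/
def inclUp (k : Type*) [Field k] [CharZero k] :
    LowerOp (shiftAction k) →+* LowerOp (shiftDAction k) :=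
  mapHom incl fun j f => (shiftD_incl j f).symm

/-- The inclusion of `𝓡` into the dressing ring, for operators bounded above. -/
def inclDown (k : Type*) [Field k] [CharZero k] :
    LowerOp (shiftAction k).rev →+* LowerOp (shiftDAction k).rev :=
  mapHom incl fun j f => (shiftD_incl (-j) f).symm

lemma inclUp_injective : Function.Injective (inclUp k) := fun _ _ h =>
  LowerOp.ext fun n => incl_injective (congrArg (fun A => coeff A n) h)

lemma inclDown_injective : Function.Injective (inclDown k) := fun _ _ h =>
  LowerOp.ext fun n => incl_injective (congrArg (fun A => coeff A n) h)

lemma opMul_neg {R : Type*} [CommRing R] {τ : ShiftAction R} (A B : LowerOp τ.rev) (n : ℤ) :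
    opMul (fun j => τ.hom j) (fun i => A.coeff (-i)) (fun i => B.coeff (-i)) n =
      (A * B).coeff (-n) := by
  have := opMul_rev (τ := τ) (fun i => A.coeff (-i)) (fun i => B.coeff (-i)) (-n)
  simp only [neg_neg] at this
  exact this.symm

lemma exists_intertwiner_up : ∃ Q : LowerOp (shiftDAction k), (∀ n < 0, Q.coeff n = 0) ∧
    Q.coeff 0 = LaurentPolynomial.T 1 ∧ inclUp k (laxUp k) * Q = Q * lam (-1) := by
  have hT (j : ℤ) : shiftD j (LaurentPolynomial.T 1 : DressingRing k) =
      LaurentPolynomial.C (inclL (qShiftFactor j 1)) * LaurentPolynomial.T 1 := by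
    rw [← one_mul (LaurentPolynomial.T 1), ← map_one LaurentPolynomial.C, shiftD_eq_mapT,
      mapT_C_mul_T]
    simp
  refine exists_intertwiner (L := inclUp k (laxUp k))
    (t := LaurentPolynomial.C (inclL (shift 1 (PowerSeries.C (expU 1)))))
    (fun n h1 h2 h3 => ?_) (LaurentPolynomial.C (R := LaurentJetX k)).range ?_ ?_ ⟨_, rfl⟩ ?_ ?_ ?_
  · change incl (lax k n) = 0
    rw [lax_eq_zero h1 h2 h3, map_zero]
  · rintro _ ⟨s, rfl⟩
    obtain ⟨F, hF⟩ := exists_shiftL_sub_eq s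
    refine ⟨_, ⟨shiftL 1 F, rfl⟩, ?_⟩
    change _ - shiftD (-1) _ = _
    rw [shiftD_C, ← shiftL_add_index, neg_add_cancel, shiftL_zero_index, ← map_sub, hF]
  · rintro _ ⟨s, rfl⟩
    exact ⟨shiftL 1 s, (shiftD_C 1 s).symm⟩
  · change incl 1 * _ ∈ _
    rw [map_one, one_mul]
    exact ⟨_, rfl⟩
  · change incl (PowerSeries.C (expU 1)) * shiftD (-1) _ = _
    rw [hT, ← mul_assoc, incl, RingHom.comp_apply, ← map_mul, ← map_mul]
    have : (PowerSeries.C (expU 1) * qShiftFactor (-1) 1 : DiffRing k) = 1 := by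
      simp [qShiftFactor, shift_zero_index, ← map_mul, ← expU_add, expU_zero]
    rw [this, map_one, map_one, one_mul]
  · change shiftD 1 _ = _
    rw [hT, qShiftFactor_one]

lemma exists_intertwiner_down : ∃ P : LowerOp (shiftDAction k).rev, (∀ n < 0, P.coeff n = 0) ∧
    P.coeff 0 = 1 ∧ inclDown k (laxDown k) * P = P * lam (-1) := by
  refine exists_intertwiner (L := inclDown k (laxDown k)) (t := 1)
    (fun n h1 h2 h3 => ?_) (LaurentPolynomial.C (R := LaurentJetX k)).range ?_ ?_ ⟨_, rfl⟩ ?_ ?_ ?_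
  · change incl (lax k (-n)) = 0
    rw [lax_eq_zero (by omega) (by omega) (by omega), map_zero]
  · rintro _ ⟨s, rfl⟩
    obtain ⟨F, hF⟩ := exists_shiftL_sub_eq (-s)
    refine ⟨_, ⟨F, rfl⟩, ?_⟩
    change _ - shiftD (- -1) _ = _
    rw [neg_neg, shiftD_C, ← map_sub, ← neg_sub, hF, neg_neg]
  · rintro _ ⟨s, rfl⟩
    exact ⟨shiftL (-1) s, (shiftD_C (-1) s).symm⟩
  · rw [mul_one]
    exact ⟨_, rfl⟩
  · change incl (lax k (- -1)) * (shiftDHom (- -1)) 1 = 1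
    rw [neg_neg, lax_one, map_one, map_one, one_mul]
  · rw [map_one, one_mul]

lemma isDressingQ_iff {Q Q' : LowerOp (shiftDAction k)} (h0 : ∀ n < 0, Q.coeff n = 0)
    (h0' : ∀ n < 0, Q'.coeff n = 0) : IsDressingQ Q.coeff Q'.coeff ↔
      Q * Q' = 1 ∧ Q' * Q = 1 ∧ Q * lam (-1) * Q' = inclUp k (laxUp k) :=
  ⟨fun h => ⟨coeff_injective h.mul_inv, coeff_injective h.inv_mul, coeff_injective h.dress⟩,
    fun h => ⟨h0, h0', congrArg coeff h.1, congrArg coeff h.2.1, congrArg coeff h.2.2⟩⟩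

/-- The dressing operator `P` is written in powers of `Λ⁻¹`, with coefficients `p n = P (-n)`. -/
lemma isDressingP_iff {P P' : LowerOp (shiftDAction k).rev} (h0 : ∀ n < 0, P.coeff n = 0)
    (h0' : ∀ n < 0, P'.coeff n = 0) :
    IsDressingP (fun n => P.coeff (-n)) (fun n => P'.coeff (-n)) ↔ P.coeff 0 = 1 ∧
      P * P' = 1 ∧ P' * P = 1 ∧ P * lam (-1) * P' = inclDown k (laxDown k) := by
  have e1 (A B : LowerOp (shiftDAction k).rev) : opMul shiftD (fun i => A.coeff (-i))
      (fun i => B.coeff (-i)) = fun n => (A * B).coeff (-n) := funext fun n => opMul_neg A B n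
  have e2 : (opShift 1 : ℤ → DressingRing k) =
      fun i => (lam (-1) : LowerOp (shiftDAction k).rev).coeff (-i) := funext fun n => by
    rw [lam_coeff, opShift]
    congr 1
    rw [eq_iff_iff]
    omega
  have e3 : (opShift 0 : ℤ → DressingRing k) =
      fun i => (1 : LowerOp (shiftDAction k).rev).coeff (-i) := funext fun n => by
    rw [one_coeff, opShift]
    congr 1
    rw [eq_iff_iff]
    omega
  have e4 : laxD k = fun i => (inclDown k (laxDown k)).coeff (-i) := funext fun n => by
    change incl (lax k n) = incl (lax k (- -n))
    rw [neg_neg]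
  have e5 (A B : LowerOp (shiftDAction k).rev) :
      ((fun n => A.coeff (-n)) = fun n => B.coeff (-n)) ↔ A = B := by
    refine ⟨fun h => LowerOp.ext fun n => ?_, fun h => by rw [h]⟩
    have := congrFun h (-n)
    simpa only [neg_neg] using this
  constructor
  · intro h
    have h1 := h.mul_inv
    have h2 := h.inv_mul
    have h3 := h.dress
    rw [e1, e3, e5] at h1 h2
    rw [e2, e1, e1, e4, e5] at h3
    exact ⟨by simpa using h.lead, h1, h2, h3⟩
  · rintro ⟨h, h1, h2, h3⟩
    refine ⟨fun n hn => h0 _ (by omega), fun n hn => h0' _ (by omega), by simpa using h, ?_, ?_, ?_⟩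
    · rw [e1, e3, e5, h1]
    · rw [e1, e3, e5, h2]
    · rw [e2, e1, e1, e4, e5, h3]

lemma mul_lam_eq_iff {R : Type*} [CommRing R] {τ : ShiftAction R} {L Q Q' : LowerOp τ}
    (h1 : Q * Q' = 1) (h2 : Q' * Q = 1) :
    Q * lam (-1) * Q' = L ↔ L * Q = Q * lam (-1) := by
  constructor
  · rintro rfl
    rw [mul_assoc, h2, mul_one]
  · intro h
    rw [← h, mul_assoc, h1, mul_one]

/-- `2 log L` has coefficients in `𝓡`: they are annihilated by all symmetries. -/
lemma exists_incl_eq_logDeriv_coeff {τ : ShiftAction (DressingRing k)}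
    (hτ : ∀ j, ∃ i, ∀ F, τ.hom j F = shiftD i F)
    (hfix : ∀ F, τ.hom (-1) F = F → shiftD 1 F = F) {L Q Q' : LowerOp τ}
    (hL : ∀ n, ∃ m, L.coeff n = laxD k m) (hLQ : L * Q = Q * lam (-1))
    (h1 : Q * Q' = 1) (h2 : Q' * Q = 1) (n : ℤ) :
    ∃ f, incl f = (mapAdd (epsDxHom k) Q * Q').coeff n := by
  refine exists_incl_eq fun δ hδ => ?_
  have := mapAdd_logDeriv_eq_zero (d := epsDxHom k) (L := L) (δ := δ) epsDx_mul (fun j f => ?_)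
    (fun f hf => epsDx_eq_zero_of_shiftD_eq (hfix f hf)) hδ.leibniz (fun j f => ?_) hδ.epsDx
    (LowerOp.ext fun n => ?_) hLQ h1 h2
  · exact congrArg (fun A => coeff A n) this
  · obtain ⟨i, hi⟩ := hτ j
    rw [hi, hi]
    exact (shiftD_epsDx i f).symm
  · obtain ⟨i, hi⟩ := hτ j
    rw [hi, hi, hδ.shift]
  · obtain ⟨m, hm⟩ := hL n
    rw [mapAdd_coeff, hm, hδ.lax]
    rfl

lemma shiftD_one_eq_of_neg {F : DressingRing k} (h : shiftD (-1) F = F) : shiftD 1 F = F := by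
  conv_lhs => rw [← h]
  rw [← shiftD_add_index, add_neg_cancel, shiftD_zero_index]

theorem exists_isLogLax : ∃ g : ℤ → DiffRing k, IsLogLax g := by
  obtain ⟨Q, hQ0, hQ1, hLQ⟩ := exists_intertwiner_up (k := k)
  obtain ⟨P, hP0, hP1, hLP⟩ := exists_intertwiner_down (k := k)
  obtain ⟨Q', hQ0', hQQ', hQ'Q⟩ := exists_inverse hQ0 (hQ1 ▸ LaurentPolynomial.isUnit_T 1)
  obtain ⟨P', hP0', hPP', hP'P⟩ := exists_inverse hP0 (hP1 ▸ isUnit_one)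
  choose y hy using exists_incl_eq_logDeriv_coeff (fun j => ⟨j, fun F => rfl⟩)
    (fun F => shiftD_one_eq_of_neg) (fun n => ⟨n, rfl⟩) hLQ hQQ' hQ'Q
  choose z hz using exists_incl_eq_logDeriv_coeff (fun j => ⟨-j, fun F => rfl⟩)
    (fun F h => (show shiftD (- -1) F = F from h)) (fun n => ⟨-n, rfl⟩) hLP hPP' hP'P
  have h2 : (2 : DiffRing k) * PowerSeries.C (algebraMap k (Jet k) 2⁻¹) = 1 := by
    have : (2 : DiffRing k) = PowerSeries.C (algebraMap k (Jet k) 2) :=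
      (map_ofNat ((PowerSeries.C (R := Jet k)).comp (algebraMap k (Jet k))) 2).symm
    rw [this, ← map_mul, ← map_mul, mul_inv_cancel₀ two_ne_zero, map_one, map_one]
  refine ⟨fun n => PowerSeries.C (algebraMap k (Jet k) 2⁻¹) * (y n - z (-n)),
    _, _, _, _, (isDressingP_iff hP0 hP0').2 ⟨hP1, hPP', hP'P, (mul_lam_eq_iff hPP' hP'P).2 hLP⟩,
    (isDressingQ_iff hQ0 hQ0').2 ⟨hQQ', hQ'Q, (mul_lam_eq_iff hQQ' hQ'Q).2 hLQ⟩, fun n => ?_⟩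
  have e : opMul shiftD (fun i => epsDx (P.coeff (-i))) (fun i => P'.coeff (-i)) n =
      (mapAdd (epsDxHom k) P * P').coeff (-n) := opMul_neg (mapAdd (epsDxHom k) P) P' n
  rw [e, ← hz, show opMul shiftD (fun i => epsDx (Q.coeff i)) Q'.coeff n =
    (mapAdd (epsDxHom k) Q * Q').coeff n from rfl, ← hy, ← map_sub]
  have : (2 : DressingRing k) = incl 2 := (map_ofNat incl 2).symm
  rw [this, ← map_mul, ← mul_assoc, h2, one_mul]

/-- The nonnegative part of `2 log L`. -/
def logUp (g : ℤ → DiffRing k) : LowerOp (shiftAction k) :=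
  ⟨fun n => if 0 ≤ n then 2 * g n else 0, 0, fun _ hn => if_neg (not_le.2 hn)⟩

/-- The negative part of `-2 log L`. -/
def logDown (g : ℤ → DiffRing k) : LowerOp (shiftAction k).rev :=
  ⟨fun n => if 0 < n then -(2 * g (-n)) else 0, 0, fun _ hn => if_neg (by omega)⟩

/-- `ε∂ₓ` as an additive endomorphism of `𝓡`. -/
def epsDxR (k : Type*) [Field k] : DiffRing k →+ DiffRing k :=
  AddMonoidHom.mk' (fun f => eps * dxR f) eps_dxR_add

lemma inclUp_mapAdd (A : LowerOp (shiftAction k)) :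
    inclUp k (mapAdd (epsDxR k) A) = mapAdd (epsDxHom k) (inclUp k A) :=
  LowerOp.ext fun _ => (epsDx_incl _).symm

lemma inclDown_mapAdd (A : LowerOp (shiftAction k).rev) :
    inclDown k (mapAdd (epsDxR k) A) = mapAdd (epsDxHom k) (inclDown k A) :=
  LowerOp.ext fun _ => (epsDx_incl _).symm

lemma epsDxHom_shiftDAction (j : ℤ) (F : DressingRing k) :
    epsDxHom k ((shiftDAction k).hom j F) = (shiftDAction k).hom j (epsDxHom k F) :=
  (shiftD_epsDx j F).symm

/-- The hypothesis `IsLogLax g` in terms of rings of operators. -/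
lemma IsLogLax.exists_lowerOp {g : ℤ → DiffRing k} (h : IsLogLax g) :
    ∃ (P P' : LowerOp (shiftDAction k).rev) (Q Q' : LowerOp (shiftDAction k)),
      ((∀ n < 0, P.coeff n = 0) ∧ (∀ n < 0, P'.coeff n = 0) ∧ P.coeff 0 = 1 ∧
        P * P' = 1 ∧ P' * P = 1 ∧ inclDown k (laxDown k) * P = P * lam (-1)) ∧
      ((∀ n < 0, Q.coeff n = 0) ∧ (∀ n < 0, Q'.coeff n = 0) ∧
        Q * Q' = 1 ∧ Q' * Q = 1 ∧ inclUp k (laxUp k) * Q = Q * lam (-1)) ∧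
      ∀ n, 2 * incl (g n) = (mapAdd (epsDxHom k) Q * Q').coeff n -
        (mapAdd (epsDxHom k) P * P').coeff (-n) := by
  obtain ⟨P₀, P₀', Q₀, Q₀', hP, hQ, hg⟩ := h
  obtain ⟨Q, rfl⟩ : ∃ Q : LowerOp (shiftDAction k), Q.coeff = Q₀ := ⟨⟨Q₀, 0, hQ.supp⟩, rfl⟩
  obtain ⟨Q', rfl⟩ : ∃ Q : LowerOp (shiftDAction k), Q.coeff = Q₀' := ⟨⟨Q₀', 0, hQ.supp_inv⟩, rfl⟩
  obtain ⟨P, rfl⟩ : ∃ P : LowerOp (shiftDAction k).rev, (fun n => P.coeff (-n)) = P₀ :=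
    ⟨⟨fun n => P₀ (-n), 0, fun n hn => hP.supp _ (by omega)⟩,
      funext fun n => congrArg P₀ (neg_neg n)⟩
  obtain ⟨P', rfl⟩ : ∃ P : LowerOp (shiftDAction k).rev, (fun n => P.coeff (-n)) = P₀' :=
    ⟨⟨fun n => P₀' (-n), 0, fun n hn => hP.supp_inv _ (by omega)⟩,
      funext fun n => congrArg P₀' (neg_neg n)⟩
  have hP0 : ∀ n < 0, P.coeff n = 0 := fun n hn => by
    have := hP.supp (-n) (by omega)
    rwa [neg_neg] at this
  have hP0' : ∀ n < 0, P'.coeff n = 0 := fun n hn => by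
    have := hP.supp_inv (-n) (by omega)
    rwa [neg_neg] at this
  obtain ⟨hP1, hPP', hP'P, hLP⟩ := (isDressingP_iff hP0 hP0').1 hP
  obtain ⟨hQQ', hQ'Q, hLQ⟩ := (isDressingQ_iff hQ.supp hQ.supp_inv).1 hQ
  refine ⟨P, P', Q, Q', ⟨hP0, hP0', hP1, hPP', hP'P, (mul_lam_eq_iff hPP' hP'P).1 hLP⟩,
    ⟨hQ.supp, hQ.supp_inv, hQQ', hQ'Q, (mul_lam_eq_iff hQQ' hQ'Q).1 hLQ⟩, fun n => ?_⟩
  rw [hg n, ← opMul_neg (mapAdd (epsDxHom k) P) P' n]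
  rfl

section LogDeriv

variable {P P' : LowerOp (shiftDAction k).rev} {Q Q' : LowerOp (shiftDAction k)}

lemma logDerivUp_coeff (hQ : ∀ n < 0, Q.coeff n = 0) (hQ' : ∀ n < 0, Q'.coeff n = 0) :
    ∀ n < 0, (mapAdd (epsDxHom k) Q * Q').coeff n = 0 := fun n hn =>
  opMul_bound (a := 0) (b := 0) _ (fun n hn => by rw [mapAdd_coeff, hQ n hn, map_zero])
    hQ' n (by omega)

/-- The logarithmic derivative of `P` is strictly negative, as the leading coefficient of `P` is
constant. -/
lemma logDerivDown_coeff (hP : ∀ n < 0, P.coeff n = 0) (hP' : ∀ n < 0, P'.coeff n = 0)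
    (h1 : P.coeff 0 = 1) : ∀ n < 1, (mapAdd (epsDxHom k) P * P').coeff n = 0 := fun n hn =>
  opMul_bound (a := 1) (b := 0) _ (fun n hn => by
    rcases eq_or_ne n 0 with rfl | hn'
    · rw [mapAdd_coeff, h1]
      change epsDx 1 = 0
      have := epsDx_mul (1 : DressingRing k) 1
      simpa using this
    · rw [mapAdd_coeff, hP n (by omega), map_zero]) hP' n (by omega)

variable {g : ℤ → DiffRing k}

lemma inclUp_logUp (hW : ∀ n, 2 * incl (g n) =
      (mapAdd (epsDxHom k) Q * Q').coeff n - (mapAdd (epsDxHom k) P * P').coeff (-n))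
    (hQ : ∀ n < 0, (mapAdd (epsDxHom k) Q * Q').coeff n = 0)
    (hP : ∀ n < 1, (mapAdd (epsDxHom k) P * P').coeff n = 0) :
    inclUp k (logUp g) = mapAdd (epsDxHom k) Q * Q' := LowerOp.ext fun n => by
  change incl (if 0 ≤ n then 2 * g n else 0) = _
  split_ifs with hn
  · rw [incl_two_mul, hW, hP _ (by omega), sub_zero]
  · rw [map_zero, hQ n (by omega)]

lemma inclDown_logDown (hW : ∀ n, 2 * incl (g n) =
      (mapAdd (epsDxHom k) Q * Q').coeff n - (mapAdd (epsDxHom k) P * P').coeff (-n))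
    (hQ : ∀ n < 0, (mapAdd (epsDxHom k) Q * Q').coeff n = 0)
    (hP : ∀ n < 1, (mapAdd (epsDxHom k) P * P').coeff n = 0) :
    inclDown k (logDown g) = mapAdd (epsDxHom k) P * P' := LowerOp.ext fun n => by
  change incl (if 0 < n then -(2 * g (-n)) else 0) = _
  split_ifs with hn
  · rw [map_neg, incl_two_mul, hW, hQ _ (by omega), neg_neg, zero_sub, neg_neg]
  · rw [map_zero, hP n (by omega)]

end LogDeriv

/-- The two halves of `2 log L` satisfy `[y, L] = ε Lₓ`. -/
theorem IsLogLax.logUp_comm {g : ℤ → DiffRing k} (h : IsLogLax g) :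
    logUp g * laxUp k - laxUp k * logUp g = mapAdd (epsDxR k) (laxUp k) := by
  obtain ⟨P, P', Q, Q', ⟨hP0, hP0', hP1, -⟩, ⟨hQ0, hQ0', hQQ', hQ'Q, hLQ⟩, hW⟩ :=
    h.exists_lowerOp
  have c := logDeriv_comm (τ := shiftDAction k) (d := epsDxHom k) (L := inclUp k (laxUp k))
    epsDxHom_mul epsDxHom_shiftDAction hLQ hQQ' hQ'Q
  refine inclUp_injective ?_
  rw [map_sub, map_mul, map_mul, inclUp_mapAdd, inclUp_logUp hW (logDerivUp_coeff hQ0 hQ0')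
    (logDerivDown_coeff hP0 hP0' hP1), c]

theorem IsLogLax.logDown_comm {g : ℤ → DiffRing k} (h : IsLogLax g) :
    logDown g * laxDown k - laxDown k * logDown g = mapAdd (epsDxR k) (laxDown k) := by
  obtain ⟨P, P', Q, Q', ⟨hP0, hP0', hP1, hPP', hP'P, hLP⟩, ⟨hQ0, hQ0', -⟩, hW⟩ :=
    h.exists_lowerOp
  have c := logDeriv_comm (τ := (shiftDAction k).rev) (d := epsDxHom k)
    (L := inclDown k (laxDown k)) epsDxHom_mul (fun j f => epsDxHom_shiftDAction (-j) f)
    hLP hPP' hP'P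
  refine inclDown_injective ?_
  rw [map_sub, map_mul, map_mul, inclDown_mapAdd, inclDown_logDown hW (logDerivUp_coeff hQ0 hQ0')
    (logDerivDown_coeff hP0 hP0' hP1), c]

end

section

variable {k : Type*} [Field k]

/-! ### Evolutionary derivations of `𝓡` -/

lemma eps_mul_cancel {f g : DiffRing k} (h : eps * f = eps * g) : f = g :=
  PowerSeries.X_mul_cancel h

lemma coeff_eps_mul (f : DiffRing k) (n : ℕ) :
    PowerSeries.coeff (n + 1) (eps * f) = PowerSeries.coeff n f :=
  PowerSeries.coeff_succ_X_mul n f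

lemma coeff_zero_eps_mul (f : DiffRing k) : PowerSeries.coeff 0 (eps * f) = 0 :=
  PowerSeries.coeff_zero_X_mul f

lemma exists_eq_eps_mul_add (f : DiffRing k) :
    ∃ f', f = eps * f' + PowerSeries.C (PowerSeries.coeff 0 f) := by
  refine ⟨PowerSeries.mk fun n => PowerSeries.coeff (n + 1) f, ?_⟩
  ext n : 1
  rw [map_add, PowerSeries.coeff_C]
  cases n with
  | zero => rw [coeff_zero_eps_mul, if_pos rfl, zero_add]
  | succ n => rw [coeff_eps_mul, PowerSeries.coeff_mk, if_neg n.succ_ne_zero, add_zero]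

lemma exists_eq_eps_mul {f : DiffRing k} (h : PowerSeries.coeff 0 f = 0) : ∃ f', f = eps * f' := by
  obtain ⟨f', hf'⟩ := exists_eq_eps_mul_add f
  exact ⟨f', by rw [hf', h, map_zero, add_zero]⟩

/-- An additive `ε`-linear endomorphism of `𝓡` is determined by its values on differential
polynomials. -/
lemma eq_zero_of_eps_linear (T : DiffRing k →+ DiffRing k) (h1 : ∀ f, T (eps * f) = eps * T f)
    (h2 : ∀ a, T (PowerSeries.C a) = 0) (f : DiffRing k) : T f = 0 := by
  ext n : 1
  induction n generalizing f with
  | zero =>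
    obtain ⟨f', hf'⟩ := exists_eq_eps_mul_add f
    rw [hf', map_add, h1, h2, add_zero, coeff_zero_eps_mul, map_zero]
  | succ n ih =>
    obtain ⟨f', hf'⟩ := exists_eq_eps_mul_add f
    rw [hf', map_add, h1, h2, add_zero, coeff_eps_mul, ih, map_zero, map_zero]

lemma dxR_add (f g : DiffRing k) : dxR (f + g) = dxR f + dxR g :=
  eps_mul_cancel (by rw [eps_dxR_add, mul_add])

lemma dxR_mul (f g : DiffRing k) : dxR (f * g) = dxR f * g + f * dxR g :=
  eps_mul_cancel (by rw [eps_dxR_mul]; ring)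

lemma dxR_C (a : Jet k) : dxR (PowerSeries.C a) = PowerSeries.C (dx a) := by
  ext n : 1
  rw [coeff_dxR, PowerSeries.coeff_C, PowerSeries.coeff_C]
  split_ifs
  · rfl
  · exact dx_zero

lemma dxR_eps_mul (f : DiffRing k) : dxR (eps * f) = eps * dxR f := by
  ext n : 1
  cases n with
  | zero => rw [coeff_dxR, coeff_zero_eps_mul, coeff_zero_eps_mul, dx_zero]
  | succ n => rw [coeff_dxR, coeff_eps_mul, coeff_eps_mul, coeff_dxR]

/-- `∂ₓ` as an additive endomorphism of `𝓡`. -/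
def dxRHom (k : Type*) [Field k] : DiffRing k →+ DiffRing k := AddMonoidHom.mk' dxR dxR_add

lemma coeff_dxR_iterate (f : DiffRing k) (m n : ℕ) :
    PowerSeries.coeff n (dxR^[m] f) = dx^[m] (PowerSeries.coeff n f) := by
  induction m with
  | zero => rfl
  | succ m ih => rw [Function.iterate_succ_apply', coeff_dxR, ih, Function.iterate_succ_apply']

section Evolve

variable (X : Label → DiffRing k)

/-- The derivation `Jet k → 𝓡` which is the restriction of `evolve X`. -/
def evolveDer : Derivation k (Jet k) (DiffRing k) :=
  derivAlongDer fun a : Label × ℕ => dxR^[a.2] (X a.1)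

lemma coeff_evolve (f : DiffRing k) (n : ℕ) : PowerSeries.coeff n (evolve X f) =
    ∑ p ∈ Finset.HasAntidiagonal.antidiagonal n,
      PowerSeries.coeff p.1 (evolveDer X (PowerSeries.coeff p.2 f)) := PowerSeries.coeff_mk _ _

lemma evolve_add (f g : DiffRing k) : evolve X (f + g) = evolve X f + evolve X g := by
  ext n : 1
  simp only [coeff_evolve, map_add, Finset.sum_add_distrib]

/-- `evolve X` as an additive endomorphism of `𝓡`. -/
def evolveHom : DiffRing k →+ DiffRing k := AddMonoidHom.mk' (evolve X) (evolve_add X)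

lemma evolveHom_apply (f : DiffRing k) : evolveHom X f = evolve X f := rfl

lemma evolve_eps_mul (f : DiffRing k) : evolve X (eps * f) = eps * evolve X f := by
  ext n : 1
  cases n with
  | zero =>
    rw [coeff_zero_eps_mul, coeff_evolve, Finset.sum_eq_zero]
    intro p hp
    rw [Finset.HasAntidiagonal.mem_antidiagonal] at hp
    rw [show p.2 = 0 by omega, coeff_zero_eps_mul, map_zero, map_zero]
  | succ n =>
    rw [coeff_eps_mul, coeff_evolve, coeff_evolve, Finset.Nat.sum_antidiagonal_succ',
      coeff_zero_eps_mul, map_zero, map_zero, zero_add]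
    simp only [coeff_eps_mul]

lemma evolve_C (a : Jet k) : evolve X (PowerSeries.C a) = evolveDer X a := by
  ext n : 1
  rw [coeff_evolve, Finset.sum_eq_single (n, 0)]
  · rw [PowerSeries.coeff_C, if_pos rfl]
  · intro p hp hne
    rw [Finset.HasAntidiagonal.mem_antidiagonal] at hp
    rw [PowerSeries.coeff_C, if_neg, map_zero, map_zero]
    intro h
    exact hne (Prod.ext (by omega) h)
  · intro h
    exact absurd (Finset.HasAntidiagonal.mem_antidiagonal.2 (add_zero n)) h

lemma evolve_C_jetVar (α : Label) (m : ℕ) :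
    evolve X (PowerSeries.C (jetVar α m)) = dxR^[m] (X α) := by
  rw [evolve_C]
  exact derivAlong_jetVar _ α m

lemma evolve_C_expU (n : ℤ) :
    evolve X (PowerSeries.C (expU n)) = n • (PowerSeries.C (expU n) * X Label.two) := by
  rw [evolve_C, ← PowerSeries.smul_eq_C_mul]
  exact derivAlong_expU _ n

lemma evolve_mul (f g : DiffRing k) : evolve X (f * g) = evolve X f * g + f * evolve X g := by
  have h1 (a : Jet k) (g : DiffRing k) : evolve X (PowerSeries.C a * g) =
      evolve X (PowerSeries.C a) * g + PowerSeries.C a * evolve X g := by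
    rw [← sub_eq_zero]
    refine eq_zero_of_eps_linear ((evolveHom X).comp (AddMonoidHom.mulLeft (PowerSeries.C a)) -
      (AddMonoidHom.mulLeft (evolve X (PowerSeries.C a)) +
        (AddMonoidHom.mulLeft (PowerSeries.C a)).comp (evolveHom X))) (fun f => ?_) (fun b => ?_) g
    · change evolve X (_ * (eps * f)) - (_ * (eps * f) + _ * evolve X (eps * f)) =
        eps * (evolve X (_ * f) - (_ * f + _ * evolve X f))
      rw [mul_left_comm, evolve_eps_mul, evolve_eps_mul]
      ring
    · change evolve X (PowerSeries.C a * PowerSeries.C b) - (evolve X (PowerSeries.C a) *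
        PowerSeries.C b + PowerSeries.C a * evolve X (PowerSeries.C b)) = 0
      rw [← map_mul, evolve_C, evolve_C, evolve_C, Derivation.leibniz, PowerSeries.smul_eq_C_mul,
        PowerSeries.smul_eq_C_mul]
      ring
  rw [← sub_eq_zero]
  refine eq_zero_of_eps_linear ((evolveHom X).comp (AddMonoidHom.mulRight g) -
    ((AddMonoidHom.mulRight g).comp (evolveHom X) + AddMonoidHom.mulRight (evolve X g)))
    (fun f => ?_) (fun b => ?_) f
  · change evolve X (eps * f * g) - (evolve X (eps * f) * g + eps * f * evolve X g) =
      eps * (evolve X (f * g) - (evolve X f * g + f * evolve X g))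
    rw [mul_assoc, evolve_eps_mul, evolve_eps_mul]
    ring
  · exact sub_eq_zero.2 (h1 b g)

lemma evolveDer_dx (a : Jet k) : evolveDer X (dx a) = dxR (evolveDer X a) := by
  have h0 : dxR (0 : DiffRing k) = 0 := map_zero (dxRHom k)
  induction a using jet_induction with
  | scalar c => rw [dx_algebraMap, map_zero, Derivation.map_algebraMap, h0]
  | var α m =>
    rw [dx_jetVar, ← evolve_C, ← evolve_C, evolve_C_jetVar, evolve_C_jetVar,
      Function.iterate_succ_apply']
  | exp n =>
    have e : dxR (n • (PowerSeries.C (expU n) * X Label.two)) =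
        n • dxR (PowerSeries.C (expU n) * X Label.two) := map_zsmul (dxRHom k) _ _
    rw [dx_expU, ← evolve_C, ← evolve_C, map_zsmul, map_mul, ← evolveHom_apply, map_zsmul,
      evolveHom_apply, evolve_mul, evolve_C_jetVar, evolve_C_expU, e, dxR_mul, dxR_C, dx_expU,
      Function.iterate_one, map_zsmul, map_mul]
    simp only [zsmul_eq_mul]
    ring
  | add f g hf hg => rw [dx_add, map_add, map_add, hf, hg, dxR_add]
  | mul f g hf hg =>
    simp only [dx_mul, map_add, Derivation.leibniz, hf, hg, dxR_add, PowerSeries.smul_eq_C_mul,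
      dxR_mul, dxR_C]
    ring

lemma evolve_dxR (f : DiffRing k) : evolve X (dxR f) = dxR (evolve X f) := by
  rw [← sub_eq_zero]
  refine eq_zero_of_eps_linear ((evolveHom X).comp (dxRHom k) - (dxRHom k).comp (evolveHom X))
    (fun f => ?_) (fun a => ?_) f
  · change evolve X (dxR (eps * f)) - dxR (evolve X (eps * f)) =
      eps * (evolve X (dxR f) - dxR (evolve X f))
    rw [dxR_eps_mul, evolve_eps_mul, evolve_eps_mul, dxR_eps_mul, mul_sub]
  · change evolve X (dxR (PowerSeries.C a)) - dxR (evolve X (PowerSeries.C a)) = 0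
    rw [dxR_C, evolve_C, evolve_C, evolveDer_dx, sub_self]

lemma evolve_eps_dxR (f : DiffRing k) : evolve X (eps * dxR f) = eps * dxR (evolve X f) := by
  rw [evolve_eps_mul, evolve_dxR]

lemma shift_eps_mul (j : ℤ) (f : DiffRing k) : shift j (eps * f) = eps * shift j f := by
  ext n : 1
  cases n with
  | zero => rw [coeff_zero_eps_mul, coeff_zero_shift, coeff_zero_eps_mul]
  | succ n =>
    have h (m : ℕ) : dx^[m] (0 : Jet k) = 0 := Function.iterate_fixed dx_zero m
    rw [coeff_eps_mul, shift, PowerSeries.coeff_mk, Finset.Nat.sum_antidiagonal_succ',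
      coeff_zero_eps_mul, h, smul_zero, zero_add, shift, PowerSeries.coeff_mk]
    simp only [coeff_eps_mul]

lemma coeff_shift_C (j : ℤ) (a : Jet k) (n : ℕ) : PowerSeries.coeff n (shift j (PowerSeries.C a)) =
    ((j : k) ^ n / (n.factorial : k)) • dx^[n] a := by
  rw [shift, PowerSeries.coeff_mk, Finset.sum_eq_single (n, 0)]
  · rw [PowerSeries.coeff_C, if_pos rfl]
  · intro p hp hne
    rw [Finset.HasAntidiagonal.mem_antidiagonal] at hp
    rw [PowerSeries.coeff_C, if_neg, Function.iterate_fixed dx_zero, smul_zero]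
    intro h
    exact hne (Prod.ext (by omega) h)
  · intro h
    exact absurd (Finset.HasAntidiagonal.mem_antidiagonal.2 (add_zero n)) h

lemma evolve_shift [CharZero k] (j : ℤ) (f : DiffRing k) :
    evolve X (shift j f) = shift j (evolve X f) := by
  rw [← sub_eq_zero]
  refine eq_zero_of_eps_linear ((evolveHom X).comp (shiftHom j).toAddMonoidHom -
    (shiftHom j).toAddMonoidHom.comp (evolveHom X)) (fun f => ?_) (fun a => ?_) f
  · change evolve X (shift j (eps * f)) - shift j (evolve X (eps * f)) =
      eps * (evolve X (shift j f) - shift j (evolve X f))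
    rw [shift_eps_mul, evolve_eps_mul, evolve_eps_mul, shift_eps_mul, mul_sub]
  · change evolve X (shift j (PowerSeries.C a)) - shift j (evolve X (PowerSeries.C a)) = 0
    have hD (m : ℕ) : evolveDer X (dx^[m] a) = dxR^[m] (evolveDer X a) := by
      induction m with
      | zero => rfl
      | succ m ih =>
        rw [Function.iterate_succ_apply', evolveDer_dx, ih, Function.iterate_succ_apply']
    rw [sub_eq_zero, evolve_C]
    ext n : 1
    have e : PowerSeries.coeff n (shift j (evolveDer X a)) =
        ∑ p ∈ Finset.HasAntidiagonal.antidiagonal n, ((j : k) ^ p.1 / (p.1.factorial : k)) •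
          dx^[p.1] (PowerSeries.coeff p.2 (evolveDer X a)) := PowerSeries.coeff_mk _ _
    rw [coeff_evolve, e, ← Finset.Nat.sum_antidiagonal_swap]
    refine Finset.sum_congr rfl fun p _ => ?_
    rw [Prod.fst_swap, Prod.snd_swap, coeff_shift_C, Derivation.map_smul, PowerSeries.coeff_smul,
      hD, coeff_dxR_iterate]

lemma evolve_algebraMap (c : k) :
    evolve X (PowerSeries.C (algebraMap k (Jet k) c)) = 0 := by
  rw [evolve_C, Derivation.map_algebraMap]

end Evolve

/-! ### The value at constant dependent variables -/

/-- The restriction of elements of `𝓡` to constant `v` and `u`. -/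
def evalConstR (k : Type*) [Field k] : DiffRing k →+* DiffRing k := PowerSeries.map evalConst

lemma coeff_evalConstR (f : DiffRing k) (n : ℕ) :
    PowerSeries.coeff n (evalConstR k f) = evalConst (PowerSeries.coeff n f) :=
  PowerSeries.coeff_map _ _ _

lemma evalConstR_eps : evalConstR k eps = eps := PowerSeries.map_X _

lemma evalConstR_C (a : Jet k) : evalConstR k (PowerSeries.C a) = PowerSeries.C (evalConst a) :=
  PowerSeries.map_C _ _

lemma evalConstR_dxR (f : DiffRing k) : evalConstR k (dxR f) = 0 := by
  ext n : 1
  rw [coeff_evalConstR, coeff_dxR, evalConst_dx, map_zero]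

lemma evalConstR_shift (j : ℤ) (f : DiffRing k) : evalConstR k (shift j f) = evalConstR k f := by
  ext n : 1
  rw [coeff_evalConstR, coeff_evalConstR, shift, PowerSeries.coeff_mk, map_sum,
    Finset.sum_eq_single (0, n)]
  · simp
  · intro p hp hne
    rw [Finset.HasAntidiagonal.mem_antidiagonal] at hp
    obtain ⟨m, hm⟩ : ∃ m, p.1 = m + 1 := ⟨p.1 - 1, by
      have : p.1 ≠ 0 := fun h => hne (Prod.ext h (by omega))
      omega⟩
    rw [hm, Function.iterate_succ_apply', Algebra.smul_def, map_mul, evalConst_dx, mul_zero]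
  · intro h
    exact absurd (Finset.HasAntidiagonal.mem_antidiagonal.2 (zero_add n)) h

lemma evalConstR_evolve {X : Label → DiffRing k} (hX : ∀ α, evalConstR k (X α) = 0)
    (f : DiffRing k) : evalConstR k (evolve X f) = 0 := by
  refine eq_zero_of_eps_linear ((evalConstR k).toAddMonoidHom.comp (evolveHom X))
    (fun f => ?_) (fun a => ?_) f
  · change evalConstR k (evolve X (eps * f)) = eps * evalConstR k (evolve X f)
    rw [evolve_eps_mul, map_mul, evalConstR_eps]
  · change evalConstR k (evolve X (PowerSeries.C a)) = 0
    rw [evolve_C]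
    induction a using jet_induction with
    | scalar c => rw [Derivation.map_algebraMap, map_zero]
    | var α m =>
      rw [← evolve_C, evolve_C_jetVar]
      cases m with
      | zero => exact hX α
      | succ m => rw [Function.iterate_succ_apply', evalConstR_dxR]
    | exp n => rw [← evolve_C, evolve_C_expU, map_zsmul, map_mul, hX, mul_zero,
        zsmul_zero]
    | add f g hf hg => rw [map_add, map_add, hf, hg, add_zero]
    | mul f g hf hg =>
      rw [Derivation.leibniz, PowerSeries.smul_eq_C_mul, PowerSeries.smul_eq_C_mul, map_add,
        map_mul, map_mul, hf, hg, mul_zero, mul_zero, add_zero]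

end

section

/-! ### The evolution of the logarithm -/

section TrivialAction

variable {R : Type*} [CommRing R]

/-- The action for which `Λ` is central. -/
def trivialAction (R : Type*) [CommRing R] : ShiftAction R :=
  ⟨fun _ => RingHom.id R, fun _ => rfl, fun _ _ _ => rfl⟩

lemma LowerOp.mul_comm_of_trivial (A B : LowerOp (trivialAction R)) : A * B = B * A :=
  LowerOp.ext fun n => by
    rw [coe_mul, coe_mul, opMul, opMul, ← finsum_comp_equiv (Equiv.subLeft n)]
    refine finsum_congr fun i => ?_
    rw [Equiv.subLeft_apply, sub_sub_cancel]
    exact mul_comm _ _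

end TrivialAction

variable {k : Type*} [Field k]

open LowerOp

/-- The derivation `ε ∂/∂t` of `𝓡`. -/
def epsEvolve (X : Label → DiffRing k) : DiffRing k →+ DiffRing k :=
  (AddMonoidHom.mulLeft eps).comp (evolveHom X)

lemma epsEvolve_apply (X : Label → DiffRing k) (f : DiffRing k) :
    epsEvolve X f = eps * evolve X f := rfl

lemma epsEvolve_mul (X : Label → DiffRing k) (f g : DiffRing k) :
    epsEvolve X (f * g) = epsEvolve X f * g + f * epsEvolve X g := by
  rw [epsEvolve_apply, evolve_mul, epsEvolve_apply, epsEvolve_apply]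
  ring

lemma evalConstR_epsEvolve {X : Label → DiffRing k} (hX : ∀ α, evalConstR k (X α) = 0)
    (f : DiffRing k) : evalConstR k (epsEvolve X f) = 0 := by
  rw [epsEvolve_apply, map_mul, evalConstR_evolve hX, mul_zero]

lemma epsDxR_apply (f : DiffRing k) : epsDxR k f = eps * dxR f := rfl

lemma epsDxR_mul (f g : DiffRing k) :
    epsDxR k (f * g) = epsDxR k f * g + f * epsDxR k g := eps_dxR_mul f g

lemma evalConstR_epsDxR (f : DiffRing k) : evalConstR k (epsDxR k f) = 0 := by
  rw [epsDxR_apply, map_mul, evalConstR_dxR, mul_zero]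

/-- The commutator of operators vanishes at constant `v`, `u`, where `Λ` is central. -/
lemma evalConstR_comm {τ : ShiftAction (DiffRing k)} {κ : ℤ}
    (hτ : ∀ i f, τ.hom i f = shift (κ * i) f) (A B : LowerOp τ)
    (n : ℤ) :
    evalConstR k ((A * B - B * A).coeff n) = 0 := by
  let F : LowerOp τ →+* LowerOp (trivialAction (DiffRing k)) :=
    mapHom (evalConstR k) fun j x => by rw [hτ, evalConstR_shift]; rfl
  have : F (A * B - B * A) = 0 := by
    rw [map_sub, map_mul, map_mul, mul_comm_of_trivial, sub_self]
  exact congrArg (fun A => coeff A n) this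

variable [CharZero k]

lemma eq_zero_of_dx_add_mul_eq_zero {f : Jet k} {n : ℤ}
    (h : dx f + (n : Jet k) * jetVar Label.two 1 * f = 0) (h0 : evalConst f = 0) : f = 0 := by
  have h1 : dx (f * expU n) = 0 := by
    rw [dx_mul, dx_expU, zsmul_eq_mul]
    linear_combination expU n * h
  have h2 : evalConst (f * expU n) = 0 := by rw [map_mul, h0, zero_mul]
  have h3 : f * expU n = 0 := eq_zero_of_dx_eq_zero h1 h2
  have h4 : f * (expU n * expU (-n)) = 0 := by rw [← mul_assoc, h3, zero_mul]
  rwa [← expU_add, add_neg_cancel, expU_zero, mul_one] at h4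

lemma dx_add_mul_eq_zero_of_smul {κ N s : ℤ} (hκ : κ ≠ 0) {f g : Jet k}
    (h : f * (((κ * N : ℤ) : k) • s • (expU s * jetVar Label.two 1)) + g * expU s =
      expU s * (g + ((-κ : ℤ) : k) • dx f)) :
    dx f + ((N * s : ℤ) : Jet k) * jetVar Label.two 1 * f = 0 := by
  have hκ' : (algebraMap k (Jet k) (κ : k)⁻¹) * (κ : Jet k) = 1 := by
    rw [← map_intCast (algebraMap k (Jet k)), ← map_mul,
      inv_mul_cancel₀ (Int.cast_ne_zero.2 hκ), map_one]
  have he : (expU (-s) * expU s : Jet k) = 1 := by rw [← expU_add, neg_add_cancel, expU_zero]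
  have hs (c : k) (x : Jet k) : c • x = algebraMap k (Jet k) c * x := Algebra.smul_def c x
  simp only [hs, map_intCast, zsmul_eq_mul] at h
  simp only [Int.cast_mul, Int.cast_neg] at h ⊢
  linear_combination (expU (-s) * algebraMap k (Jet k) (κ : k)⁻¹) * h -
    (dx f + (N : Jet k) * (s : Jet k) * jetVar Label.two 1 * f) * (expU (-s) * expU s) * hκ' -
    (dx f + (N : Jet k) * (s : Jet k) * jetVar Label.two 1 * f) * he

lemma coeff_zero_eq_zero_of_mul_shift_expU_eq {κ N s : ℤ} (hκ : κ ≠ 0) {d : DiffRing k}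
    (h : d * shift (κ * N) (PowerSeries.C (expU s)) = PowerSeries.C (expU s) * shift (-κ) d)
    (h0 : evalConstR k d = 0) : PowerSeries.coeff 0 d = 0 := by
  have h1 := congrArg (PowerSeries.coeff 1) h
  rw [PowerSeries.coeff_mul, PowerSeries.coeff_C_mul, Finset.Nat.sum_antidiagonal_succ,
    Finset.Nat.antidiagonal_zero, Finset.sum_singleton, zero_add, coeff_one_shift,
    coeff_one_shift, coeff_zero_shift, PowerSeries.coeff_C, PowerSeries.coeff_C, if_pos rfl,
    if_neg one_ne_zero, zero_add, dx_expU] at h1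
  refine eq_zero_of_dx_add_mul_eq_zero (dx_add_mul_eq_zero_of_smul hκ h1) ?_
  rw [← coeff_evalConstR, h0, map_zero]

/-- The equation satisfied by the leading coefficient `d` of an operator `d Λᴺ + ⋯` that commutes
with `e^{su} Λ⁻¹ + ⋯`, where `Λ` acts as the shift by `κ`: the lowest term of `d` in `ε` is a
constant multiple of `e^{-Nsu}`. Hence `d = 0` if `d` vanishes at constant `v`, `u`. -/
lemma eq_zero_of_mul_shift_expU_eq {κ N s : ℤ} (hκ : κ ≠ 0) {d : DiffRing k}
    (h : d * shift (κ * N) (PowerSeries.C (expU s)) = PowerSeries.C (expU s) * shift (-κ) d)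
    (h0 : evalConstR k d = 0) : d = 0 := by
  ext n : 1
  rw [map_zero]
  induction n generalizing d with
  | zero => exact coeff_zero_eq_zero_of_mul_shift_expU_eq hκ h h0
  | succ n ih =>
    obtain ⟨d, rfl⟩ := exists_eq_eps_mul (coeff_zero_eq_zero_of_mul_shift_expU_eq hκ h h0)
    rw [coeff_eps_mul]
    refine ih (eps_mul_cancel ?_) (eps_mul_cancel ?_)
    · rw [← mul_assoc, h, shift_eps_mul]
      ring
    · rw [mul_zero, ← h0, map_mul, evalConstR_eps]

section Half

variable {τ : ShiftAction (DiffRing k)} {κ : ℤ} {L : LowerOp τ}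

/-- An operator that commutes with `L` and vanishes at constant `v`, `u` vanishes. -/
lemma eq_zero_of_comm_lax (hκ : κ ≠ 0) (hτ : ∀ i f, τ.hom i f = shift (κ * i) f)
    (hL : ∀ n < -1, L.coeff n = 0) {s : ℤ}
    (hs : L.coeff (-1) = PowerSeries.C (expU s)) {D : LowerOp τ} (hD : D * L = L * D)
    (h0 : ∀ n, evalConstR k (D.coeff n) = 0) : D = 0 := by
  obtain ⟨N₀, hN⟩ := D.exists_bound
  have h (m : ℕ) : ∀ n < N₀ + m, D.coeff n = 0 := by
    induction m with
    | zero => simpa using hN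
    | succ m ih =>
      intro n hn
      rcases lt_or_ge n (N₀ + m) with h | h
      · exact ih n h
      have ih' : ∀ j < n, D.coeff j = 0 := fun j hj => ih j (by push_cast at hn; omega)
      have e : (D * L).coeff (n - 1) = (L * D).coeff (n - 1) := by rw [hD]
      rw [mul_coeff _ _ _ ih' hL, mul_coeff _ _ _ hL ih', sub_neg_eq_add, sub_add_cancel,
        sub_sub_cancel_left, Finset.Icc_self, Finset.Icc_self, Finset.sum_singleton,
        Finset.sum_singleton, sub_sub_cancel_left, sub_neg_eq_add, sub_add_cancel, hs, hτ, hτ,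
        mul_neg_one] at e
      exact eq_zero_of_mul_shift_expU_eq hκ e (h0 n)
  refine LowerOp.ext fun n => h (n - N₀ + 1).toNat n ?_
  have := Int.self_le_toNat (n - N₀ + 1)
  omega

lemma epsEvolve_hom (hτ : ∀ i f, τ.hom i f = shift (κ * i) f) (X : Label → DiffRing k) (j : ℤ)
    (f : DiffRing k) : epsEvolve X (τ.hom j f) = τ.hom j (epsEvolve X f) := by
  rw [hτ, hτ, epsEvolve_apply, epsEvolve_apply, shift_eps_mul, evolve_shift]

lemma epsDxR_hom (hτ : ∀ i f, τ.hom i f = shift (κ * i) f) (j : ℤ)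
    (f : DiffRing k) : epsDxR k (τ.hom j f) = τ.hom j (epsDxR k f) := by
  rw [hτ, hτ]
  exact (shift_eps_mul_dxR _ f).symm

/-- The logarithm evolves by `ε ∂y/∂t = [M, y] + ε Mₓ` whenever `ε ∂L/∂t = [M, L]`: both sides have
the same commutator with `L`. -/
lemma epsEvolve_log (hκ : κ ≠ 0) (hτ : ∀ i f, τ.hom i f = shift (κ * i) f)
    (hL : ∀ n < -1, L.coeff n = 0) {s : ℤ} (hs : L.coeff (-1) = PowerSeries.C (expU s))
    {y M : LowerOp τ} (hy : y * L - L * y = mapAdd (epsDxR k) L) {X : Label → DiffRing k}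
    (hX : ∀ α, evalConstR k (X α) = 0) (hM : mapAdd (epsEvolve X) L = M * L - L * M) :
    mapAdd (epsEvolve X) y = M * y - y * M + mapAdd (epsDxR k) M := by
  have hδ := mapAdd_mul (τ := τ) (epsEvolve_mul X) (epsEvolve_hom hτ X)
  have hd := mapAdd_mul (τ := τ) epsDxR_mul (epsDxR_hom hτ)
  have hcomm : mapAdd (epsEvolve X) (mapAdd (epsDxR k) L) =
      mapAdd (epsDxR k) (mapAdd (epsEvolve X) L) := LowerOp.ext fun n => by
    change eps * evolve X (eps * dxR (L.coeff n)) = eps * dxR (eps * evolve X (L.coeff n))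
    rw [evolve_eps_dxR, dxR_eps_mul]
  rw [hM, ← hy] at hcomm
  simp only [map_sub, hδ, hd, hM, ← hy] at hcomm
  rw [← sub_eq_zero]
  refine eq_zero_of_comm_lax hκ hτ hL hs ?_ fun n => ?_
  · rw [← sub_eq_zero] at hcomm ⊢
    rw [← hcomm]
    noncomm_ring
  · rw [sub_coeff, add_coeff, map_sub, map_add, evalConstR_comm hτ, mapAdd_coeff, mapAdd_coeff,
      evalConstR_epsEvolve hX, evalConstR_epsDxR, add_zero, sub_zero]

end Half

/-! ### Polynomials in the Lax operator -/

section Scal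

variable {R : Type*} [CommRing R] {τ : ShiftAction R}

/-- The operator of multiplication by `c`. -/
def scal (c : R) : LowerOp τ := ⟨fun n => if n = 0 then c else 0, 0, fun _ hn => if_neg hn.ne⟩

lemma scal_coeff (c : R) (n : ℤ) : (scal c : LowerOp τ).coeff n = if n = 0 then c else 0 := rfl

lemma scal_mul_coeff (c : R) (A : LowerOp τ) (n : ℤ) :
    (scal c * A).coeff n = c * A.coeff n := by
  rw [coe_mul, opMul_eq_sum τ _ _ n {0}]
  · rw [Finset.sum_singleton, scal_coeff, if_pos rfl, τ.zero_apply, sub_zero]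
  · intro i hi
    exact Or.inl (if_neg (by simpa using hi))

lemma mul_scal_coeff (A : LowerOp τ) (c : R) (n : ℤ) :
    (A * scal c).coeff n = A.coeff n * τ.hom n c := by
  rw [coe_mul, opMul_eq_sum τ _ _ n {n}]
  · rw [Finset.sum_singleton, sub_self, scal_coeff, if_pos rfl]
  · intro i hi
    rw [Finset.mem_singleton] at hi
    exact Or.inr (if_neg (by omega))

lemma scal_mul_comm {c : R} (hc : ∀ n, τ.hom n c = c) (A : LowerOp τ) :
    scal c * A = A * scal c := LowerOp.ext fun n => by
  rw [scal_mul_coeff, mul_scal_coeff, hc, mul_comm]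

lemma matches_scal (c : R) : Matches (scal c : LowerOp τ) (scal c) := fun n => by
  rw [scal_coeff, scal_coeff]
  simp only [neg_eq_zero]

/-- If a derivation acts on `L` as `[M, ·]`, it acts so on `c Lᵖ`, for constants `c`. -/
lemma mapAdd_scal_mul_pow {δ : R →+ R} (hl : ∀ f g, δ (f * g) = δ f * g + f * δ g)
    (hs : ∀ j f, δ (τ.hom j f) = τ.hom j (δ f)) {L M : LowerOp τ}
    (hM : mapAdd δ L = M * L - L * M) {c : R} (hc : ∀ n, τ.hom n c = c) (hδ : δ c = 0) (p : ℕ) :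
    mapAdd δ (scal c * L ^ p) = M * (scal c * L ^ p) - scal c * L ^ p * M := by
  have h1 : mapAdd δ (L ^ p) = M * L ^ p - L ^ p * M := by
    induction p with
    | zero =>
      rw [pow_zero, mul_one, one_mul, sub_self]
      exact mapAdd_lam hl 0
    | succ p ih =>
      rw [pow_succ, mapAdd_mul hl hs, ih, hM]
      noncomm_ring
  have h2 : mapAdd δ (scal c : LowerOp τ) = 0 := LowerOp.ext fun n => by
    rw [mapAdd_coeff, scal_coeff]
    split_ifs
    · exact hδ
    · exact map_zero δ
  rw [mapAdd_mul hl hs, h1, h2, zero_mul, zero_add, mul_sub, ← mul_assoc, scal_mul_comm hc M,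
    mul_assoc, mul_assoc]

lemma scal_mul_pow_comm {c d : R} (hc : ∀ n, τ.hom n c = c) (hd : ∀ n, τ.hom n d = d)
    (L : LowerOp τ) (p q : ℕ) :
    scal c * L ^ p * (scal d * L ^ q) = scal d * L ^ q * (scal c * L ^ p) := by
  have h1 : Commute (scal c) (scal d * L ^ q) := scal_mul_comm hc _
  have h2 : Commute (L ^ p) (scal d) := (scal_mul_comm hd (L ^ p)).symm
  have h3 : Commute (L ^ p) (L ^ q) := (Commute.refl L).pow_pow p q
  exact h1.mul_left (h2.mul_right h3)

end Scal

/-! ### Cross derivatives -/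

/-- The algebra behind tau-symmetry. With `U = f y + h` and `K = M - U`, and similarly `U'`, `K'`,
the difference of the cross derivatives is `[M, M'] - E`, where
`E = [K, K'] - f' ∂K + f ∂K'` depends only on `f`, `f'` and `K`, `K'`. -/
lemma cross_derivative_eq {A : Type*} [Ring A] {d δ δ' : A →+ A}
    (hd : ∀ a b, d (a * b) = d a * b + a * d b) (hδ : ∀ a b, δ (a * b) = δ a * b + a * δ b)
    (hδ' : ∀ a b, δ' (a * b) = δ' a * b + a * δ' b) {y f h f' h' M M' : A}
    (ff : f * f' = f' * f) (fh : f * h' = h' * f) (hf : h * f' = f' * h) (hh : h * h' = h' * h)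
    (df : d f = y * f - f * y) (dh : d h = y * h - h * y) (df' : d f' = y * f' - f' * y)
    (dh' : d h' = y * h' - h' * y) (δf : δ f' = M * f' - f' * M) (δh : δ h' = M * h' - h' * M)
    (δf' : δ' f = M' * f - f * M') (δh' : δ' h = M' * h - h * M')
    (δy : δ y = M * y - y * M + d M) (δy' : δ' y = M' * y - y * M' + d M') :
    δ (f' * y + h') - δ' (f * y + h) = (M * M' - M' * M) -
      ((M - (f * y + h)) * (M' - (f' * y + h')) - (M' - (f' * y + h')) * (M - (f * y + h)) -
        f' * d (M - (f * y + h)) + f * d (M' - (f' * y + h'))) := by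
  simp only [map_add, map_sub, hd, hδ, hδ', df, dh, df', dh', δf, δh, δf', δh', δy, δy']
  rw [← sub_eq_zero]
  have e1 : (f * f' - f' * f) * (d y - y * y) + (f' * h - h * f') * y + (h' * f - f * h') * y +
      (h' * h - h * h') = 0 := by
    rw [ff, fh, hf, hh]
    simp
  rw [← neg_eq_zero, ← e1]
  noncomm_ring

end

section

variable {k : Type*} [Field k]

open LowerOp

/-! ### Products with the Lax operator -/

/-- The constants of `𝓡`. -/
def constR (c : k) : DiffRing k := PowerSeries.C (algebraMap k (Jet k) c)

lemma smul_eq_constR_mul (c : k) (f : DiffRing k) : c • f = constR c * f := by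
  rw [constR, ← PowerSeries.smul_eq_C_mul, algebraMap_smul]

lemma constR_mul (c d : k) : constR (c * d) = constR c * constR d := by
  rw [constR, map_mul, map_mul]; rfl

lemma constR_ofNat_two : constR (2 : k) = 2 :=
  map_ofNat ((PowerSeries.C (R := Jet k)).comp (algebraMap k (Jet k))) 2

lemma constR_neg (c : k) : constR (-c) = -constR c := by
  rw [constR, map_neg, map_neg]; rfl

lemma constR_zero : constR (0 : k) = 0 := by rw [constR, map_zero, map_zero]

lemma epsEvolve_constR (X : Label → DiffRing k) (c : k) : epsEvolve X (constR c) = 0 := by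
  rw [epsEvolve_apply, constR, evolve_algebraMap, mul_zero]

lemma epsDxR_constR (c : k) : epsDxR k (constR c) = 0 := by
  rw [epsDxR_apply, constR, dxR_C, dx_algebraMap, map_zero, mul_zero]

/-- The operator `c Lᵖ y + d L^q`. -/
def halfOp {τ : ShiftAction (DiffRing k)} (L y : LowerOp τ) (c : k) (p : ℕ) (d : k) (q : ℕ) :
    LowerOp τ := scal (constR c) * L ^ p * y + scal (constR d) * L ^ q

lemma halfOp_comm {τ : ShiftAction (DiffRing k)} (hτ : ∀ c : k, ∀ n, τ.hom n (constR c) = constR c)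
    (L y : LowerOp τ) (c : k) (p : ℕ) (d : k) (q : ℕ) :
    halfOp L y c p d q * L - L * halfOp L y c p d q =
      scal (constR c) * L ^ p * (y * L - L * y) := by
  have h1 := scal_mul_comm (hτ c) L
  have h2 := scal_mul_comm (hτ d) L
  have h3 : L ^ p * L = L * L ^ p := (pow_succ L p).symm.trans (pow_succ' L p)
  have h4 : L ^ q * L = L * L ^ q := (pow_succ L q).symm.trans (pow_succ' L q)
  have h5 : L * (scal (constR c) * L ^ p) = scal (constR c) * L ^ p * L := by
    rw [← mul_assoc, ← h1, mul_assoc, mul_assoc, h3]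
  have h6 : L * (scal (constR d) * L ^ q) = scal (constR d) * L ^ q * L := by
    rw [← mul_assoc, ← h2, mul_assoc, mul_assoc, h4]
  rw [halfOp, mul_add, h6, ← mul_assoc L, h5]
  noncomm_ring

variable [CharZero k]

lemma shift_constR (j : ℤ) (c : k) : shift j (constR c) = constR c := by
  ext n : 1
  rw [constR, coeff_shift_C, PowerSeries.coeff_C]
  cases n with
  | zero => simp
  | succ n =>
    rw [Function.iterate_succ_apply, dx_algebraMap, Function.iterate_fixed dx_zero, smul_zero,
      if_neg n.succ_ne_zero]

lemma shift_sub (j : ℤ) (f g : DiffRing k) : shift j (f - g) = shift j f - shift j g :=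
  map_sub (shiftHom j) f g

lemma shift_mul (j : ℤ) (f g : DiffRing k) : shift j (f * g) = shift j f * shift j g :=
  map_mul (shiftHom j) f g

lemma shift_zero (j : ℤ) : shift j (0 : DiffRing k) = 0 := map_zero (shiftHom j)

lemma opMul_lax (b : ℤ → DiffRing k) (n : ℤ) : opMul shift b (lax k) n =
    b (n - 1) + (b n * shift n (lax k 0) + b (n + 1) * shift (n + 1) (lax k (-1))) := by
  have h := opMul_eq_sum (shiftAction k) b (lax k) n {n - 1, n, n + 1} fun i hi => by
    simp only [Finset.mem_insert, Finset.mem_singleton, not_or] at hi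
    exact Or.inr (lax_eq_zero (by omega) (by omega) (by omega))
  rw [Finset.sum_insert (by simp only [Finset.mem_insert, Finset.mem_singleton]; omega),
    Finset.sum_insert (by simp), Finset.sum_singleton,
    sub_sub_cancel, sub_self, sub_add_cancel_left, lax_one, map_one, mul_one] at h
  exact h

lemma lax_opMul (b : ℤ → DiffRing k) (n : ℤ) : opMul shift (lax k) b n =
    lax k (-1) * shift (-1) (b (n + 1)) + (lax k 0 * b n + shift 1 (b (n - 1))) := by
  have h := opMul_eq_sum (shiftAction k) (lax k) b n {-1, 0, 1} fun i hi => by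
    simp only [Finset.mem_insert, Finset.mem_singleton, not_or] at hi
    exact Or.inl (lax_eq_zero hi.1 hi.2.1 hi.2.2)
  rw [Finset.sum_insert (by decide), Finset.sum_insert (by decide), Finset.sum_singleton,
    (shiftAction k).zero_apply, sub_neg_eq_add, sub_zero, lax_one, one_mul] at h
  exact h

lemma opComm_lax (b : ℤ → DiffRing k) (n : ℤ) : opComm shift b (lax k) n =
    b (n - 1) + (b n * shift n (lax k 0) + b (n + 1) * shift (n + 1) (lax k (-1))) -
      (lax k (-1) * shift (-1) (b (n + 1)) + (lax k 0 * b n + shift 1 (b (n - 1)))) := by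
  rw [opComm, Pi.sub_apply, opMul_lax, lax_opMul]

lemma opComm_sub_lax (a b : ℤ → DiffRing k) (n : ℤ) :
    opComm shift (fun i => a i - b i) (lax k) n =
      opComm shift a (lax k) n - opComm shift b (lax k) n := by
  simp only [opComm_lax, shift_sub]
  ring

lemma comm_laxUp_coeff (A : LowerOp (shiftAction k)) (n : ℤ) :
    (A * laxUp k - laxUp k * A).coeff n = opComm shift A.coeff (lax k) n := rfl

lemma comm_laxDown_coeff (A : LowerOp (shiftAction k).rev) (n : ℤ) :
    (A * laxDown k - laxDown k * A).coeff n =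
      opComm shift (fun i => A.coeff (-i)) (lax k) (-n) := by
  have e : lax k = fun i => (laxDown k).coeff (-i) :=
    funext fun n => congrArg (lax k) (neg_neg n).symm
  have h1 := opMul_neg A (laxDown k) (-n)
  have h2 := opMul_neg (laxDown k) A (-n)
  rw [← e, neg_neg] at h1 h2
  rw [sub_coeff, ← h1, ← h2]
  rfl

lemma coeff_zero_opComm_lax (b : ℤ → DiffRing k) (n : ℤ) :
    PowerSeries.coeff 0 (opComm shift b (lax k) n) = 0 := by
  have hm (f g : DiffRing k) : PowerSeries.coeff 0 (f * g) =
      PowerSeries.coeff 0 f * PowerSeries.coeff 0 g := by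
    rw [PowerSeries.coeff_mul, Finset.Nat.antidiagonal_zero, Finset.sum_singleton]
  rw [opComm_lax]
  simp only [map_sub, map_add, hm, coeff_zero_shift]
  ring

lemma evalConstR_opComm_lax (b : ℤ → DiffRing k) (n : ℤ) :
    evalConstR k (opComm shift b (lax k) n) = 0 := by
  rw [opComm_lax]
  simp only [map_sub, map_add, map_mul, evalConstR_shift]
  ring

lemma matches_lax : Matches (laxUp k) (laxDown k) :=
  fun n => congrArg (lax k) (neg_neg n).symm

lemma opPow_lax (p : ℕ) : opPow shift (lax k) p = (laxUp k ^ p).coeff := by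
  induction p with
  | zero => rfl
  | succ p ih => rw [opPow, ih, pow_succ]; rfl

lemma exists_support_laxUp_pow (p : ℕ) :
    ∃ S : Finset ℤ, ∀ i ∉ S, (laxUp k ^ p).coeff i = 0 := by
  obtain ⟨a, ha⟩ := (laxUp k ^ p).exists_bound
  obtain ⟨b, hb⟩ := (laxDown k ^ p).exists_bound
  refine ⟨Finset.Icc a (-b), fun i hi => ?_⟩
  rw [Finset.mem_Icc, not_and_or] at hi
  rcases hi with hi | hi
  · exact ha i (by omega)
  · rw [matches_lax.pow p i]
    exact hb _ (by omega)

/-! ### The operators that generate the flows -/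

/-- The operator `c Lᵖ (2 log L) + d L^q`: the operators `B_{β,q}` with `A_{β,q} = (B_{β,q})₊` are
of this form. -/
def fullOp (g : ℤ → DiffRing k) (c : k) (p : ℕ) (d : k) (q : ℕ) (n : ℤ) : DiffRing k :=
  (halfOp (laxUp k) (logUp g) c p d q).coeff n -
    (halfOp (laxDown k) (logDown g) c p 0 q).coeff (-n)

lemma logUp_sub_logDown (g : ℤ → DiffRing k) (n : ℤ) :
    (logUp g).coeff n - (logDown g).coeff (-n) = 2 * g n := by
  change (if 0 ≤ n then 2 * g n else 0) - (if 0 < -n then -(2 * g (- -n)) else 0) = 2 * g n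
  rw [neg_neg]
  split_ifs <;> first | omega | ring

lemma two_mul_laxPowLog (g : ℤ → DiffRing k) (p : ℕ) (n : ℤ) : 2 * laxPowLog g p n =
    (laxUp k ^ p * logUp g).coeff n - (laxDown k ^ p * logDown g).coeff (-n) -
      2 * constR ((harmonic p : ℚ) : k) * (laxUp k ^ p).coeff n := by
  obtain ⟨S, hS⟩ := exists_support_laxUp_pow (k := k) p
  have hsum (A : LowerOp (shiftAction k)) (B : ℤ → DiffRing k) (hA : ∀ i ∉ S, A.coeff i = 0) :
      opMul shift A.coeff B n = ∑ i ∈ S, A.coeff i * shift i (B (n - i)) :=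
    opMul_eq_sum (shiftAction k) A.coeff B n S fun i hi => Or.inl (hA i hi)
  have e1 : (laxUp k ^ p * logUp g).coeff n =
      ∑ i ∈ S, (laxUp k ^ p).coeff i * shift i ((logUp g).coeff (n - i)) := hsum _ _ hS
  have e2 : (laxDown k ^ p * logDown g).coeff (-n) =
      ∑ i ∈ S, (laxUp k ^ p).coeff i * shift i ((logDown g).coeff (-(n - i))) := by
    rw [← opMul_neg, ← hsum (laxUp k ^ p) (fun j => (logDown g).coeff (-j)) hS,
      show (fun i => (laxDown k ^ p).coeff (-i)) = (laxUp k ^ p).coeff from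
        funext fun i => (matches_lax.pow p i).symm]
    rfl
  have e3 : (laxUp k ^ p).coeff n =
      ∑ i ∈ S, (laxUp k ^ p).coeff i * shift i ((opShift 0 : ℤ → DiffRing k) (n - i)) := by
    rw [← hsum _ _ hS]
    conv_lhs => rw [← mul_one (laxUp k ^ p)]
    rfl
  rw [laxPowLog, opPow_lax, hsum _ _ hS, e1, e2, e3, Finset.mul_sum, Finset.mul_sum,
    ← Finset.sum_sub_distrib, ← Finset.sum_sub_distrib]
  refine Finset.sum_congr rfl fun i _ => ?_
  have h2 : shift i ((logUp g).coeff (n - i)) - shift i ((logDown g).coeff (-(n - i))) =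
      2 * shift i (g (n - i)) := by
    rw [← shift_sub, logUp_sub_logDown, ← constR_ofNat_two, shift_mul, shift_constR]
  rw [Pi.sub_apply, Pi.smul_apply, smul_eq_constR_mul, shift_sub, shift_mul, shift_constR]
  linear_combination -(laxUp k ^ p).coeff i * h2

/-- The data `(c, p, d, q)` for which `fullOp g c p d q` generates the flow `∂/∂t^{β,q}`. -/
def flowData (k : Type*) [Field k] : Label → ℕ → k × ℕ × k × ℕ
  | Label.one, q => ((q.factorial : k)⁻¹, q,
      -((q.factorial : k)⁻¹ * (2 * ((harmonic q : ℚ) : k))), q)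
  | Label.two, q => (0, 0, ((q + 1).factorial : k)⁻¹, q + 1)

/-- The operator `B_{β,q}`: the flows are generated by `A_{β,q} = (B_{β,q})₊`, and the Hamiltonian
densities are the residues of the `B_{α,p}`. -/
def flowOp (g : ℤ → DiffRing k) (β : Label) (q : ℕ) : ℤ → DiffRing k :=
  fullOp g (flowData k β q).1 (flowData k β q).2.1 (flowData k β q).2.2.1 (flowData k β q).2.2.2

lemma fullOp_eq (g : ℤ → DiffRing k) (c : k) (p : ℕ) (d : k) (q : ℕ) (n : ℤ) :
    fullOp g c p d q n = constR c * ((laxUp k ^ p * logUp g).coeff n -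
      (laxDown k ^ p * logDown g).coeff (-n)) + constR d * (laxUp k ^ q).coeff n := by
  rw [fullOp, halfOp, halfOp, add_coeff, add_coeff, mul_assoc, mul_assoc, scal_mul_coeff,
    scal_mul_coeff, scal_mul_coeff, scal_mul_coeff, constR_zero]
  ring

lemma flowOp_one (g : ℤ → DiffRing k) (q : ℕ) (n : ℤ) :
    flowOp g Label.one q n = (2 / (q.factorial : k)) • laxPowLog g q n := by
  have h := two_mul_laxPowLog g q n
  rw [flowOp, fullOp_eq, flowData, smul_eq_constR_mul, div_eq_mul_inv, constR_mul, constR_neg,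
    constR_mul, constR_mul, constR_ofNat_two]
  linear_combination -constR (q.factorial : k)⁻¹ * h

lemma flowOp_two (g : ℤ → DiffRing k) (q : ℕ) (n : ℤ) : flowOp g Label.two q n =
    (1 / ((q + 1).factorial : k)) • opPow shift (lax k) (q + 1) n := by
  rw [flowOp, fullOp_eq, flowData, smul_eq_constR_mul, constR_zero, opPow_lax, one_div]
  ring

lemma laxA_eq (g : ℤ → DiffRing k) (β : Label) (q : ℕ) : laxA g β q = opPlus (flowOp g β q) := by
  funext n
  cases β with
  | one =>
    rw [laxA, Pi.smul_apply, opPlus, opPlus, flowOp_one]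
    split_ifs
    · rfl
    · exact smul_zero _
  | two =>
    rw [laxA, Pi.smul_apply, opPlus, opPlus, flowOp_two]
    split_ifs
    · rfl
    · exact smul_zero _

lemma hamDensityPred_eq (g : ℤ → DiffRing k) (α : Label) (p : ℕ) :
    hamDensityPred g α p = flowOp g α p 0 := by
  cases α with
  | one => rw [flowOp_one]; rfl
  | two => rw [flowOp_two]; rfl

/-! ### Existence of the flows -/

lemma shiftAction_hom_constR (c : k) (n : ℤ) : (shiftAction k).hom n (constR c) = constR c :=
  shift_constR n c

lemma shiftAction_rev_hom_constR (c : k) (n : ℤ) :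
    (shiftAction k).rev.hom n (constR c) = constR c := shift_constR (-n) c

lemma matches_laxMono (c : k) (p : ℕ) : Matches (scal (constR c) * laxUp k ^ p)
    (scal (constR c) * laxDown k ^ p) := (matches_scal _).mul (matches_lax.pow p)

/-- The operator `c Lᵖ (2 log L) + d L^q` commutes with `L`. -/
lemma opComm_fullOp_lax {g : ℤ → DiffRing k} (h : IsLogLax g) (c : k) (p : ℕ) (d : k) (q : ℕ)
    (n : ℤ) : opComm shift (fullOp g c p d q) (lax k) n = 0 := by
  have e1 := comm_laxUp_coeff (halfOp (laxUp k) (logUp g) c p d q) n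
  have e2 := comm_laxDown_coeff (halfOp (laxDown k) (logDown g) c p 0 q) (-n)
  rw [halfOp_comm shiftAction_hom_constR, h.logUp_comm] at e1
  rw [halfOp_comm shiftAction_rev_hom_constR, h.logDown_comm, neg_neg] at e2
  have e3 := (matches_laxMono c p).mul (matches_lax.mapAdd (epsDxR k)) n
  change opComm shift (fun i => _ - _) (lax k) n = 0
  rw [opComm_sub_lax, ← e1, ← e2, e3, sub_self]

lemma opComm_opPlus_eq_zero {B : ℤ → DiffRing k} (hB : ∀ n, opComm shift B (lax k) n = 0) {n : ℤ}
    (h0 : n ≠ 0) (h1 : n ≠ -1) : opComm shift (opPlus B) (lax k) n = 0 := by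
  rcases lt_or_ge n 0 with hn | hn
  · have h (m : ℤ) (hm : m < 0) : opPlus B m = 0 := if_neg (not_le.2 hm)
    rw [opComm_lax, h _ (by omega), h _ (by omega), h _ (by omega), shift_zero, shift_zero]
    ring
  · have h (m : ℤ) (hm : 0 ≤ m) : opPlus B m = B m := if_pos hm
    rw [← hB n, opComm_lax, opComm_lax, h _ (by omega), h _ (by omega), h _ (by omega)]

/-- If `B` commutes with `L`, then `[B₊, L]` is an operator of the form `ε (X¹ + e^u X² Λ⁻¹)`. -/
lemma exists_evolve_lax {B : ℤ → DiffRing k} (hB : ∀ n, opComm shift B (lax k) n = 0) :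
    ∃ X : Label → DiffRing k,
      ∀ n, eps * evolve X (lax k n) = opComm shift (opPlus B) (lax k) n := by
  obtain ⟨e, he⟩ := exists_eq_eps_mul (coeff_zero_opComm_lax (opPlus B) 0)
  obtain ⟨f, hf⟩ := exists_eq_eps_mul (coeff_zero_opComm_lax (opPlus B) (-1))
  let X : Label → DiffRing k
    | Label.one => e
    | Label.two => PowerSeries.C (expU (-1)) * f
  refine ⟨X, fun n => ?_⟩
  rcases eq_or_ne n 0 with rfl | h0
  · rw [lax_zero, evolve_C_jetVar, he]
    rfl
  rcases eq_or_ne n (-1) with rfl | h1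
  · have hX : PowerSeries.C (expU 1) * X Label.two = f := by
      change PowerSeries.C (expU 1) * (PowerSeries.C (expU (-1)) * f) = f
      rw [← mul_assoc, ← map_mul, ← expU_add, add_neg_cancel, expU_zero, map_one, one_mul]
    rw [lax_neg_one, evolve_C_expU, one_zsmul, hX, hf]
  rw [opComm_opPlus_eq_zero hB h0 h1]
  have hz : evolve X (0 : DiffRing k) = 0 := map_zero (evolveHom X)
  rcases eq_or_ne n 1 with rfl | h2
  · rw [lax_one, ← map_one PowerSeries.C, evolve_C, Derivation.map_one_eq_zero, mul_zero]
  · rw [lax_eq_zero h1 h0 h2, hz, mul_zero]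

lemma exists_flowOp_eq (g : ℤ → DiffRing k) (β : Label) (q : ℕ) :
    ∃ c p d r, flowOp g β q = fullOp g c p d r := ⟨_, _, _, _, rfl⟩

theorem exists_isExtendedToda {g : ℤ → DiffRing k} (h : IsLogLax g) :
    ∃ X : Label → ℕ → Label → DiffRing k, IsExtendedToda g X := by
  choose X hX using fun (β : Label) (q : ℕ) =>
    show ∃ X : Label → DiffRing k, ∀ n, eps * evolve X (lax k n) =
        opComm shift (opPlus (flowOp g β q)) (lax k) n by
      obtain ⟨c, p, d, r, e⟩ := exists_flowOp_eq g β q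
      rw [e]
      exact exists_evolve_lax (opComm_fullOp_lax h c p d r)
  refine ⟨X, fun β q n => ?_⟩
  rw [hX, laxA_eq]

/-! ### Tau-symmetry -/

/-- The vector fields of the flows vanish at constant `v`, `u`. -/
lemma evalConstR_eq_zero_of_flow {X : Label → DiffRing k} {B : ℤ → DiffRing k}
    (hX : ∀ n, eps * evolve X (lax k n) = opComm shift B (lax k) n) (α : Label) :
    evalConstR k (X α) = 0 := by
  have h (n : ℤ) : evalConstR k (evolve X (lax k n)) = 0 := by
    refine eps_mul_cancel ?_
    rw [← evalConstR_eps, ← map_mul, hX, evalConstR_opComm_lax, mul_zero]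
  cases α with
  | one =>
    have := h 0
    rwa [lax_zero, evolve_C_jetVar] at this
  | two =>
    have := h (-1)
    rw [lax_neg_one, evolve_C_expU, one_zsmul, map_mul, evalConstR_C, evalConst_expU] at this
    calc evalConstR k (X Label.two)
        = PowerSeries.C (expU (-1)) * (PowerSeries.C (expU 1) * evalConstR k (X Label.two)) := by
          rw [← mul_assoc, ← map_mul, ← expU_add, neg_add_cancel, expU_zero, map_one, one_mul]
      _ = 0 := by rw [this, mul_zero]

/-- The part `B₊` of `B`, as an operator bounded below. -/
def plusOp (B : ℤ → DiffRing k) : LowerOp (shiftAction k) :=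
  ⟨opPlus B, 0, fun _ hn => if_neg (not_le.2 hn)⟩

/-- The part `-B₋` of `B`, as an operator bounded above. -/
def minusOp (B : ℤ → DiffRing k) : LowerOp (shiftAction k).rev :=
  ⟨fun n => if 0 < n then -B (-n) else 0, 0, fun _ hn => if_neg (by omega)⟩

lemma plusOp_sub_minusOp (B : ℤ → DiffRing k) (n : ℤ) :
    (plusOp B).coeff n - (minusOp B).coeff (-n) = B n := by
  change (if 0 ≤ n then B n else 0) - (if 0 < -n then -B (- -n) else 0) = B n
  rw [neg_neg]
  split_ifs <;> first | omega | ring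

lemma plusOp_comm {X : Label → DiffRing k} {B : ℤ → DiffRing k}
    (hX : ∀ n, eps * evolve X (lax k n) = opComm shift (opPlus B) (lax k) n) :
    mapAdd (epsEvolve X) (laxUp k) = plusOp B * laxUp k - laxUp k * plusOp B :=
  LowerOp.ext fun n => (hX n).trans (comm_laxUp_coeff (plusOp B) n).symm

lemma minusOp_comm {X : Label → DiffRing k} {B : ℤ → DiffRing k}
    (hB : ∀ n, opComm shift B (lax k) n = 0)
    (hX : ∀ n, eps * evolve X (lax k n) = opComm shift (opPlus B) (lax k) n) :
    mapAdd (epsEvolve X) (laxDown k) = minusOp B * laxDown k - laxDown k * minusOp B := by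
  refine LowerOp.ext fun n => (hX (-n)).trans ?_
  have e : (fun i => (minusOp B).coeff (-i)) = fun i => opPlus B i - B i := funext fun i => by
    rw [← plusOp_sub_minusOp B i]
    change _ = (plusOp B).coeff i - _
    ring
  rw [comm_laxDown_coeff, e, opComm_sub_lax, hB, sub_zero]

/-- The identity `cross_derivative_eq` for the flows, in either of the two rings of operators. -/
lemma cross_derivative_halfOp {τ : ShiftAction (DiffRing k)} {κ : ℤ} (hκ : κ ≠ 0)
    (hτ : ∀ i f, τ.hom i f = shift (κ * i) f) {L y : LowerOp τ} (hL : ∀ n < -1, L.coeff n = 0)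
    {s : ℤ} (hs : L.coeff (-1) = PowerSeries.C (expU s))
    (hy : y * L - L * y = mapAdd (epsDxR k) L) {X X' : Label → DiffRing k}
    (hX : ∀ α, evalConstR k (X α) = 0) (hX' : ∀ α, evalConstR k (X' α) = 0) {M M' : LowerOp τ}
    (hM : mapAdd (epsEvolve X) L = M * L - L * M)
    (hM' : mapAdd (epsEvolve X') L = M' * L - L * M')
    (c c' d d' : k) (p p' q q' : ℕ) :
    mapAdd (epsEvolve X) (halfOp L y c' p' d' q') - mapAdd (epsEvolve X') (halfOp L y c p d q) =
      (M * M' - M' * M) -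
      ((M - halfOp L y c p d q) * (M' - halfOp L y c' p' d' q') -
        (M' - halfOp L y c' p' d' q') * (M - halfOp L y c p d q) -
        scal (constR c') * L ^ p' * mapAdd (epsDxR k) (M - halfOp L y c p d q) +
        scal (constR c) * L ^ p * mapAdd (epsDxR k) (M' - halfOp L y c' p' d' q')) := by
  have hc (c : k) (n : ℤ) : τ.hom n (constR c) = constR c := by rw [hτ, shift_constR]
  have hcomm (c d : k) (p q : ℕ) := scal_mul_pow_comm (hc c) (hc d) L p q
  have hd (c : k) (p : ℕ) := mapAdd_scal_mul_pow epsDxR_mul (epsDxR_hom hτ) hy.symm (hc c)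
    (epsDxR_constR c) p
  have hδ (c : k) (p : ℕ) := mapAdd_scal_mul_pow (epsEvolve_mul X) (epsEvolve_hom hτ X) hM (hc c)
    (epsEvolve_constR X c) p
  have hδ' (c : k) (p : ℕ) := mapAdd_scal_mul_pow (epsEvolve_mul X') (epsEvolve_hom hτ X') hM'
    (hc c) (epsEvolve_constR X' c) p
  exact cross_derivative_eq (mapAdd_mul epsDxR_mul (epsDxR_hom hτ))
    (mapAdd_mul (epsEvolve_mul X) (epsEvolve_hom hτ X))
    (mapAdd_mul (epsEvolve_mul X') (epsEvolve_hom hτ X'))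
    (hcomm _ _ _ _) (hcomm _ _ _ _) (hcomm _ _ _ _) (hcomm _ _ _ _)
    (hd _ _) (hd _ _) (hd _ _) (hd _ _) (hδ _ _) (hδ _ _) (hδ' _ _) (hδ' _ _)
    (epsEvolve_log hκ hτ hL hs hy hX hM) (epsEvolve_log hκ hτ hL hs hy hX' hM')

lemma plusOp_coeff_of_neg (B : ℤ → DiffRing k) (n : ℤ) (hn : n < 0) : (plusOp B).coeff n = 0 :=
  if_neg (not_le.2 hn)

lemma minusOp_coeff_of_lt (B : ℤ → DiffRing k) (n : ℤ) (hn : n < 1) : (minusOp B).coeff n = 0 :=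
  if_neg (by omega)

lemma comm_plusOp_coeff_zero (B B' : ℤ → DiffRing k) :
    (plusOp B * plusOp B' - plusOp B' * plusOp B).coeff 0 = 0 := by
  have h (B B' : ℤ → DiffRing k) : (plusOp B * plusOp B').coeff 0 = B 0 * B' 0 := by
    rw [mul_coeff _ _ _ (plusOp_coeff_of_neg B) (plusOp_coeff_of_neg B'), sub_zero,
      Finset.Icc_self, Finset.sum_singleton, (shiftAction k).zero_apply]
    rfl
  rw [sub_coeff, h, h, mul_comm, sub_self]

lemma comm_minusOp_coeff_zero (B B' : ℤ → DiffRing k) :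
    (minusOp B * minusOp B' - minusOp B' * minusOp B).coeff 0 = 0 := by
  have h (B B' : ℤ → DiffRing k) : (minusOp B * minusOp B').coeff 0 = 0 :=
    opMul_bound _ (minusOp_coeff_of_lt B) (minusOp_coeff_of_lt B') 0 (by omega)
  rw [sub_coeff, h, h, sub_self]

/-- The operator `K = B₊ - U` is the finite operator `-B₋ - V`, where `B = U - V`. -/
lemma matches_plusOp_sub (g : ℤ → DiffRing k) (c : k) (p : ℕ) (d : k) (q : ℕ) :
    Matches (plusOp (fullOp g c p d q) - halfOp (laxUp k) (logUp g) c p d q)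
      (minusOp (fullOp g c p d q) - halfOp (laxDown k) (logDown g) c p 0 q) := fun n => by
  have h := plusOp_sub_minusOp (fullOp g c p d q) n
  rw [sub_coeff, sub_coeff]
  have e : fullOp g c p d q n = (halfOp (laxUp k) (logUp g) c p d q).coeff n -
    (halfOp (laxDown k) (logDown g) c p 0 q).coeff (-n) := rfl
  linear_combination h + e

theorem evolve_fullOp_comm {g : ℤ → DiffRing k} (hg : IsLogLax g) {X X' : Label → DiffRing k}
    (c c' d d' : k) (p p' q q' : ℕ)
    (hX : ∀ n, eps * evolve X (lax k n) = opComm shift (opPlus (fullOp g c p d q)) (lax k) n)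
    (hX' : ∀ n, eps * evolve X' (lax k n) =
      opComm shift (opPlus (fullOp g c' p' d' q')) (lax k) n) :
    evolve X (fullOp g c' p' d' q' 0) = evolve X' (fullOp g c p d q 0) := by
  have hφ := evalConstR_eq_zero_of_flow hX
  have hφ' := evalConstR_eq_zero_of_flow hX'
  have up := cross_derivative_halfOp (τ := shiftAction k) (κ := 1) one_ne_zero
    (fun i f => by rw [one_mul]; rfl) (L := laxUp k)
    (fun n hn => lax_eq_zero (by omega) (by omega) (by omega)) (s := 1) lax_neg_one
    hg.logUp_comm hφ hφ' (plusOp_comm hX) (plusOp_comm hX') c c' d d' p p' q q'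
  have down := cross_derivative_halfOp (τ := (shiftAction k).rev) (κ := -1)
    (neg_ne_zero.2 one_ne_zero) (fun i f => by rw [neg_one_mul]; rfl) (L := laxDown k)
    (fun n hn => lax_eq_zero (by omega) (by omega) (by omega)) (s := 0)
    (by rw [expU_zero, map_one, ← lax_one]; exact congrArg (lax k) (neg_neg 1))
    hg.logDown_comm hφ hφ' (minusOp_comm (opComm_fullOp_lax hg _ _ _ _) hX)
    (minusOp_comm (opComm_fullOp_lax hg _ _ _ _) hX') c c' 0 0 p p' q q'
  have hK := matches_plusOp_sub g c p d q
  have hK' := matches_plusOp_sub g c' p' d' q'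
  have hE := ((((hK.mul hK').sub (hK'.mul hK)).sub
    ((matches_laxMono c' p').mul (hK.mapAdd (epsDxR k)))).add
    ((matches_laxMono c p).mul (hK'.mapAdd (epsDxR k)))) 0
  have up0 := congrArg (fun A => coeff A 0) up
  have down0 := congrArg (fun A => coeff A 0) down
  simp only [sub_coeff (mapAdd _ _), sub_coeff (plusOp _ * plusOp _ - _),
    sub_coeff (minusOp _ * minusOp _ - _), mapAdd_coeff] at up0 down0
  rw [comm_plusOp_coeff_zero] at up0
  rw [comm_minusOp_coeff_zero] at down0
  rw [neg_zero] at hE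
  refine eps_mul_cancel ?_
  rw [← epsEvolve_apply, ← epsEvolve_apply]
  change epsEvolve X (coeff _ 0 - coeff _ (-0)) = epsEvolve X' (coeff _ 0 - coeff _ (-0))
  rw [neg_zero, map_sub, map_sub]
  linear_combination up0 - down0 - hE

theorem evolve_hamDensityPred_comm {g : ℤ → DiffRing k} (hg : IsLogLax g)
    {X : Label → ℕ → Label → DiffRing k} (hX : IsExtendedToda g X) (α β : Label) (p q : ℕ) :
    evolve (X β q) (hamDensityPred g α p) = evolve (X α p) (hamDensityPred g β q) := by
  have h (β : Label) (q : ℕ) (n : ℤ) : eps * evolve (X β q) (lax k n) =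
      opComm shift (opPlus (flowOp g β q)) (lax k) n := by rw [hX, laxA_eq]
  have h1 := h β q
  have h2 := h α p
  obtain ⟨c, l, d, r, e⟩ := exists_flowOp_eq g β q
  obtain ⟨c', l', d', r', e'⟩ := exists_flowOp_eq g α p
  rw [e] at h1
  rw [e'] at h2
  rw [hamDensityPred_eq, hamDensityPred_eq, e, e']
  exact evolve_fullOp_comm hg c c' d d' l l' r r' h1 h2

end

end ExtendedToda

end

open ExtendedToda in
theorem theorem4p2 (k : Type*) [Field k] [CharZero k] :
    (∃ g : ℤ → DiffRing k, IsLogLax g) ∧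
    ∀ g : ℤ → DiffRing k, IsLogLax g →
      (∃ X : Label → ℕ → Label → DiffRing k, IsExtendedToda g X) ∧
      ∀ X : Label → ℕ → Label → DiffRing k, IsExtendedToda g X →
        ∀ (α β : Label) (p q : ℕ),
          evolve (X β q) (hamDensityPred g α p) = evolve (X α p) (hamDensityPred g β q) :=
  ⟨exists_isLogLax, fun _ hg => ⟨exists_isExtendedToda hg, fun _ hX =>
    evolve_hamDensityPred_comm hg hX⟩⟩
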